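/- Let ${\bf P}^1$ be the complex projective line, with its sheaf ${\cal O}$ of holomorphic functions. A holomorphic vector bundle is a locally free sheaf of ${\cal O}$-modules of finite rank. The degree of a vector bundle $E$ is the degree of its determinant line bundle, i.e. the degree of the divisor of a nonzero meromorphic section of $\det E$. A vector bundle $E$ is semistable of slope $w$ if $\deg E = w\cdot {\rm rk}\, E$ and $\deg F\le w\cdot {\rm rk}\, F$ for every coherent subsheaf $F\subset E$ (such an $F$ is again a vector bundle); in particular, the zero bundle is semistable of every slope. A mixed twistor structure $(E,W)$ is a vector bundle $E$ on ${\bf P}^1$ with an increasing filtration $(W_i)_{i\in {\bf Z}}$ by strict subbundles (i.e. $W_i$ and $E/W_i$ are vector bundles), with $W_i=0$ for $i\ll 0$ and $W_i=E$ for $i\gg 0$, such that $Gr^W_i(E)=W_i/W_{i-1}$ is semistable of slope $i$ for every $i\in{\bf Z}$. A morphism $f:(E,W)\rightarrow (E',W')$ is a morphism of sheaves of ${\cal O}$-modules with $f(W_i)\subset W'_i$ for all $i$. Theorem. The category of mixed twistor structures, with the usual addition of morphisms, is abelian. More precisely, for every morphism $f:(E,W)\rightarrow (E',W')$ of mixed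 twistor structures: (1) the kernel of $f$ in the category of sheaves of ${\cal O}$-modules, with the induced filtration $W_i\cap \ker f$, is a mixed twistor structure, and it is the kernel of $f$ in the category of mixed twistor structures; (2) the cokernel of $f$ in the category of sheaves of ${\cal O}$-modules, filtered by the images of the $W'_i$, is a mixed twistor structure, and it is the cokernel of $f$ in the category of mixed twistor structures; (3) the canonical morphism from the coimage of $f$ to the image of $f$ is an isomorphism of mixed twistor structures; (4) $f$ is strict: $f(W_i)=f(E)\cap W'_i$ for every $i$. -/

import Mathlib

open CategoryTheory CategoryTheory.Limits TopologicalSpace Opposite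
open scoped Manifold ContDiff

noncomputable section

namespace Twistor

/-! ## The projective line as a compact complex curve -/

/-- The complex projective line, as the Riemann sphere `ℂ ∪ {∞}`. -/
abbrev P1 : Type := OnePoint ℂ

/-- The coordinate `w = 1 / z`, extended by `w(∞) = 0` (and by the junk value `0` at `z = 0`). -/
def invCoord : P1 → ℂ
  | none => 0
  | some z => z⁻¹

/-- The inverse of the coordinate `w = 1 / z`. -/
def invParam (w : ℂ) : P1 := if w = 0 then OnePoint.infty else ((w⁻¹ : ℂ) : P1)

@[simp] lemma invCoord_infty : invCoord OnePoint.infty = 0 := rfl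

@[simp] lemma invCoord_coe (z : ℂ) : invCoord (z : P1) = z⁻¹ := rfl

lemma continuousOn_invCoord : ContinuousOn invCoord {((0 : ℂ) : P1)}ᶜ := by
  intro x hx
  apply ContinuousAt.continuousWithinAt
  induction x using OnePoint.rec with
  | infty =>
    rw [OnePoint.continuousAt_infty']
    simpa [Function.comp_def, ← Metric.cobounded_eq_cocompact] using
      Filter.tendsto_inv₀_cobounded (α := ℂ)
  | coe z =>
    have hz : z ≠ 0 := by
      rintro rfl
      exact hx rfl
    rw [OnePoint.continuousAt_coe]
    exact continuousAt_inv₀ hz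

lemma continuous_invParam : Continuous invParam := by
  rw [continuous_iff_continuousAt]
  intro w
  by_cases hw : w = 0
  · subst hw
    have h : Filter.Tendsto invParam (nhdsWithin 0 {0}ᶜ) (nhds OnePoint.infty) := by
      have h1 : Filter.Tendsto (fun w : ℂ => ((w⁻¹ : ℂ) : P1)) (nhdsWithin 0 {0}ᶜ)
          (nhds OnePoint.infty) := by
        refine OnePoint.tendsto_coe_infty.comp ?_
        rw [Filter.coclosedCompact_eq_cocompact, ← Metric.cobounded_eq_cocompact]
        exact Filter.tendsto_inv₀_nhdsNE_zero
      refine h1.congr' ?_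
      filter_upwards [self_mem_nhdsWithin] with w hw
      simp only [Set.mem_compl_iff, Set.mem_singleton_iff] at hw
      simp [invParam, hw]
    rw [continuousAt_iff_punctured_nhds]
    simpa [invParam] using h
  · have h : ContinuousAt (fun w : ℂ => ((w⁻¹ : ℂ) : P1)) w :=
      OnePoint.continuous_coe.continuousAt.comp (continuousAt_inv₀ hw)
    refine h.congr ?_
    filter_upwards [isOpen_ne.mem_nhds hw] with v hv
    have hv' : v ≠ 0 := hv
    simp [invParam, hv']

/-- The affine chart `z`, defined on `P1 ∖ {∞}`. -/
def chartZ : OpenPartialHomeomorph P1 ℂ :=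
  (OnePoint.isOpenEmbedding_coe.toOpenPartialHomeomorph ((↑) : ℂ → P1)).symm

/-- The affine chart `w = 1 / z`, defined on `P1 ∖ {0}`. -/
def chartW : OpenPartialHomeomorph P1 ℂ where
  toFun := invCoord
  invFun := invParam
  source := {((0 : ℂ) : P1)}ᶜ
  target := Set.univ
  map_source' _ _ := trivial
  map_target' w _ := by
    by_cases hw : w = 0
    · simp [invParam, hw]
    · simp [invParam, hw]
  left_inv' x hx := by
    induction x using OnePoint.rec with
    | infty => simp [invParam]
    | coe z =>
      have hz : z ≠ 0 := by
        rintro rfl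
        exact hx rfl
      simp [invParam, hz]
  right_inv' w _ := by
    by_cases hw : w = 0
    · simp [invParam, hw]
    · simp [invParam, hw]
  open_source := isOpen_compl_singleton
  open_target := isOpen_univ
  continuousOn_toFun := continuousOn_invCoord
  continuousOn_invFun := continuous_invParam.continuousOn

lemma chartZ_symm_apply (z : ℂ) : chartZ.symm z = (z : P1) := rfl

lemma chartW_symm_apply (w : ℂ) : chartW.symm w = invParam w := rfl

lemma chartW_symm_zero_notMem (h : chartW.symm 0 ∈ chartZ.source) : False := by
  rw [chartW_symm_apply] at h
  simp [chartZ, invParam] at h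

/-- The complex atlas of the projective line: the two affine charts `z` and `w = 1 / z`. -/
instance : ChartedSpace ℂ P1 where
  atlas := {chartZ, chartW}
  chartAt
    | none => chartW
    | some _ => chartZ
  mem_chart_source x := by
    rcases x with _ | z
    · exact OnePoint.infty_ne_coe 0
    · change (z : P1) ∈ chartZ.source
      simp [chartZ]
  chart_mem_atlas x := by
    rcases x with _ | z
    · exact Or.inr rfl
    · exact Or.inl rfl

/-- The transition function `w = 1 / z` of the atlas is holomorphic. -/
instance : IsManifold 𝓘(ℂ) ω P1 := by
  apply isManifold_of_contDiffOn
  have key : ∀ s : Set ℂ, (∀ z ∈ s, z ≠ 0) → ContDiffOn ℂ ω (fun z : ℂ => z⁻¹) s :=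
    fun s hs => contDiffOn_id.inv hs
  rintro e e' (rfl | rfl) (rfl | rfl)
  · refine contDiffOn_id.congr fun z _ => ?_
    exact chartZ.right_inv trivial
  · refine (key _ ?_).congr fun z hz => ?_
    · rintro z hz rfl
      exact hz.1.2 rfl
    · rfl
  · refine (key _ ?_).congr fun z hz => ?_
    · rintro z hz rfl
      exact chartW_symm_zero_notMem hz.1.2
    · have hz0 : z ≠ 0 := by
        rintro rfl
        exact chartW_symm_zero_notMem hz.1.2
      have h : chartW.symm z = ((z⁻¹ : ℂ) : P1) := by
        simp [chartW_symm_apply, invParam, hz0]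
      change chartZ (chartW.symm z) = z⁻¹
      rw [h]
      exact chartZ.right_inv (x := z⁻¹) trivial
  · refine contDiffOn_id.congr fun z _ => ?_
    exact chartW.right_inv trivial

/-- The sheaf of rings of holomorphic functions on the projective line (a function on an open subset
of a complex curve is holomorphic if and only if it is infinitely complex differentiable). -/
abbrev structureSheaf : Sheaf (Opens.grothendieckTopology (TopCat.of P1)) RingCat.{0} :=
  smoothSheafRing 𝓘(ℂ) 𝓘(ℂ) P1 ℂ

/-- Sheaves of modules over the sheaf of holomorphic functions on the projective line. -/
abbrev Mod : Type 1 := SheafOfModules.{0} structureSheaf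


/-- The ring of holomorphic functions on an open subset `U` of the projective line. -/
abbrev Fun (U : Opens P1) : Type := structureSheaf.obj.obj (op U)

/-- The value of a holomorphic function on `U` at a point of `U`. -/
def Fun.value {U : Opens P1} (g : Fun U) (x : P1) (hx : x ∈ U) : ℂ :=
  (show ContMDiffMap 𝓘(ℂ) 𝓘(ℂ) U ℂ ∞ from g) ⟨x, hx⟩

/-! ## Vector bundles, rank and degree -/

/-- The module of sections of a sheaf of modules over an open subset. -/
abbrev Sec (E : Mod) (U : Opens P1) : Type := E.val.obj (op U)

/-- Restriction of sections. -/
def restrict (E : Mod) {V U : Opens P1} (h : V ≤ U) (s : Sec E U) : Sec E V :=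
  (E.val.map (homOfLE h).op).hom s

/-- `e` is a frame of `E` over `U`, i.e. it defines an isomorphism from the free sheaf of rank `r`
on `U` to the restriction of `E` to `U`. -/
def IsFrame (E : Mod) {r : ℕ} (U : Opens P1) (e : Fin r → Sec E U) : Prop :=
  ∀ (V : Opens P1) (h : V ≤ U),
    LinearIndependent (Fun V) (fun i => restrict E h (e i)) ∧
      Submodule.span (Fun V) (Set.range fun i => restrict E h (e i)) = ⊤

/-- `E` is a holomorphic vector bundle of rank `r`: a locally free sheaf of modules of rank `r`. -/
def IsBundleOfRank (E : Mod) (r : ℕ) : Prop :=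
  ∀ x : P1, ∃ U : Opens P1, x ∈ U ∧ ∃ e : Fin r → Sec E U, IsFrame E U e

/-- `E` is a holomorphic vector bundle (the projective line is connected, so that the rank
is constant). -/
def IsBundle (E : Mod) : Prop := ∃ r : ℕ, IsBundleOfRank E r

/-- `f` is a meromorphic function near `x` (possibly not defined, hence with an arbitrary value,
at a pole) whose order at `x` is the integer `n`; in particular `f` is not identically zero
near `x`. -/
def HasOrderAt (f : P1 → ℂ) (x : P1) (n : ℤ) : Prop :=
  MeromorphicAt (f ∘ (chartAt ℂ x).symm) (chartAt ℂ x x) ∧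
    meromorphicOrderAt (f ∘ (chartAt ℂ x).symm) (chartAt ℂ x x) = n

/-- A nonzero meromorphic section `σ` of the determinant line bundle `⋀ʳ E` of a vector bundle `E`
of rank `r`, with its divisor. The section is given by its coefficients with respect to all local
frames: `σ = coeff U e • (e₁ ∧ ⋯ ∧ eᵣ)` over `U`. -/
structure MeromorphicDetSection (E : Mod) (r : ℕ) where
  /-- The coefficient of the section in the frame `e₁ ∧ ⋯ ∧ eᵣ` of the determinant. -/
  coeff : ∀ (U : Opens P1), (Fin r → Sec E U) → P1 → ℂ
  /-- The divisor of the section. -/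
  divisor : P1 →₀ ℤ
  hasOrderAt : ∀ (U : Opens P1) (e : Fin r → Sec E U), IsFrame E U e →
    ∀ x ∈ U, HasOrderAt (coeff U e) x (divisor x)
  /-- Change of frame: if `e'ⱼ = ∑ᵢ gᵢⱼ eᵢ`, then `e'₁ ∧ ⋯ ∧ e'ᵣ = det(g) e₁ ∧ ⋯ ∧ eᵣ`. -/
  coeff_eq : ∀ (U U' : Opens P1) (e : Fin r → Sec E U) (e' : Fin r → Sec E U'),
    IsFrame E U e → IsFrame E U' e' → ∀ g : Matrix (Fin r) (Fin r) (Fun (U ⊓ U')),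
    (∀ j, restrict E inf_le_right (e' j) = ∑ i, g i j • restrict E inf_le_left (e i)) →
    ∀ (x : P1) (hx : x ∈ U ⊓ U'),
      coeff U e x = (g.map fun a => Fun.value a x hx).det * coeff U' e' x

/-- The vector bundle `E` of rank `r` has degree `d`: the divisor of some nonzero meromorphic
section of its determinant line bundle has degree `d`. -/
def HasDegree (E : Mod) (r : ℕ) (d : ℤ) : Prop :=
  ∃ σ : MeromorphicDetSection E r, (σ.divisor.sum fun _ n => n) = d

/-- `E` is a semistable vector bundle of slope `w`: its degree is `w` times its rank, and all
subsheaves `F` that are vector bundles, of rank `s` and degree `d`, have slope `d / s ≤ w`. (On a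
smooth curve, every coherent subsheaf of a vector bundle is a vector bundle.) The zero bundle
is semistable of every slope. -/
def IsSemistableOfSlope (E : Mod) (w : ℤ) : Prop :=
  ∃ r : ℕ, IsBundleOfRank E r ∧ HasDegree E r (w * r) ∧
    ∀ (F : Mod) (i : F ⟶ E) [Mono i] (s : ℕ) (d : ℤ),
      IsBundleOfRank F s → HasDegree F s d → d ≤ w * s

/-! ## Filtered objects of an abelian category -/

universe v u

/-- An object with an increasing filtration by subobjects, indexed by the integers. -/
structure FilteredObj (C : Type u) [Category.{v} C] where
  /-- The underlying object. -/
  obj : C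
  /-- The filtration. -/
  W : ℤ → Subobject obj
  monotone : Monotone W

namespace FilteredObj

variable {C : Type u} [Category.{v} C]

/-- A morphism of filtered objects: a morphism that maps `W i` to `W i` for all `i`. -/
@[ext]
structure Hom (A B : FilteredObj C) where
  /-- The underlying morphism. -/
  hom : A.obj ⟶ B.obj
  factors : ∀ i, (B.W i).Factors ((A.W i).arrow ≫ hom)

instance : Category (FilteredObj C) where
  Hom := Hom
  id A := ⟨𝟙 _, fun i => by
    rw [Category.comp_id]
    exact Subobject.factors_self _⟩
  comp {A B D} f g := ⟨f.hom ≫ g.hom, fun i => by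
    have h : (A.W i).arrow ≫ f.hom ≫ g.hom =
        (B.W i).factorThru _ (f.factors i) ≫ (B.W i).arrow ≫ g.hom := by
      rw [← Category.assoc, ← Category.assoc, Subobject.factorThru_arrow]
    rw [h]
    exact Subobject.factors_of_factors_right _ (g.factors i)⟩

@[simp] lemma id_hom (A : FilteredObj C) : Hom.hom (𝟙 A) = 𝟙 A.obj := rfl

@[simp] lemma comp_hom {A B D : FilteredObj C} (f : A ⟶ B) (g : B ⟶ D) :
    Hom.hom (f ≫ g) = f.hom ≫ g.hom := rfl

@[ext] lemma hom_ext {A B : FilteredObj C} {f g : A ⟶ B} (h : f.hom = g.hom) : f = g :=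
  Hom.ext h

variable [Abelian C]

instance (A B : FilteredObj C) : Zero (A ⟶ B) :=
  ⟨⟨0, fun i => by rw [comp_zero]; exact Subobject.factors_zero⟩⟩

instance (A B : FilteredObj C) : Add (A ⟶ B) :=
  ⟨fun f g => ⟨f.hom + g.hom, fun i => by
    rw [Preadditive.comp_add]
    exact Subobject.factors_add _ _ (f.factors i) (g.factors i)⟩⟩

instance (A B : FilteredObj C) : Neg (A ⟶ B) :=
  ⟨fun f => ⟨-f.hom, fun i => by
    have h : (A.W i).arrow ≫ (-f.hom) = (B.W i).factorThru _ (f.factors i) ≫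
        (-(B.W i).arrow) := by
      rw [Preadditive.comp_neg, Preadditive.comp_neg, Subobject.factorThru_arrow]
    rw [h, Preadditive.comp_neg, ← Preadditive.neg_comp]
    exact Subobject.factors_comp_arrow _⟩⟩

@[simp] lemma zero_hom (A B : FilteredObj C) : Hom.hom (0 : A ⟶ B) = 0 := rfl

@[simp] lemma add_hom {A B : FilteredObj C} (f g : A ⟶ B) :
    Hom.hom (f + g) = f.hom + g.hom := rfl

@[simp] lemma neg_hom {A B : FilteredObj C} (f : A ⟶ B) : Hom.hom (-f) = -f.hom := rfl

instance (A B : FilteredObj C) : AddCommGroup (A ⟶ B) where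
  add_assoc f g h := by ext; simp [add_assoc]
  zero_add f := by ext; simp
  add_zero f := by ext; simp
  nsmul := nsmulRec
  zsmul := zsmulRec
  neg_add_cancel f := by ext; simp
  add_comm f g := by ext; simp [add_comm]

instance : Preadditive (FilteredObj C) where
  add_comp _ _ _ _ _ _ := by ext; simp
  comp_add _ _ _ _ _ _ := by ext; simp

/-- The graded piece `Gr i = W i / W (i - 1)`. -/
def gr (A : FilteredObj C) (i : ℤ) : C :=
  cokernel (Subobject.ofLE (A.W (i - 1)) (A.W i) (A.monotone (by lia)))

/-- The kernel of the underlying morphism, with the filtration induced from the source: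
`W i (ker f) = ker f ∩ W i A`. -/
def ker {A B : FilteredObj C} (f : A ⟶ B) : FilteredObj C where
  obj := kernel f.hom
  W i := (Subobject.pullback (kernel.ι f.hom)).obj (A.W i)
  monotone _ _ h := (Subobject.pullback (kernel.ι f.hom)).monotone (A.monotone h)

/-- The inclusion of the kernel. -/
def kerι {A B : FilteredObj C} (f : A ⟶ B) : ker f ⟶ A :=
  Hom.mk (kernel.ι f.hom) fun i => by
    have h := (Subobject.isPullback (kernel.ι f.hom) (A.W i)).w
    exact h ▸ Subobject.factors_comp_arrow _

/-- The cokernel of the underlying morphism, with the filtration induced from the target: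
`W i (coker f)` is the image of `W i B`. -/
def coker {A B : FilteredObj C} (f : A ⟶ B) : FilteredObj C where
  obj := cokernel f.hom
  W i := imageSubobject ((B.W i).arrow ≫ cokernel.π f.hom)
  monotone i j h := by
    have h' : (B.W i).arrow ≫ cokernel.π f.hom =
        Subobject.ofLE _ _ (B.monotone h) ≫ (B.W j).arrow ≫ cokernel.π f.hom := by
      rw [← Category.assoc, Subobject.ofLE_arrow]
    beta_reduce
    rw [h']
    exact imageSubobject_comp_le _ _

/-- The projection to the cokernel. -/
def cokerπ {A B : FilteredObj C} (f : A ⟶ B) : B ⟶ coker f :=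
  Hom.mk (cokernel.π f.hom) fun i => by
    have h := imageSubobject_factors_comp_self (f := (B.W i).arrow ≫ cokernel.π f.hom) (𝟙 _)
    rwa [Category.id_comp] at h

lemma kerι_comp {A B : FilteredObj C} (f : A ⟶ B) : kerι f ≫ f = 0 := by
  ext
  exact kernel.condition f.hom

lemma comp_cokerπ {A B : FilteredObj C} (f : A ⟶ B) : f ≫ cokerπ f = 0 := by
  ext
  exact cokernel.condition f.hom

end FilteredObj

/-! ## Mixed twistor structures -/

/-- A filtered sheaf of modules `(E, W)` is a mixed twistor structure if `E` is a vector bundle,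
`W` is a finite increasing filtration by strict subbundles (i.e. `W i` and `E / W i` are vector
bundles), and `Gr i = W i / W (i - 1)` is pure of weight `i`, i.e. semistable of slope `i`,
for all `i`. -/
structure IsMixedTwistorStructure (A : FilteredObj Mod) : Prop where
  isBundle : IsBundle A.obj
  eventually_zero : ∃ a : ℤ, IsZero (A.W a : Mod)
  eventually_top : ∃ b : ℤ, A.W b = ⊤
  isBundle_W : ∀ i, IsBundle (A.W i : Mod)
  isBundle_quotient : ∀ i, IsBundle (cokernel (A.W i).arrow)
  isSemistableOfSlope_gr : ∀ i, IsSemistableOfSlope (A.gr i) i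

/-- The category of mixed twistor structures: its morphisms are the morphisms of sheaves of modules
that preserve the weight filtrations. -/
abbrev MixedTwistorStructure : Type 1 :=
  ObjectProperty.FullSubcategory (C := FilteredObj Mod) IsMixedTwistorStructure

/-- Morphisms of mixed twistor structures are added as morphisms of sheaves of modules. -/
instance MixedTwistorStructure.preadditive : Preadditive MixedTwistorStructure :=
  inferInstanceAs
    (Preadditive (ObjectProperty.FullSubcategory (C := FilteredObj Mod) IsMixedTwistorStructure))

end Twistor

end

/-!
The argument rests on three properties of semistable bundles of integral slopes on the projective
line, collected in `IsPureFamily`: there are no nonzero morphisms from larger to smaller slopes,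
kernels and cokernels of morphisms between bundles of the same slope `w` are again semistable of
slope `w`, and so are extensions. All three are formal consequences of the existence, the uniqueness
and the additivity of the degree, with one exception: that the cokernel is locally free.

**Bundles.** Holomorphic germs in one variable are ordered by divisibility, so that matrices of
functions can be column reduced near every point (`exists_reduced_basis`). Hence kernels and images
of morphisms of bundles are bundles. If `A ⟶ B` is a monomorphism of bundles whose cokernel is not a
bundle, then a section of the cokernel is annihilated exactly by the ideal sheaf of some point
(`isBundle_or_exists_torsion`). Pulling back along this section enlarges the image of `A` to a
subsheaf of `B` of the same rank and of larger degree, because the ideal sheaf of a point has degree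
`-1`. For semistable `A` and `B` of the same slope this is impossible
(`IsSemistableOfSlope.isBundle_cokernel`).

**The degree.** A meromorphic section of the determinant is obtained by hand. A line bundle on `ℂ`
given by a cocycle is trivial near a circle, because a circle is a union of short arcs meeting in
points, near which the Cousin problem is solved by cutting a Cauchy integral into two parts
(`exists_mul_split_of_finite`); it is trivial near a disc, because discs grow by annuli, where an
invertible function is a power of `z` times invertible functions inside and outside
(`exists_laurent_mul`). Thus the determinant is trivial on two discs that cover the projective line,
with a power of `z` as transition function, up to invertible functions that extend to one of the
discs (`IsBundleOfRank.exists_hasDegree`). The degree is unique since meromorphic functions have as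
many zeros as poles, which follows from Liouville's theorem after division by an explicit rational
function (`HasDegree.unique`). It is additive since the transition matrices of an extension are
block triangular (`HasDegree.of_shortExact`).

**Strictness.** What remains holds for filtered objects in any abelian category whose graded pieces
belong to such a family (`IsMixed`). For a morphism `f`, apply the snake lemma to the extensions of
`Gr i` by `W (i - 1)`. By induction on `i`, the cokernel of `f` on `W (i - 1)` is an iterated
extension of objects of slopes at most `i - 1`, so that it receives no nonzero morphism from the
kernel of `Gr i f`, which has slope `i`. The connecting homomorphism therefore vanishes, and the
kernels and the cokernels of the restrictions of `f` to the `W i` are filtered with graded pieces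
`ker (Gr i f)` and `coker (Gr i f)`. This shows that kernels and cokernels are mixed
(`IsMixed.ker`, `IsMixed.coker`), and that the cokernels of the restrictions embed into the cokernel
of `f`, which is strictness (`IsMixed.strict`). Strictness shows that a morphism is an isomorphism
as soon as the underlying morphism is one; applied to the comparison of the coimage with the image,
this makes the category abelian.
-/

noncomputable section

namespace Twistor

/-! ### Additive splitting of holomorphic functions -/

section Splitting

open Metric Set Filter Topology

lemma differentiableAt_intervalIntegral {F F' : ℂ → ℝ → ℂ} {a b : ℝ} {s : Set ℂ} {z₀ : ℂ}
    (hs : s ∈ 𝓝 z₀) (hF : ∀ z ∈ s, Continuous (F z))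
    (hF' : ContinuousOn (Function.uncurry F') (s ×ˢ univ))
    (h : ∀ z ∈ s, ∀ t, HasDerivAt (fun z => F z t) (F' z t) z) :
    DifferentiableAt ℂ (fun z => ∫ t in a..b, F z t) z₀ := by
  obtain ⟨δ, hδ, hδs⟩ := nhds_basis_closedBall.mem_iff.mp hs
  have hK : IsCompact (closedBall z₀ δ ×ˢ uIcc a b) :=
    (isCompact_closedBall _ _).prod isCompact_uIcc
  obtain ⟨C, hC⟩ := hK.exists_bound_of_continuousOn
    (hF'.mono (prod_mono hδs (subset_univ _)))
  have hz₀ : z₀ ∈ s := mem_of_mem_nhds hs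
  have hc : Continuous (F' z₀) := by
    rw [← continuousOn_univ]
    exact hF'.comp (by fun_prop : Continuous fun t : ℝ => (z₀, t)).continuousOn
      fun t _ => ⟨hz₀, trivial⟩
  refine (intervalIntegral.hasDerivAt_integral_of_dominated_loc_of_deriv_le
    (bound := fun _ => C) (F' := F') (closedBall_mem_nhds z₀ hδ) ?_
    ((hF z₀ hz₀).intervalIntegrable _ _) hc.aestronglyMeasurable ?_
    (continuous_const.intervalIntegrable _ _) ?_).2.differentiableAt
  · filter_upwards [hs] with z hz
    exact (hF z hz).aestronglyMeasurable
  · refine Eventually.of_forall fun t ht z hz => ?_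
    exact hC (z, t) ⟨hz, uIoc_subset_uIcc ht⟩
  · exact Eventually.of_forall fun t _ z hz => h z (hδs hz) t

/-- A Cauchy integral over a circle with a continuous density is holomorphic wherever the density
vanishes nearby. -/
lemma differentiableAt_circleIntegral_div {k : ℂ → ℂ} (hk : Continuous k) (c : ℂ) (R : ℝ)
    {z₀ : ℂ} {δ : ℝ} (hδ : 0 < δ) (hz : ∀ t : ℝ, dist (circleMap c R t) z₀ < δ →
      k =ᶠ[𝓝 (circleMap c R t)] 0) :
    DifferentiableAt ℂ (fun z => ∮ ζ in C(c, R), (ζ - z)⁻¹ • k ζ) z₀ := by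
  have key : ∀ m : ℕ, ContinuousOn (Function.uncurry fun (z : ℂ) (t : ℝ) =>
      deriv (circleMap c R) t * ((circleMap c R t - z)⁻¹ ^ m * k (circleMap c R t)))
      (ball z₀ (δ / 2) ×ˢ univ) := by
    rintro m ⟨z, t⟩ ⟨hz', -⟩
    apply ContinuousAt.continuousWithinAt
    by_cases h : dist (circleMap c R t) z₀ < δ
    · have h1 : Tendsto (fun p : ℂ × ℝ => circleMap c R p.2) (𝓝 (z, t))
          (𝓝 (circleMap c R t)) :=
        ((continuous_circleMap c R).comp continuous_snd).continuousAt
      refine (continuousAt_const (y := (0 : ℂ))).congr ?_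
      filter_upwards [h1.eventually (hz t h)] with p hp
      simp only [Function.uncurry]
      simp only [Pi.zero_apply] at hp
      rw [hp]; simp
    · have hne : circleMap c R t - z ≠ 0 := by
        intro h0
        rw [sub_eq_zero] at h0
        rw [h0] at h
        have : dist z z₀ < δ / 2 := hz'
        linarith
      simp only [Function.uncurry_def, deriv_circleMap]
      have h2 : Continuous fun p : ℂ × ℝ => circleMap c R p.2 :=
        (continuous_circleMap c R).comp continuous_snd
      have h3 : Continuous fun p : ℂ × ℝ => circleMap 0 R p.2 :=
        (continuous_circleMap 0 R).comp continuous_snd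
      have h4 : ContinuousAt (fun p : ℂ × ℝ => (circleMap c R p.2 - p.1)⁻¹) (z, t) :=
        (h2.sub continuous_fst).continuousAt.inv₀ hne
      have h5 : ContinuousAt (fun p : ℂ × ℝ => k (circleMap c R p.2)) (z, t) :=
        (hk.comp h2).continuousAt
      exact (h3.continuousAt.mul continuousAt_const).mul ((h4.pow m).mul h5)
  have := differentiableAt_intervalIntegral (a := 0) (b := 2 * Real.pi) (z₀ := z₀)
    (ball_mem_nhds z₀ (half_pos hδ)) (fun z hz' => ?_) (key 2) (F := fun z t =>
      deriv (circleMap c R) t * ((circleMap c R t - z)⁻¹ ^ 1 * k (circleMap c R t))) ?_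
  · simpa [circleIntegral] using this
  · rw [← continuousOn_univ]
    exact (key 1).comp (by fun_prop : Continuous fun t : ℝ => (z, t)).continuousOn
      fun t _ => ⟨hz', trivial⟩
  · intro z hz' t
    by_cases h : dist (circleMap c R t) z₀ < δ
    · have : k (circleMap c R t) = 0 := (hz t h).self_of_nhds
      simp only [this, mul_zero]
      exact hasDerivAt_const _ _
    · have hne : circleMap c R t - z ≠ 0 := by
        intro h0
        rw [sub_eq_zero] at h0
        rw [h0] at h
        have : dist z z₀ < δ / 2 := hz'
        linarith
      refine HasDerivAt.const_mul _ (HasDerivAt.mul_const ?_ _)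
      have := ((hasDerivAt_id z).const_sub (circleMap c R t)).inv hne
      simp only [id, neg_neg, one_div] at this
      simp only [pow_one, inv_pow]
      exact this

/-- Cousin splitting on a disc whose boundary circle misses `K₁ ∩ K₂`: the Cauchy integral is cut
into two parts by a weight that is supported away from `K₁`, resp. `K₂`. -/
lemma exists_cauchy_split {K₁ K₂ : Set ℂ} (hK₁ : IsClosed K₁) (hK₂ : IsClosed K₂) {p : ℂ} {ρ : ℝ}
    (hρ : 0 < ρ) (hd : K₁ ∩ K₂ ∩ sphere p ρ = ∅) {g : ℂ → ℂ} (hg : ContinuousOn g (closedBall p ρ))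
    (hg' : DifferentiableOn ℂ g (ball p ρ)) :
    ∃ N₁ N₂ : Set ℂ, IsOpen N₁ ∧ IsOpen N₂ ∧ K₁ ⊆ N₁ ∧ K₂ ⊆ N₂ ∧ ∃ G₁ G₂ : ℂ → ℂ,
      DifferentiableOn ℂ G₁ N₁ ∧ DifferentiableOn ℂ G₂ N₂ ∧
      ∀ z ∈ N₁ ∩ N₂, z ∉ sphere p ρ ∧ (z ∈ ball p ρ → G₁ z + G₂ z = g z) ∧
        (z ∉ closedBall p ρ → G₁ z + G₂ z = 0) := by
  obtain ⟨u, hu0, hu1, -⟩ := exists_continuous_zero_one_of_isClosed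
    (hK₁.inter (isClosed_sphere (x := p) (ε := ρ)))
    (hK₂.inter (isClosed_sphere (x := p) (ε := ρ))) (by
      rw [Set.disjoint_iff_inter_eq_empty, ← hd]
      ext z
      simp only [mem_inter_iff]
      tauto)
  -- the weight vanishes where `u ≤ 1 / 3` and is one where `u ≥ 2 / 3`
  let χ : ℂ → ℝ := fun z => max 0 (min 1 (3 * u z - 1))
  have hχ : Continuous χ := by fun_prop
  have hχ0 : ∀ z, u z < 1 / 3 → χ z = 0 := fun z hz => by
    simp only [χ]
    rw [max_eq_left]
    exact (min_le_right _ _).trans (by linarith)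
  have hχ1 : ∀ z, 2 / 3 < u z → χ z = 1 := fun z hz => by
    simp only [χ]
    rw [min_eq_left (by linarith), max_eq_right zero_le_one]
  -- a continuous extension of the boundary values
  obtain ⟨ge, hge, hge'⟩ : ∃ ge : ℂ → ℂ, Continuous ge ∧ EqOn ge g (sphere p ρ) := by
    have h1 : ContinuousOn g (sphere p ρ) := hg.mono sphere_subset_closedBall
    obtain ⟨e, he⟩ := ContinuousMap.exists_restrict_eq (isClosed_sphere (x := p) (ε := ρ))
      ⟨(sphere p ρ).domRestrict g, continuousOn_iff_continuous_domRestrict.mp h1⟩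
    refine ⟨e, e.continuous, fun z hz => ?_⟩
    exact congrArg (fun f : C(sphere p ρ, ℂ) => f ⟨z, hz⟩) he
  let I : (ℂ → ℂ) → ℂ → ℂ := fun k z => (2 * Real.pi * Complex.I : ℂ)⁻¹ *
    ∮ ζ in C(p, ρ), (ζ - z)⁻¹ • k ζ
  have hI : ∀ (k : ℂ → ℂ), Continuous k → ∀ (N : Set ℂ), IsOpen N →
      (∀ z ∈ sphere p ρ ∩ N, k =ᶠ[𝓝 z] 0) → DifferentiableOn ℂ (I k) N := by
    intro k hk N hN hkN z hz
    refine (DifferentiableAt.const_mul ?_ _).differentiableWithinAt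
    obtain ⟨δ, hδ, hδN⟩ := Metric.isOpen_iff.mp hN z hz
    refine differentiableAt_circleIntegral_div hk p ρ hδ fun t ht => hkN _ ⟨?_, hδN ht⟩
    exact circleMap_mem_sphere _ hρ.le _
  let k₁ : ℂ → ℂ := fun z => χ z * ge z
  let k₂ : ℂ → ℂ := fun z => (1 - χ z) * ge z
  have hk₁ : Continuous k₁ := by fun_prop
  have hk₂ : Continuous k₂ := by fun_prop
  have hN₁ : IsOpen ((sphere p ρ)ᶜ ∪ {z | u z < 1 / 3}) :=
    isClosed_sphere.isOpen_compl.union (isOpen_lt (by fun_prop) (by fun_prop))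
  have hN₂ : IsOpen ((sphere p ρ)ᶜ ∪ {z | 2 / 3 < u z}) :=
    isClosed_sphere.isOpen_compl.union (isOpen_lt (by fun_prop) (by fun_prop))
  have hN : ∀ z ∈ ((sphere p ρ)ᶜ ∪ {z | u z < 1 / 3}) ∩ ((sphere p ρ)ᶜ ∪ {z | 2 / 3 < u z}),
      z ∉ sphere p ρ := by
    rintro z ⟨h1 | h1, h2 | h2⟩
    · exact h1
    · exact h1
    · exact h2
    · simp only [mem_ofPred_eq] at h1 h2
      linarith
  have hsum : ∀ z, z ∉ sphere p ρ → I k₁ z + I k₂ z =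
      (2 * Real.pi * Complex.I : ℂ)⁻¹ * ∮ ζ in C(p, ρ), (ζ - z)⁻¹ • g ζ := by
    intro z hz
    have hint : ∀ k : ℂ → ℂ, Continuous k →
        CircleIntegrable (fun ζ => (ζ - z)⁻¹ • k ζ) p ρ := by
      intro k hk
      apply ContinuousOn.circleIntegrable hρ.le
      refine ContinuousOn.smul (ContinuousOn.inv₀ (continuousOn_id.sub continuousOn_const)
        fun ζ hζ h0 => ?_) hk.continuousOn
      replace h0 := sub_eq_zero.mp h0
      exact hz ((show ζ = z from h0) ▸ hζ)
    simp only [I]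
    rw [← mul_add, ← circleIntegral.integral_add (hint _ hk₁) (hint _ hk₂)]
    congr 1
    refine circleIntegral.integral_congr hρ.le fun ζ hζ => ?_
    simp only [k₁, k₂, smul_eq_mul, ← hge' hζ]
    ring
  refine ⟨_, _, hN₁, hN₂, ?_, ?_, I k₁, I k₂, hI _ hk₁ _ hN₁ ?_, hI _ hk₂ _ hN₂ ?_, ?_⟩
  · intro z hz
    by_cases hs : z ∈ sphere p ρ
    · right
      have : u z = 0 := hu0 ⟨hz, hs⟩
      simp [this]
    · exact Or.inl hs
  · intro z hz
    by_cases hs : z ∈ sphere p ρ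
    · right
      have : u z = 1 := hu1 ⟨hz, hs⟩
      simp only [mem_ofPred_eq, this]
      norm_num
    · exact Or.inl hs
  · rintro z ⟨hz, hz' | hz'⟩
    · exact absurd hz hz'
    · have : ∀ᶠ y in 𝓝 z, u y < 1 / 3 := u.continuous.continuousAt.eventually_lt_const hz'
      filter_upwards [this] with y hy
      simp [k₁, hχ0 y hy]
  · rintro z ⟨hz, hz' | hz'⟩
    · exact absurd hz hz'
    · have : ∀ᶠ y in 𝓝 z, 2 / 3 < u y := u.continuous.continuousAt.eventually_const_lt hz'
      filter_upwards [this] with y hy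
      simp [k₂, hχ1 y hy]
  · intro z hz
    refine ⟨hN z hz, fun hb => ?_, fun hb => ?_⟩
    · rw [hsum z (hN z hz), Complex.circleIntegral_sub_inv_smul_of_differentiable_on_off_countable
        countable_empty hb hg (fun x hx => (hg'.differentiableAt (isOpen_ball.mem_nhds hx.1)))]
      rw [smul_eq_mul, ← mul_assoc, inv_mul_cancel₀ Complex.two_pi_I_ne_zero, one_mul]
    · rw [hsum z (hN z hz), Complex.circleIntegral_eq_zero_of_differentiable_on_off_countable hρ.le
        countable_empty, mul_zero]
      · refine ContinuousOn.smul (ContinuousOn.inv₀ (continuousOn_id.sub continuousOn_const)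
          fun ζ hζ h0 => ?_) hg
        replace h0 : ζ = z := sub_eq_zero.mp h0
        exact hb (h0 ▸ hζ)
      · intro ζ hζ
        refine DifferentiableAt.smul
          (DifferentiableAt.inv (differentiableAt_id.sub_const z) fun h0 => ?_)
          (hg'.differentiableAt (isOpen_ball.mem_nhds hζ.1))
        replace h0 : ζ = z := sub_eq_zero.mp h0
        exact hb (h0 ▸ ball_subset_closedBall hζ.1)

lemma exists_open_inter_subset {X : Type*} [TopologicalSpace X] [T2Space X] {K₁ K₂ O : Set X}
    (h₁ : IsCompact K₁) (h₂ : IsCompact K₂) (hO : IsOpen O) (h : K₁ ∩ K₂ ⊆ O) :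
    ∃ N₁ N₂ : Set X, IsOpen N₁ ∧ IsOpen N₂ ∧ K₁ ⊆ N₁ ∧ K₂ ⊆ N₂ ∧ N₁ ∩ N₂ ⊆ O := by
  obtain ⟨A, B, hA, hB, hA', hB', hd⟩ := SeparatedNhds.of_isCompact_isCompact (h₁.diff hO) h₂ (by
    rw [Set.disjoint_left]
    exact fun z hz hz' => hz.2 (h ⟨hz.1, hz'⟩))
  refine ⟨A ∪ O, B, hA.union hO, hB, fun z hz => ?_, hB', ?_⟩
  · by_cases hzO : z ∈ O
    · exact Or.inr hzO
    · exact Or.inl (hA' ⟨hz, hzO⟩)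
  · rintro z ⟨hz | hz, hz'⟩
    · exact absurd hz' (Set.disjoint_left.mp hd hz)
    · exact hz

/-- Multiplicative Cousin problem for two compact sets that meet in finitely many points. -/
lemma exists_mul_split_of_finite {K₁ K₂ : Set ℂ} (hK₁ : IsCompact K₁) (hK₂ : IsCompact K₂)
    (hfin : (K₁ ∩ K₂).Finite) {h : ℂ → ℂ} (ha : ∀ z ∈ K₁ ∩ K₂, AnalyticAt ℂ h z)
    (h0 : ∀ z ∈ K₁ ∩ K₂, h z ≠ 0) :
    ∃ N₁ N₂ : Set ℂ, IsOpen N₁ ∧ IsOpen N₂ ∧ K₁ ⊆ N₁ ∧ K₂ ⊆ N₂ ∧ ∃ a₁ a₂ : ℂ → ℂ,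
      (∀ z ∈ N₁, AnalyticAt ℂ a₁ z ∧ a₁ z ≠ 0) ∧ (∀ z ∈ N₂, AnalyticAt ℂ a₂ z ∧ a₂ z ≠ 0) ∧
      ∀ z ∈ N₁ ∩ N₂, h z = a₁ z * a₂ z := by
  -- solve the problem near one intersection point after the other
  have key : ∀ S : Set ℂ, S.Finite → S ⊆ K₁ ∩ K₂ →
      ∃ N₁ N₂ : Set ℂ, IsOpen N₁ ∧ IsOpen N₂ ∧ K₁ ⊆ N₁ ∧ K₂ ⊆ N₂ ∧ ∃ a₁ a₂ : ℂ → ℂ,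
        (∀ z ∈ N₁, AnalyticAt ℂ a₁ z ∧ a₁ z ≠ 0) ∧ (∀ z ∈ N₂, AnalyticAt ℂ a₂ z ∧ a₂ z ≠ 0) ∧
        ∀ z ∈ S, ∀ᶠ w in 𝓝 z, h w = a₁ w * a₂ w := by
    intro S hS
    induction S, hS using Set.Finite.induction_on with
    | empty =>
      intro _
      exact ⟨univ, univ, isOpen_univ, isOpen_univ, subset_univ _, subset_univ _, 1, 1,
        fun z _ => ⟨analyticAt_const, one_ne_zero⟩, fun z _ => ⟨analyticAt_const, one_ne_zero⟩,
        by simp⟩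
    | @insert p S hpS _ ih =>
      intro hsub
      obtain ⟨N₁, N₂, hN₁, hN₂, hKN₁, hKN₂, a₁, a₂, ha₁, ha₂, hS'⟩ :=
        ih ((subset_insert _ _).trans hsub)
      have hp : p ∈ K₁ ∩ K₂ := hsub (mem_insert _ _)
      have hA₁ := ha₁ p (hKN₁ hp.1)
      have hA₂ := ha₂ p (hKN₂ hp.2)
      let q : ℂ → ℂ := fun z => h z / (a₁ z * a₂ z)
      have hq : AnalyticAt ℂ q p :=
        (ha p hp).div (hA₁.1.mul hA₂.1) (mul_ne_zero hA₁.2 hA₂.2)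
      have hq0 : q p ≠ 0 := div_ne_zero (h0 p hp) (mul_ne_zero hA₁.2 hA₂.2)
      let g : ℂ → ℂ := fun z => Complex.log (q z / q p) + Complex.log (q p)
      have hg : AnalyticAt ℂ g p := by
        refine AnalyticAt.add (AnalyticAt.clog (hq.div analyticAt_const hq0) ?_) analyticAt_const
        simp [div_self hq0]
      have e1 : ∀ᶠ z in 𝓝 p, AnalyticAt ℂ g z := hg.eventually_analyticAt
      have e2 : ∀ᶠ z in 𝓝 p, q z ≠ 0 := hq.continuousAt.eventually_ne hq0
      have e3 : ∀ᶠ z in 𝓝 p, z ∉ (K₁ ∩ K₂) \ {p} :=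
        (hfin.subset sdiff_subset).isClosed.isOpen_compl.mem_nhds (by simp)
      have e4 : ∀ᶠ z in 𝓝 p, z ∈ N₁ ∩ N₂ :=
        (hN₁.inter hN₂).mem_nhds ⟨hKN₁ hp.1, hKN₂ hp.2⟩
      obtain ⟨ρ, hρ, hball⟩ := nhds_basis_closedBall.mem_iff.mp
        ((e1.and e2).and (e3.and e4))
      obtain ⟨M₁, M₂, hM₁, hM₂, hKM₁, hKM₂, G₁, G₂, hG₁, hG₂, hG⟩ :=
        exists_cauchy_split (g := g) hK₁.isClosed hK₂.isClosed hρ (by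
          rw [Set.eq_empty_iff_forall_notMem]
          rintro z ⟨hz, hz'⟩
          refine (hball (sphere_subset_closedBall hz')).2.1 ⟨hz, ?_⟩
          rintro rfl
          simp [hρ.ne] at hz')
          (fun z hz => (hball hz).1.1.continuousAt.continuousWithinAt)
          (fun z hz =>
            (hball (ball_subset_closedBall hz)).1.1.differentiableAt.differentiableWithinAt)
      refine ⟨N₁ ∩ M₁, N₂ ∩ M₂, hN₁.inter hM₁, hN₂.inter hM₂, subset_inter hKN₁ hKM₁,
        subset_inter hKN₂ hKM₂, fun z => a₁ z * Complex.exp (G₁ z),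
        fun z => a₂ z * Complex.exp (G₂ z), ?_, ?_, ?_⟩
      · intro z hz
        exact ⟨(ha₁ z hz.1).1.mul (hG₁.analyticAt (hM₁.mem_nhds hz.2)).cexp,
          mul_ne_zero (ha₁ z hz.1).2 (Complex.exp_ne_zero _)⟩
      · intro z hz
        exact ⟨(ha₂ z hz.1).1.mul (hG₂.analyticAt (hM₂.mem_nhds hz.2)).cexp,
          mul_ne_zero (ha₂ z hz.1).2 (Complex.exp_ne_zero _)⟩
      · rintro z hz
        have hzK := hsub hz
        have hzM : ∀ᶠ w in 𝓝 z, w ∈ M₁ ∩ M₂ :=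
          (hM₁.inter hM₂).mem_nhds ⟨hKM₁ hzK.1, hKM₂ hzK.2⟩
        rcases hz with rfl | hz
        · filter_upwards [hzM, ball_mem_nhds z hρ] with w hw hwb
          obtain ⟨⟨-, hqw⟩, -, hwN⟩ := hball (ball_subset_closedBall hwb)
          have h1 := (hG w hw).2.1 hwb
          have h2 : a₁ w * a₂ w ≠ 0 := mul_ne_zero (ha₁ w hwN.1).2 (ha₂ w hwN.2).2
          calc h w = a₁ w * a₂ w * q w := by simp only [q]; rw [mul_div_cancel₀ _ h2]
            _ = a₁ w * a₂ w * Complex.exp (g w) := by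
              simp only [g]
              rw [Complex.exp_add, Complex.exp_log (div_ne_zero hqw hq0), Complex.exp_log hq0,
                div_mul_cancel₀ _ hq0]
            _ = _ := by rw [← h1, Complex.exp_add]; ring
        · have hzb : z ∉ closedBall p ρ := by
            intro hzb
            refine (hball hzb).2.1 ⟨hzK, ?_⟩
            rintro rfl
            exact hpS hz
          filter_upwards [hzM, hS' z hz, isClosed_closedBall.isOpen_compl.mem_nhds hzb]
            with w hw hw' hwb
          have h1 := (hG w hw).2.2 hwb
          calc h w = a₁ w * a₂ w * Complex.exp (G₁ w + G₂ w) := by rw [h1, hw']; simp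
            _ = _ := by rw [Complex.exp_add]; ring
  obtain ⟨N₁, N₂, hN₁, hN₂, hKN₁, hKN₂, a₁, a₂, ha₁, ha₂, hS'⟩ := key _ hfin subset_rfl
  obtain ⟨M₁, M₂, hM₁, hM₂, hKM₁, hKM₂, hM⟩ := exists_open_inter_subset hK₁ hK₂
    (isOpen_setOfPred_eventually_nhds (p := fun w => h w = a₁ w * a₂ w)) hS'
  exact ⟨N₁ ∩ M₁, N₂ ∩ M₂, hN₁.inter hM₁, hN₂.inter hM₂, subset_inter hKN₁ hKM₁,
    subset_inter hKN₂ hKM₂, a₁, a₂, fun z hz => ha₁ z hz.1, fun z hz => ha₂ z hz.1,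
    fun z hz => (hM ⟨hz.1.2, hz.2.2⟩).self_of_nhds⟩

end Splitting

/-! ### Invertible holomorphic cocycles in the plane -/

section Cocycle

open Metric Set Filter Topology

/-- A holomorphic line bundle on `ℂ`, given by invertible holomorphic transition functions between
trivializations over the members of an open cover. -/
structure UnitCocycle (ι : Type*) where
  /-- The members of the cover. -/
  U : ι → Set ℂ
  isOpen_U : ∀ i, IsOpen (U i)
  cover : ∀ z, ∃ i, z ∈ U i
  /-- The transition functions. -/
  g : ι → ι → ℂ → ℂ
  analyticAt_g : ∀ i j z, z ∈ U i → z ∈ U j → AnalyticAt ℂ (g i j) z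
  g_ne_zero : ∀ i j z, z ∈ U i → z ∈ U j → g i j z ≠ 0
  g_mul : ∀ i j k z, z ∈ U i → z ∈ U j → z ∈ U k → g i j z * g j k z = g i k z

namespace UnitCocycle

variable {ι : Type*} (c : UnitCocycle ι)

/-- A nowhere vanishing holomorphic section over `N`, given by its coefficients in the
trivializations. -/
structure IsSection (N : Set ℂ) (s : ι → ℂ → ℂ) : Prop where
  analyticAt : ∀ i z, z ∈ N → z ∈ c.U i → AnalyticAt ℂ (s i) z
  ne_zero : ∀ i z, z ∈ N → z ∈ c.U i → s i z ≠ 0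
  eq_mul : ∀ i j z, z ∈ N → z ∈ c.U i → z ∈ c.U j → s i z = c.g i j z * s j z

/-- There is a nowhere vanishing holomorphic section over some neighbourhood of `K`. -/
def TrivialNear (K : Set ℂ) : Prop := ∃ N, IsOpen N ∧ K ⊆ N ∧ ∃ s, c.IsSection N s

variable {c}

lemma IsSection.mono {N M : Set ℂ} {s : ι → ℂ → ℂ} (h : c.IsSection N s) (hM : M ⊆ N) :
    c.IsSection M s :=
  ⟨fun i z hz => h.1 i z (hM hz), fun i z hz => h.2 i z (hM hz),
    fun i j z hz => h.3 i j z (hM hz)⟩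

lemma TrivialNear.mono {K L : Set ℂ} (h : c.TrivialNear K) (hL : L ⊆ K) : c.TrivialNear L :=
  let ⟨N, hN, hK, hs⟩ := h
  ⟨N, hN, hL.trans hK, hs⟩

lemma isSection_U (i : ι) : c.IsSection (c.U i) (fun j => c.g j i) :=
  ⟨fun j z hz hj => c.analyticAt_g j i z hj hz, fun j z hz hj => c.g_ne_zero j i z hj hz,
    fun j k z hz hj hk => (c.g_mul j k i z hj hk hz).symm⟩

/-- Two sections differ by an invertible holomorphic function. -/
lemma IsSection.exists_ratio {N N' : Set ℂ} {s s' : ι → ℂ → ℂ} (h : c.IsSection N s)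
    (h' : c.IsSection N' s') (hN : IsOpen N) (hN' : IsOpen N') :
    ∃ q : ℂ → ℂ, ∀ z ∈ N ∩ N', AnalyticAt ℂ q z ∧ q z ≠ 0 ∧
      ∀ i, z ∈ c.U i → s i z = q z * s' i z := by
  choose k hk using c.cover
  refine ⟨fun z => s (k z) z / s' (k z) z, fun z hz => ?_⟩
  have key : ∀ z ∈ N ∩ N', ∀ i, z ∈ c.U i → s (k z) z / s' (k z) z = s i z / s' i z := by
    intro z hz i hi
    have hg := c.g_ne_zero (k z) i z (hk z) hi
    rw [h.eq_mul (k z) i z hz.1 (hk z) hi, h'.eq_mul (k z) i z hz.2 (hk z) hi,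
      mul_div_mul_left _ _ hg]
  refine ⟨?_, div_ne_zero (h.ne_zero _ z hz.1 (hk z)) (h'.ne_zero _ z hz.2 (hk z)),
    fun i hi => ?_⟩
  · refine ((h.analyticAt (k z) z hz.1 (hk z)).div (h'.analyticAt (k z) z hz.2 (hk z))
      (h'.ne_zero _ z hz.2 (hk z))).congr ?_
    filter_upwards [(hN.inter hN').mem_nhds hz, (c.isOpen_U (k z)).mem_nhds (hk z)] with w hw hw'
    exact (key w hw _ hw').symm
  · simp only
    rw [key z hz i hi, div_mul_cancel₀ _ (h'.ne_zero i z hz.2 hi)]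

/-- Gluing of sections, after a correction by invertible functions. -/
lemma IsSection.exists_glue {N N' : Set ℂ} {s s' : ι → ℂ → ℂ} (h : c.IsSection N s)
    (h' : c.IsSection N' s') (hN : IsOpen N) (hN' : IsOpen N') {a a' : ℂ → ℂ}
    (ha : ∀ z ∈ N, AnalyticAt ℂ a z ∧ a z ≠ 0) (ha' : ∀ z ∈ N', AnalyticAt ℂ a' z ∧ a' z ≠ 0)
    (hs : ∀ z ∈ N ∩ N', ∀ i, z ∈ c.U i → s i z = a z * a' z * s' i z) :
    ∃ t, c.IsSection (N ∪ N') t := by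
  classical
  let t : ι → ℂ → ℂ := fun i z => if z ∈ N then s i z / a z else a' z * s' i z
  have t1 : ∀ i, ∀ z ∈ N, t i z = s i z / a z := fun i z hz => if_pos hz
  have t2 : ∀ i, ∀ z ∈ N', z ∈ c.U i → t i z = a' z * s' i z := fun i z hz hi => by
    by_cases hzN : z ∈ N
    · rw [t1 i z hzN, hs z ⟨hzN, hz⟩ i hi, mul_assoc, mul_div_cancel_left₀ _ (ha z hzN).2]
    · exact if_neg hzN
  refine ⟨t, ⟨?_, ?_, ?_⟩⟩
  · rintro i z (hz | hz) hi
    · refine ((h.analyticAt i z hz hi).div (ha z hz).1 (ha z hz).2).congr ?_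
      filter_upwards [hN.mem_nhds hz] with w hw
      exact (t1 i w hw).symm
    · refine ((ha' z hz).1.mul (h'.analyticAt i z hz hi)).congr ?_
      filter_upwards [hN'.mem_nhds hz, (c.isOpen_U i).mem_nhds hi] with w hw hwi
      exact (t2 i w hw hwi).symm
  · rintro i z (hz | hz) hi
    · rw [t1 i z hz]
      exact div_ne_zero (h.ne_zero i z hz hi) (ha z hz).2
    · rw [t2 i z hz hi]
      exact mul_ne_zero (ha' z hz).2 (h'.ne_zero i z hz hi)
  · rintro i j z (hz | hz) hi hj
    · rw [t1 i z hz, t1 j z hz, h.eq_mul i j z hz hi hj, mul_div_assoc]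
    · rw [t2 i z hz hi, t2 j z hz hj, h'.eq_mul i j z hz hi hj]
      ring

lemma TrivialNear.union_of_finite {K₁ K₂ : Set ℂ} (hK₁ : IsCompact K₁) (hK₂ : IsCompact K₂)
    (hfin : (K₁ ∩ K₂).Finite) (h₁ : c.TrivialNear K₁) (h₂ : c.TrivialNear K₂) :
    c.TrivialNear (K₁ ∪ K₂) := by
  obtain ⟨N₁, hN₁, hKN₁, s₁, hs₁⟩ := h₁
  obtain ⟨N₂, hN₂, hKN₂, s₂, hs₂⟩ := h₂
  obtain ⟨q, hq⟩ := hs₁.exists_ratio hs₂ hN₁ hN₂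
  have hsub : K₁ ∩ K₂ ⊆ N₁ ∩ N₂ := inter_subset_inter hKN₁ hKN₂
  obtain ⟨M₁, M₂, hM₁, hM₂, hKM₁, hKM₂, a₁, a₂, ha₁, ha₂, ha⟩ :=
    exists_mul_split_of_finite hK₁ hK₂ hfin (fun z hz => (hq z (hsub hz)).1)
      (fun z hz => (hq z (hsub hz)).2.1)
  obtain ⟨t, ht⟩ := (hs₁.mono (inter_subset_left (t := M₁))).exists_glue
    (hs₂.mono (inter_subset_left (t := M₂))) (hN₁.inter hM₁) (hN₂.inter hM₂)
    (fun z hz => ha₁ z hz.2) (fun z hz => ha₂ z hz.2) (fun z hz i hi => by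
      rw [← ha z ⟨hz.1.2, hz.2.2⟩]
      exact (hq z ⟨hz.1.1, hz.2.1⟩).2.2 i hi)
  exact ⟨_, (hN₁.inter hM₁).union (hN₂.inter hM₂),
    union_subset_union (subset_inter hKN₁ hKM₁) (subset_inter hKN₂ hKM₂), t, ht⟩

/-- The bundle is trivial near every circle around the origin: the circle is built from short arcs
that meet in at most two points. -/
lemma trivialNear_sphere {ρ : ℝ} (hρ : 0 ≤ ρ) : c.TrivialNear (sphere 0 ρ) := by
  have hc := continuous_circleMap (0 : ℂ) ρ
  obtain ⟨t, ht0, htm, ⟨m, hm⟩, ht⟩ := exists_monotone_Icc_subset_open_cover_Icc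
    (a := 0) (b := 2 * Real.pi) (by positivity)
    (c := fun i : ι => {x | circleMap (0 : ℂ) ρ x ∈ c.U i})
    (fun i => (c.isOpen_U i).preimage (hc.comp continuous_subtype_val))
    (fun x _ => by simpa using c.cover _)
  have key : ∀ n, c.TrivialNear (circleMap 0 ρ '' Icc 0 (t n : ℝ)) := by
    intro n
    induction n with
    | zero =>
      rw [ht0, Icc_self, image_singleton]
      obtain ⟨i, hi⟩ := c.cover (circleMap 0 ρ 0)
      exact ⟨c.U i, c.isOpen_U i, by simpa using hi, _, isSection_U i⟩
    | succ n ih =>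
      have hle : (t n : ℝ) ≤ t (n + 1) := htm n.le_succ
      have h0 : (0 : ℝ) ≤ t n := (t n).2.1
      have h1 : (t (n + 1) : ℝ) ≤ 2 * Real.pi := (t (n + 1)).2.2
      rw [← Icc_union_Icc_eq_Icc h0 hle, image_union]
      refine TrivialNear.union_of_finite (isCompact_Icc.image hc) (isCompact_Icc.image hc) ?_ ih ?_
      · refine (Set.toFinite {circleMap 0 ρ (t n : ℝ), circleMap 0 ρ 0}).subset ?_
        rintro z ⟨⟨x, hx, rfl⟩, ⟨y, hy, hxy⟩⟩
        rcases hρ.eq_or_lt with rfl | hρ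
        · simp
        · rcases eq_or_ne y (2 * Real.pi) with rfl | hy2
          · right
            rw [mem_singleton_iff, ← hxy]
            simp [circleMap]
          · left
            have hyx : y = x := by
              refine injOn_circleMap_of_abs_sub_le' (a := 0) (b := 2 * Real.pi) hρ.ne' ?_ ?_ ?_ hxy
              · simp
              · exact ⟨h0.trans hy.1, lt_of_le_of_ne (hy.2.trans h1) hy2⟩
              · exact ⟨hx.1, (hx.2.trans hy.1).trans_lt (lt_of_le_of_ne (hy.2.trans h1) hy2)⟩
            rw [← hxy, le_antisymm (hyx ▸ hx.2) hy.1]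
      · obtain ⟨i, hi⟩ := ht n
        refine ⟨c.U i, c.isOpen_U i, ?_, _, isSection_U i⟩
        rintro _ ⟨x, hx, rfl⟩
        exact hi (a := ⟨x, h0.trans hx.1, hx.2.trans h1⟩) hx
  refine (key m).mono ?_
  rw [hm m le_rfl]
  intro z hz
  rw [← abs_of_nonneg hρ, ← image_circleMap_Ioc] at hz
  obtain ⟨x, hx, rfl⟩ := hz
  exact ⟨x, Ioc_subset_Icc_self hx, rfl⟩

end UnitCocycle

end Cocycle

/-! ### Laurent splitting and triviality over discs -/

section Laurent

open Metric Set Filter Topology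

/-- Additive Laurent splitting on an annulus. -/
lemma exists_laurent_add {r R : ℝ} (hr : 0 < r) (hrR : r < R) {f : ℂ → ℂ}
    (hf : ∀ z, r ≤ ‖z‖ → ‖z‖ ≤ R → AnalyticAt ℂ f z) :
    ∃ p q : ℂ → ℂ, DifferentiableOn ℂ p (ball 0 R) ∧ DifferentiableOn ℂ q (ball 0 r⁻¹) ∧
      ∀ z, r < ‖z‖ → ‖z‖ < R → f z = p z + z⁻¹ * q z⁻¹ := by
  have hR : 0 < R := hr.trans hrR
  have hcont : ∀ ρ, r ≤ ρ → ρ ≤ R → ContinuousOn f (sphere 0 ρ) := fun ρ h1 h2 z hz => by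
    rw [mem_sphere_zero_iff_norm] at hz
    exact (hf z (hz ▸ h1) (hz ▸ h2)).continuousAt.continuousWithinAt
  let p : ℂ → ℂ := fun w => (2 * Real.pi * Complex.I : ℂ)⁻¹ • ∮ z in C(0, R), (z - w)⁻¹ • f z
  let q : ℂ → ℂ := fun w => (2 * Real.pi * Complex.I : ℂ)⁻¹ *
    ∫ t in (0 : ℝ)..2 * Real.pi, deriv (circleMap 0 r) t *
      ((1 - circleMap 0 r t * w)⁻¹ * f (circleMap 0 r t))
  refine ⟨p, q, ?_, ?_, fun z hz1 hz2 => ?_⟩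
  · lift R to NNReal using hR.le
    have := (hasFPowerSeriesOn_cauchy_integral
      ((hcont R hrR.le le_rfl).circleIntegrable hR.le) (by exact_mod_cast hR)).differentiableOn
    rwa [Metric.eball_coe] at this
  · intro w₀ hw₀
    refine (DifferentiableAt.const_mul ?_ _).differentiableWithinAt
    have hne : ∀ w ∈ ball (0 : ℂ) r⁻¹, ∀ t, 1 - circleMap 0 r t * w ≠ 0 := by
      intro w hw t h0
      have h1 : ‖circleMap 0 r t * w‖ = 1 := by rw [← sub_eq_zero.mp h0]; simp
      rw [norm_mul, norm_circleMap_zero, abs_of_pos hr] at h1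
      rw [mem_ball_zero_iff] at hw
      have : r * ‖w‖ < r * r⁻¹ := by gcongr
      rw [mul_inv_cancel₀ hr.ne'] at this
      linarith
    have hc : Continuous (circleMap 0 r) := continuous_circleMap 0 r
    have hfc : Continuous fun t => f (circleMap 0 r t) :=
      continuousOn_univ.mp ((hcont r le_rfl hrR.le).comp hc.continuousOn
        fun t _ => circleMap_mem_sphere _ hr.le _)
    refine differentiableAt_intervalIntegral (F' := fun w t => deriv (circleMap 0 r) t *
      (circleMap 0 r t * (1 - circleMap 0 r t * w)⁻¹ ^ 2 * f (circleMap 0 r t)))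
      (isOpen_ball.mem_nhds hw₀) (fun w hw => ?_) ?_ ?_
    · simp only [deriv_circleMap]
      exact (hc.mul continuous_const).mul (((continuous_const.sub (hc.mul continuous_const)).inv₀
        (hne w hw)).mul hfc)
    · rintro ⟨w, t⟩ ⟨hw, -⟩
      simp only [deriv_circleMap, Function.uncurry_def]
      have h1 : Continuous fun x : ℂ × ℝ => circleMap 0 r x.2 := hc.comp continuous_snd
      have h2 : Continuous fun x : ℂ × ℝ => f (circleMap 0 r x.2) := hfc.comp continuous_snd
      have h3 : ContinuousAt (fun x : ℂ × ℝ => (1 - circleMap 0 r x.2 * x.1)⁻¹) (w, t) :=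
        (continuous_const.sub (h1.mul continuous_fst)).continuousAt.inv₀ (hne w hw t)
      exact ((h1.continuousAt.mul continuousAt_const).mul
        ((h1.continuousAt.mul (h3.pow 2)).mul h2.continuousAt)).continuousWithinAt
    · intro w hw t
      have := (((hasDerivAt_id w).const_mul (circleMap 0 r t)).const_sub 1).inv (hne w hw t)
      refine HasDerivAt.const_mul _ (HasDerivAt.mul_const ?_ _)
      convert! this using 1
      simp only [id, mul_one, neg_neg]
      rw [inv_pow, div_eq_mul_inv]
  · have hz0 : z ≠ 0 := by
      rintro rfl
      simp at hz1
      linarith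
    have hnear : ∀ ζ, r < ‖ζ‖ → ‖ζ‖ < R → ∀ᶠ w in 𝓝 ζ, r < ‖w‖ ∧ ‖w‖ < R := fun ζ h1 h2 =>
      ((continuous_norm (E := ℂ)).continuousAt.eventually_const_lt h1).and
        ((continuous_norm (E := ℂ)).continuousAt.eventually_lt_const h2)
    have hann : ∀ ζ, ζ ∈ ball (0 : ℂ) R \ closedBall 0 r ↔ r < ‖ζ‖ ∧ ‖ζ‖ < R := fun ζ => by
      simp [and_comm]
    have hd : ∮ ζ in C(0, R), dslope f z ζ = ∮ ζ in C(0, r), dslope f z ζ := by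
      refine Complex.circleIntegral_eq_of_differentiable_on_annulus_off_countable hr hrR.le
        countable_empty ?_ ?_
      · rw [continuousOn_dslope]
        · refine ⟨fun ζ hζ => ?_, (hf z hz1.le hz2.le).differentiableAt⟩
          simp only [Set.mem_sdiff, mem_closedBall, dist_zero_right, mem_ball, not_lt] at hζ
          exact (hf ζ hζ.2 hζ.1).continuousAt.continuousWithinAt
        · filter_upwards [hnear z hz1 hz2] with w hw
          simpa using ⟨hw.2.le, hw.1.le⟩
      · rintro ζ ⟨hζ, -⟩
        have hopen : IsOpen (ball (0 : ℂ) R \ closedBall 0 r) :=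
          isOpen_ball.sdiff isClosed_closedBall
        refine DifferentiableOn.differentiableAt (s := ball (0 : ℂ) R \ closedBall 0 r) ?_
          (hopen.mem_nhds hζ)
        rw [Complex.differentiableOn_dslope (hopen.mem_nhds ((hann z).2 ⟨hz1, hz2⟩))]
        intro ζ hζ
        obtain ⟨h1, h2⟩ := (hann ζ).1 hζ
        exact (hf ζ h1.le h2.le).differentiableAt.differentiableWithinAt
    have hne : ∀ ρ, ρ ≠ ‖z‖ → ∀ ζ ∈ sphere (0 : ℂ) ρ, ζ - z ≠ 0 := by
      intro ρ hρ ζ hζ h0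
      rw [mem_sphere_zero_iff_norm, sub_eq_zero.mp h0] at hζ
      exact hρ hζ.symm
    have hci : ∀ ρ, ρ ≠ ‖z‖ → ContinuousOn (fun ζ => (ζ - z)⁻¹) (sphere (0 : ℂ) ρ) := fun ρ hρ =>
      (continuousOn_id.sub continuousOn_const).inv₀ (hne ρ hρ)
    have hexp : ∀ ρ, r ≤ ρ → ρ ≤ R → ρ ≠ ‖z‖ → ∮ ζ in C(0, ρ), dslope f z ζ =
        (∮ ζ in C(0, ρ), (ζ - z)⁻¹ • f ζ) - (∮ ζ in C(0, ρ), (ζ - z)⁻¹) * f z := by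
      intro ρ h1 h2 hρ
      have h0 : (0 : ℝ) ≤ ρ := hr.le.trans h1
      have hm := circleIntegral.integral_smul_const (fun ζ : ℂ => (ζ - z)⁻¹) (f z) 0 ρ
      rw [smul_eq_mul] at hm
      rw [← hm, ← circleIntegral.integral_sub]
      · refine circleIntegral.integral_congr h0 fun ζ hζ => ?_
        have : ζ ≠ z := sub_ne_zero.mp (hne ρ hρ ζ hζ)
        rw [dslope_of_ne _ this, slope_def_field, smul_eq_mul, smul_eq_mul]
        ring
      · exact ((hci ρ hρ).smul (hcont ρ h1 h2)).circleIntegrable h0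
      · exact ((hci ρ hρ).smul continuousOn_const).circleIntegrable h0
    rw [hexp R hrR.le le_rfl hz2.ne', hexp r le_rfl hrR.le hz1.ne,
      circleIntegral.integral_sub_inv_of_mem_ball (mem_ball_zero_iff.2 hz2)] at hd
    have hzero : ∮ ζ in C(0, r), (ζ - z)⁻¹ = 0 := by
      have hne' : ∀ ζ ∈ closedBall (0 : ℂ) r, ζ - z ≠ 0 := by
        intro ζ hζ h0
        rw [mem_closedBall_zero_iff, sub_eq_zero.mp h0] at hζ
        linarith
      refine Complex.circleIntegral_eq_zero_of_differentiable_on_off_countable hr.le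
        countable_empty ((continuousOn_id.sub continuousOn_const).inv₀ hne') fun ζ hζ => ?_
      exact (differentiableAt_id.sub_const z).inv (hne' ζ (ball_subset_closedBall hζ.1))
    rw [hzero, zero_mul, sub_zero] at hd
    have hq : ∮ ζ in C(0, r), (ζ - z)⁻¹ • f ζ = -(z⁻¹ * ∫ t in (0 : ℝ)..2 * Real.pi,
        deriv (circleMap 0 r) t * ((1 - circleMap 0 r t * z⁻¹)⁻¹ * f (circleMap 0 r t))) := by
      rw [circleIntegral, ← intervalIntegral.integral_const_mul, ← intervalIntegral.integral_neg]
      refine intervalIntegral.integral_congr fun t _ => ?_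
      have h1 : circleMap 0 r t - z ≠ 0 := hne r hz1.ne _ (circleMap_mem_sphere _ hr.le _)
      have h2 : 1 - circleMap 0 r t * z⁻¹ = -((circleMap 0 r t - z) * z⁻¹) := by
        field_simp
        ring
      simp only [smul_eq_mul]
      rw [h2, inv_neg, mul_inv, inv_inv]
      field_simp
    have hpi := Complex.two_pi_I_ne_zero
    rw [hq] at hd
    simp only [p, q, smul_eq_mul]
    simp only [smul_eq_mul] at hd
    generalize (∮ ζ in C(0, R), (ζ - z)⁻¹ * f ζ) = A at *
    generalize (∫ t in (0 : ℝ)..2 * Real.pi,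
        deriv (circleMap 0 r) t * ((1 - circleMap 0 r t * z⁻¹)⁻¹ * f (circleMap 0 r t))) = B at *
    have : A = (2 * Real.pi * Complex.I) * f z - z⁻¹ * B := by linear_combination hd
    rw [this]
    field_simp
    ring

/-- Multiplicative Laurent splitting: an invertible function on an annulus is the product of a power
of `z`, an invertible function inside and an invertible function outside. The exponent is the
residue of the logarithmic derivative. -/
lemma exists_laurent_mul {r R : ℝ} (hr : 0 < r) (hrR : r < R) {h : ℂ → ℂ}
    (hh : ∀ z, r ≤ ‖z‖ → ‖z‖ ≤ R → AnalyticAt ℂ h z ∧ h z ≠ 0) :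
    ∃ (m : ℤ) (a b : ℂ → ℂ), (∀ z ∈ ball 0 R, AnalyticAt ℂ a z ∧ a z ≠ 0) ∧
      (∀ w ∈ ball 0 r⁻¹, AnalyticAt ℂ b w ∧ b w ≠ 0) ∧
      ∀ z, r < ‖z‖ → ‖z‖ < R → h z = z ^ m * a z * b z⁻¹ := by
  obtain ⟨p, q, hp, hq, hpq⟩ := exists_laurent_add hr hrR (f := fun z => deriv h z / h z)
    fun z h1 h2 => (hh z h1 h2).1.deriv.div (hh z h1 h2).1 (hh z h1 h2).2
  obtain ⟨P, hP⟩ := hp.isExactOn_ball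
  have hr' : (0 : ℂ) ∈ ball (0 : ℂ) r⁻¹ := mem_ball_self (inv_pos.2 hr)
  obtain ⟨Q, hQ⟩ := ((Complex.differentiableOn_dslope
    (isOpen_ball.mem_nhds hr')).2 hq).isExactOn_ball
  set n : ℂ := q 0 with hn
  have hinv : ∀ z : ℂ, r < ‖z‖ → z⁻¹ ∈ ball (0 : ℂ) r⁻¹ := fun z hz => by
    rw [mem_ball_zero_iff, norm_inv]
    exact inv_strictAnti₀ hr hz
  let k : ℂ → ℂ := fun z => h z * Complex.exp (-P z) * Complex.exp (Q z⁻¹)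
  have hk0 : ∀ z, r < ‖z‖ → ‖z‖ < R → k z ≠ 0 := fun z h1 h2 =>
    mul_ne_zero (mul_ne_zero (hh z h1.le h2.le).2 (Complex.exp_ne_zero _)) (Complex.exp_ne_zero _)
  have hk : ∀ z, r < ‖z‖ → ‖z‖ < R → HasDerivAt k (k z * (n / z)) z := by
    intro z h1 h2
    have hz0 : z ≠ 0 := by
      rintro rfl
      simp at h1
      linarith
    have hz := hh z h1.le h2.le
    have e1 := hz.1.differentiableAt.hasDerivAt
    have e2 := (hP z (mem_ball_zero_iff.2 h2)).neg.cexp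
    have e3 := ((hQ z⁻¹ (hinv z h1)).comp z (hasDerivAt_inv hz0)).cexp
    refine ((e1.mul e2).mul e3).congr_deriv ?_
    have e4 : deriv h z = h z * (p z + z⁻¹ * q z⁻¹) := by
      rw [← hpq z h1 h2, mul_div_cancel₀ _ hz.2]
    have e5 : dslope q 0 z⁻¹ = (q z⁻¹ - n) * z := by
      rw [dslope_of_ne _ (inv_ne_zero hz0), slope_def_field, hn]
      field_simp
      simp
    simp only [k, Function.comp_def, e4, e5, Pi.mul_apply, Pi.neg_apply]
    field_simp
    ring
  -- on the universal cover of the annulus, `k` becomes a multiple of `exp (n u)`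
  let S : Set ℂ := {u | Real.log r < u.re ∧ u.re < Real.log R}
  have hS : ∀ u ∈ S, r < ‖Complex.exp u‖ ∧ ‖Complex.exp u‖ < R := fun u hu => by
    rw [Complex.norm_exp]
    exact ⟨(Real.log_lt_iff_lt_exp hr).1 hu.1, (Real.lt_log_iff_exp_lt (hr.trans hrR)).1 hu.2⟩
  have hSo : IsOpen S := (isOpen_lt continuous_const Complex.continuous_re).inter
    (isOpen_lt Complex.continuous_re continuous_const)
  have hSc : Convex ℝ S := (convex_halfSpace_re_gt _).inter (convex_halfSpace_re_lt _)
  let φ : ℂ → ℂ := fun u => k (Complex.exp u) * Complex.exp (-(n * u))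
  have hφ : ∀ u ∈ S, HasDerivAt φ 0 u := by
    intro u hu
    have e1 := (hk _ (hS u hu).1 (hS u hu).2).comp u (Complex.hasDerivAt_exp u)
    have e2 := (((hasDerivAt_id u).const_mul n).neg).cexp
    refine (e1.mul e2).congr_deriv ?_
    have := Complex.exp_ne_zero u
    simp only [Function.comp_def, id, Pi.neg_apply]
    field_simp
    ring
  have hφc : ∀ u ∈ S, ∀ v ∈ S, φ u = φ v := fun u hu v hv =>
    hSo.is_const_of_deriv_eq_zero hSc.isPreconnected
      (fun u hu => (hφ u hu).differentiableAt.differentiableWithinAt)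
      (fun u hu => (hφ u hu).deriv) hu hv
  obtain ⟨u₀, hu₀⟩ : ∃ u : ℂ, u ∈ S := by
    obtain ⟨x, hx1, hx2⟩ := exists_between (Real.log_lt_log hr hrR)
    exact ⟨x, by simpa [S] using ⟨hx1, hx2⟩⟩
  have hφ0 : φ u₀ ≠ 0 :=
    mul_ne_zero (hk0 _ (hS u₀ hu₀).1 (hS u₀ hu₀).2) (Complex.exp_ne_zero _)
  -- periodicity forces `n` to be an integer
  obtain ⟨m, hm⟩ : ∃ m : ℤ, n = m := by
    have hper : u₀ + 2 * Real.pi * Complex.I ∈ S := by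
      simpa [S] using hu₀
    have e1 := hφc _ hper _ hu₀
    simp only [φ] at e1
    rw [Complex.exp_periodic u₀] at e1
    have e2 : Complex.exp (n * (2 * Real.pi * Complex.I)) = 1 := by
      have e3 := mul_left_cancel₀ (hk0 _ (hS u₀ hu₀).1 (hS u₀ hu₀).2) e1
      have : -(n * u₀) = -(n * (u₀ + 2 * Real.pi * Complex.I)) + n * (2 * Real.pi * Complex.I) := by
        ring
      rw [this, Complex.exp_add] at e3
      exact (mul_left_cancel₀ (Complex.exp_ne_zero _) ((mul_one _).trans e3)).symm
    obtain ⟨m, hm⟩ := Complex.exp_eq_one_iff.1 e2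
    exact ⟨m, mul_right_cancel₀ Complex.two_pi_I_ne_zero hm⟩
  refine ⟨m, fun z => φ u₀ * Complex.exp (P z), fun w => Complex.exp (-Q w), ?_, ?_, ?_⟩
  · intro z hz
    have hPa : AnalyticAt ℂ P z := DifferentiableOn.analyticAt (s := ball 0 R)
      (fun w hw => (hP w hw).differentiableAt.differentiableWithinAt) (isOpen_ball.mem_nhds hz)
    exact ⟨analyticAt_const.mul hPa.cexp, mul_ne_zero hφ0 (Complex.exp_ne_zero _)⟩
  · intro z hz
    have hQa : AnalyticAt ℂ Q z := DifferentiableOn.analyticAt (s := ball 0 r⁻¹)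
      (fun w hw => (hQ w hw).differentiableAt.differentiableWithinAt) (isOpen_ball.mem_nhds hz)
    exact ⟨hQa.neg.cexp, Complex.exp_ne_zero _⟩
  · intro z h1 h2
    have hz0 : z ≠ 0 := by
      rintro rfl
      simp at h1
      linarith
    have hu : Complex.log z ∈ S := by
      simp only [S, mem_ofPred_eq, Complex.log_re]
      exact ⟨Real.log_lt_log hr h1, Real.log_lt_log (norm_pos_iff.2 hz0) h2⟩
    have e1 := hφc _ hu _ hu₀
    rw [← e1]
    simp only [φ, k]
    rw [Complex.exp_log hz0, hm]
    have e2 : Complex.exp (-(m * Complex.log z)) = z ^ (-m) := by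
      rw [← neg_mul, ← Int.cast_neg, Complex.exp_int_mul, Complex.exp_log hz0]
    rw [e2, Complex.exp_neg, Complex.exp_neg, zpow_neg]
    have := Complex.exp_ne_zero (P z)
    have := Complex.exp_ne_zero (Q z⁻¹)
    have := zpow_ne_zero m hz0
    field_simp

end Laurent

section Disc

open Metric Set Filter Topology

lemma isOpen_setOf_sphere_subset {N : Set ℂ} (hN : IsOpen N) :
    IsOpen {ρ : ℝ | sphere 0 ρ ⊆ N} := by
  have h : IsClosedMap (norm : ℂ → ℝ) :=
    (isProperMap_iff_tendsto_cocompact.2 ⟨continuous_norm,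
      tendsto_norm_cocompact_atTop.mono_right atTop_le_cocompact⟩).isClosedMap
  convert (h _ hN.isClosed_compl).isOpen_compl using 1
  ext ρ
  simp only [mem_ofPred_eq, mem_compl_iff, mem_image, not_exists, not_and, subset_def,
    mem_sphere_zero_iff_norm]
  exact ⟨fun hρ z hz hz' => hz (hρ z hz'), fun hρ z hz => by_contra fun hz' => hρ z hz' hz⟩

lemma exists_annulus_subset {N : Set ℂ} (hN : IsOpen N) {ρ : ℝ} (hρ : 0 < ρ)
    (h : sphere 0 ρ ⊆ N) :
    ∃ r R, 0 < r ∧ r < ρ ∧ ρ < R ∧ ∀ z, r ≤ ‖z‖ → ‖z‖ ≤ R → z ∈ N := by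
  obtain ⟨ε, hε, hball⟩ := nhds_basis_closedBall.mem_iff.1
    ((isOpen_setOf_sphere_subset hN).mem_nhds h)
  refine ⟨max (ρ - ε) (ρ / 2), ρ + ε, lt_max_of_lt_right (half_pos hρ),
    max_lt (by linarith) (by linarith), by linarith, fun z h1 h2 => ?_⟩
  have h3 := (le_max_left _ _).trans h1
  refine hball (?_ : ‖z‖ ∈ closedBall ρ ε) (by simp : z ∈ sphere (0 : ℂ) ‖z‖)
  rw [mem_closedBall, Real.dist_eq, abs_le]
  constructor <;> linarith

namespace UnitCocycle

variable {ι : Type*} {c : UnitCocycle ι}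

/-- Triviality over discs: discs are enlarged by annuli, where Laurent splitting applies. -/
lemma trivialNear_closedBall {R : ℝ} (hR : 0 ≤ R) : c.TrivialNear (closedBall 0 R) := by
  have hs : ∀ ρ : Icc (0 : ℝ) R, ∃ N, IsOpen N ∧ sphere 0 (ρ : ℝ) ⊆ N ∧ ∃ s, c.IsSection N s :=
    fun ρ => trivialNear_sphere ρ.2.1
  choose N hN hsub s hs using hs
  obtain ⟨t, ht0, htm, ⟨m, hm⟩, ht⟩ := exists_monotone_Icc_subset_open_cover_Icc hR
    (c := fun i => {x : Icc (0 : ℝ) R | sphere 0 (x : ℝ) ⊆ N i})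
    (fun i => (isOpen_setOf_sphere_subset (hN i)).preimage continuous_subtype_val)
    (fun x _ => mem_iUnion.2 ⟨x, hsub x⟩)
  have key : ∀ n, c.TrivialNear (closedBall 0 (t n : ℝ)) := by
    intro n
    induction n with
    | zero =>
      rw [ht0, closedBall_zero]
      obtain ⟨i, hi⟩ := c.cover 0
      exact ⟨c.U i, c.isOpen_U i, by simpa using hi, _, isSection_U i⟩
    | succ n ih =>
      have hle : (t n : ℝ) ≤ t (n + 1) := htm n.le_succ
      obtain ⟨i, hi⟩ := ht n
      have hi' : ∀ z : ℂ, (t n : ℝ) ≤ ‖z‖ → ‖z‖ ≤ t (n + 1) → z ∈ N i := by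
        intro z h1 h2
        exact hi (a := ⟨‖z‖, (t n).2.1.trans h1, h2.trans (t (n + 1)).2.2⟩) ⟨h1, h2⟩
          (by simp)
      rcases (t n).2.1.eq_or_lt with h0 | h0
      · refine ⟨N i, hN i, fun z hz => ?_, s i, hs i⟩
        exact hi' z (h0 ▸ norm_nonneg z) (mem_closedBall_zero_iff.1 hz)
      · obtain ⟨M, hM, hKM, s', hs'⟩ := ih
        obtain ⟨q, hq⟩ := hs'.exists_ratio (hs i) hM (hN i)
        obtain ⟨r, R', hr, hrt, htR, hann⟩ := exists_annulus_subset (hM.inter (hN i)) h0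
          (fun z hz => ⟨hKM (sphere_subset_closedBall hz), hi' z
            (mem_sphere_zero_iff_norm.1 hz).ge ((mem_sphere_zero_iff_norm.1 hz).le.trans hle)⟩)
        obtain ⟨k, a, b, ha, hb, hab⟩ := exists_laurent_mul hr (hrt.trans htR)
          (fun z h1 h2 => ⟨(hq z (hann z h1 h2)).1, (hq z (hann z h1 h2)).2.1⟩)
        have hout : IsOpen {z : ℂ | r < ‖z‖} := isOpen_lt continuous_const continuous_norm
        obtain ⟨u, hu⟩ := (hs'.mono (inter_subset_left (t := ball 0 R'))).exists_glue
          ((hs i).mono (inter_subset_left (t := {z : ℂ | r < ‖z‖}))) (hM.inter isOpen_ball)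
          ((hN i).inter hout) (a := a) (a' := fun z => z ^ k * b z⁻¹) (fun z hz => ha z hz.2) (by
            rintro z ⟨-, hz⟩
            have hz0 : z ≠ 0 := norm_pos_iff.1 (hr.trans hz)
            have hz' : z⁻¹ ∈ ball (0 : ℂ) r⁻¹ := by
              rw [mem_ball_zero_iff, norm_inv]
              exact inv_strictAnti₀ hr hz
            have hb' := hb _ hz'
            exact ⟨(analyticAt_id.fun_zpow hz0).mul
              (hb'.1.fun_comp (analyticAt_inv hz0)),
              mul_ne_zero (zpow_ne_zero _ hz0) hb'.2⟩) (by
            intro z hz j hj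
            rw [(hq z ⟨hz.1.1, hz.2.1⟩).2.2 j hj, hab z hz.2.2 (mem_ball_zero_iff.1 hz.1.2)]
            ring)
        refine ⟨_, (hM.inter isOpen_ball).union ((hN i).inter hout), fun z hz => ?_, u, hu⟩
        rw [mem_closedBall_zero_iff] at hz
        rcases le_total ‖z‖ (t n) with h | h
        · exact Or.inl ⟨hKM (mem_closedBall_zero_iff.2 h), mem_ball_zero_iff.2 (h.trans_lt htR)⟩
        · exact Or.inr ⟨hi' z h hz, hrt.trans_le h⟩
  have := key m
  rwa [hm m le_rfl] at this

end UnitCocycle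

end Disc

/-! ### Holomorphic functions on the projective line -/

section Holomorphic

open Filter Topology

/-- A function on the projective line is holomorphic at `x`, as read in the chart at `x`. -/
def HolAt (F : P1 → ℂ) (x : P1) : Prop :=
  AnalyticAt ℂ (F ∘ (chartAt ℂ x).symm) (chartAt ℂ x x)

lemma chartAt_coe_self (z : ℂ) : chartAt ℂ (z : P1) (z : P1) = z :=
  chartZ.right_inv (x := z) trivial

lemma holAt_coe {F : P1 → ℂ} {z : ℂ} : HolAt F z ↔ AnalyticAt ℂ (fun u : ℂ => F u) z := by
  rw [HolAt, chartAt_coe_self]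
  exact Iff.rfl

lemma holAt_infty {F : P1 → ℂ} :
    HolAt F OnePoint.infty ↔ AnalyticAt ℂ (fun w : ℂ => F (invParam w)) 0 := Iff.rfl

lemma hasOrderAt_coe {F : P1 → ℂ} {z : ℂ} {n : ℤ} : HasOrderAt F z n ↔
    MeromorphicAt (fun u : ℂ => F u) z ∧ meromorphicOrderAt (fun u : ℂ => F u) z = n := by
  rw [HasOrderAt, chartAt_coe_self]
  exact Iff.rfl

lemma hasOrderAt_infty {F : P1 → ℂ} {n : ℤ} : HasOrderAt F OnePoint.infty n ↔
    MeromorphicAt (fun w : ℂ => F (invParam w)) 0 ∧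
      meromorphicOrderAt (fun w : ℂ => F (invParam w)) 0 = n := Iff.rfl

lemma invParam_inv {z : ℂ} (hz : z ≠ 0) : invParam z⁻¹ = (z : P1) := by
  simp [invParam, hz]

lemma invParam_of_ne_zero {w : ℂ} (hw : w ≠ 0) : invParam w = ((w⁻¹ : ℂ) : P1) := if_neg hw

@[simp] lemma invParam_zero : invParam 0 = OnePoint.infty := if_pos rfl

/-- Holomorphy away from `0` may be tested in the coordinate `1 / z`. -/
lemma holAt_invParam {F : P1 → ℂ} {w : ℂ} :
    HolAt F (invParam w) ↔ AnalyticAt ℂ (fun u : ℂ => F (invParam u)) w := by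
  rcases eq_or_ne w 0 with rfl | hw
  · rw [invParam_zero, holAt_infty]
  · rw [invParam_of_ne_zero hw, holAt_coe]
    constructor
    · intro h
      refine (h.fun_comp (analyticAt_inv hw)).congr ?_
      filter_upwards [isOpen_ne.mem_nhds hw] with u hu
      rw [invParam_of_ne_zero hu]
    · intro h
      have h' : AnalyticAt ℂ (fun u : ℂ => F (invParam u)) (w⁻¹)⁻¹ := by rwa [inv_inv]
      refine (h'.fun_comp (analyticAt_inv (inv_ne_zero hw))).congr ?_
      filter_upwards [isOpen_ne.mem_nhds (inv_ne_zero hw)] with u hu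
      rw [invParam_inv hu]

lemma chartAt_symm_chartAt (x : P1) : (chartAt ℂ x).symm (chartAt ℂ x x) = x :=
  (chartAt ℂ x).left_inv (mem_chart_source ℂ x)

lemma tendsto_chartAt_symm (x : P1) :
    Tendsto (chartAt ℂ x).symm (𝓝 (chartAt ℂ x x)) (𝓝 x) := by
  have := (chartAt ℂ x).continuousAt_symm (mem_chart_target ℂ x)
  rwa [ContinuousAt, chartAt_symm_chartAt] at this

lemma tendsto_chartAt_symm_nhdsNE (x : P1) :
    Tendsto (chartAt ℂ x).symm (𝓝[≠] (chartAt ℂ x x)) (𝓝[≠] x) := by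
  refine tendsto_nhdsWithin_iff.2 ⟨(tendsto_chartAt_symm x).mono_left nhdsWithin_le_nhds, ?_⟩
  filter_upwards [nhdsWithin_le_nhds ((chartAt ℂ x).open_target.mem_nhds (mem_chart_target ℂ x)),
    self_mem_nhdsWithin] with u hu hu' h
  refine hu' ?_
  simp only [Set.mem_singleton_iff] at h ⊢
  rw [← (chartAt ℂ x).right_inv hu, h]

lemma tendsto_chartAt (x : P1) : Tendsto (chartAt ℂ x) (𝓝 x) (𝓝 (chartAt ℂ x x)) :=
  (chartAt ℂ x).continuousAt (mem_chart_source ℂ x)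

lemma tendsto_chartAt_nhdsNE (x : P1) :
    Tendsto (chartAt ℂ x) (𝓝[≠] x) (𝓝[≠] (chartAt ℂ x x)) := by
  refine tendsto_nhdsWithin_iff.2 ⟨(tendsto_chartAt x).mono_left nhdsWithin_le_nhds, ?_⟩
  filter_upwards [nhdsWithin_le_nhds (chart_source_mem_nhds ℂ x), self_mem_nhdsWithin] with y hy hy'
  exact fun h => hy' ((chartAt ℂ x).injOn hy (mem_chart_source ℂ x) h)

lemma eventually_chartAt_symm (x : P1) : ∀ᶠ y in 𝓝 x, (chartAt ℂ x).symm (chartAt ℂ x y) = y := by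
  filter_upwards [chart_source_mem_nhds ℂ x] with y hy
  exact (chartAt ℂ x).left_inv hy

lemma eventually_nhds_iff_chart {p : P1 → Prop} {x : P1} :
    (∀ᶠ y in 𝓝 x, p y) ↔ ∀ᶠ u in 𝓝 (chartAt ℂ x x), p ((chartAt ℂ x).symm u) := by
  refine ⟨fun h => (tendsto_chartAt_symm x).eventually h, fun h => ?_⟩
  filter_upwards [(tendsto_chartAt x).eventually h, eventually_chartAt_symm x] with y hy hy'
  rwa [hy'] at hy

lemma eventually_nhdsNE_iff_chart {p : P1 → Prop} {x : P1} :
    (∀ᶠ y in 𝓝[≠] x, p y) ↔ ∀ᶠ u in 𝓝[≠] (chartAt ℂ x x), p ((chartAt ℂ x).symm u) := by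
  refine ⟨fun h => (tendsto_chartAt_symm_nhdsNE x).eventually h, fun h => ?_⟩
  filter_upwards [(tendsto_chartAt_nhdsNE x).eventually h,
    nhdsWithin_le_nhds (eventually_chartAt_symm x)] with y hy hy'
  rwa [hy'] at hy

namespace HolAt

variable {F G : P1 → ℂ} {x : P1}

lemma congr (h : HolAt F x) (hFG : F =ᶠ[𝓝 x] G) : HolAt G x :=
  AnalyticAt.congr h ((tendsto_chartAt_symm x).eventually hFG)

lemma const (c : ℂ) : HolAt (fun _ => c) x := analyticAt_const

lemma mul (hF : HolAt F x) (hG : HolAt G x) : HolAt (fun y => F y * G y) x :=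
  AnalyticAt.mul hF hG

lemma inv (hF : HolAt F x) (h : F x ≠ 0) : HolAt (fun y => (F y)⁻¹) x :=
  AnalyticAt.inv (f := F ∘ (chartAt ℂ x).symm) hF (by
    rwa [Function.comp_apply, chartAt_symm_chartAt])

lemma sum {ι : Type*} {s : Finset ι} {F : ι → P1 → ℂ} (h : ∀ i ∈ s, HolAt (F i) x) :
    HolAt (fun y => ∑ i ∈ s, F i y) x :=
  Finset.analyticAt_fun_sum (f := fun i => F i ∘ (chartAt ℂ x).symm) s h

lemma prod {ι : Type*} {s : Finset ι} {F : ι → P1 → ℂ} (h : ∀ i ∈ s, HolAt (F i) x) :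
    HolAt (fun y => ∏ i ∈ s, F i y) x :=
  Finset.analyticAt_fun_prod (f := fun i => F i ∘ (chartAt ℂ x).symm) s h

lemma det {n : Type*} [Fintype n] [DecidableEq n] {M : n → n → P1 → ℂ}
    (h : ∀ i j, HolAt (M i j) x) : HolAt (fun y => (Matrix.of fun i j => M i j y).det) x := by
  simp only [Matrix.det_apply', Matrix.of_apply]
  exact sum fun σ _ => (const _).mul (prod fun i _ => h _ _)

lemma continuousAt (h : HolAt F x) : ContinuousAt F x := by
  have h1 : ContinuousAt (F ∘ (chartAt ℂ x).symm) (chartAt ℂ x x) := AnalyticAt.continuousAt h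
  have h2 := h1.tendsto.comp (tendsto_chartAt x)
  rw [ContinuousAt]
  rw [Function.comp_apply, chartAt_symm_chartAt] at h2
  refine h2.congr' ?_
  filter_upwards [eventually_chartAt_symm x] with y hy
  simp [hy]

lemma eventually (h : HolAt F x) : ∀ᶠ y in 𝓝 x, HolAt F y := by
  rw [eventually_nhds_iff_chart]
  induction x using OnePoint.rec with
  | infty =>
    filter_upwards [AnalyticAt.eventually_analyticAt h] with u hu
    exact holAt_invParam.2 hu
  | coe z =>
    filter_upwards [AnalyticAt.eventually_analyticAt h] with u hu
    exact holAt_coe.2 hu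

lemma eventually_eq_zero_or_ne_zero (h : HolAt F x) :
    (∀ᶠ y in 𝓝 x, F y = 0) ∨ ∀ᶠ y in 𝓝[≠] x, F y ≠ 0 := by
  rw [eventually_nhds_iff_chart, eventually_nhdsNE_iff_chart]
  exact AnalyticAt.eventually_eq_zero_or_eventually_ne_zero h

/-- A function that vanishes near `x`, except possibly at `x`, vanishes at `x`. -/
lemma eq_zero_of_frequently (h : HolAt F x) (h0 : ∃ᶠ y in 𝓝[≠] x, F y = 0) :
    ∀ᶠ y in 𝓝 x, F y = 0 :=
  h.eventually_eq_zero_or_ne_zero.resolve_right h0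

end HolAt

instance (x : P1) : (𝓝[≠] x).NeBot := by
  have := (tendsto_chartAt_symm_nhdsNE x).neBot
  exact this

/-- The order of vanishing of a holomorphic function at a point. -/
def ordAt (F : P1 → ℂ) (x : P1) : ℕ∞ := analyticOrderAt (F ∘ (chartAt ℂ x).symm) (chartAt ℂ x x)

/-- Divisibility of holomorphic germs is decided by the orders of vanishing. -/
lemma exists_eq_mul_of_ordAt_le {F G : P1 → ℂ} {x : P1} (hF : HolAt F x) (hG : HolAt G x)
    (h : ordAt G x ≤ ordAt F x) :
    ∃ q : P1 → ℂ, HolAt q x ∧ ∀ᶠ y in 𝓝 x, F y = q y * G y := by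
  rcases eq_or_ne (ordAt G x) ⊤ with htop | htop
  · have : ∀ᶠ y in 𝓝 x, F y = 0 := by
      rw [eventually_nhds_iff_chart]
      exact analyticOrderAt_eq_top.1 (top_le_iff.1 (htop ▸ h))
    exact ⟨fun _ => 0, HolAt.const 0, by filter_upwards [this] with y hy; simp [hy]⟩
  · obtain ⟨n, hn⟩ := ENat.ne_top_iff_exists.1 htop
    obtain ⟨g, hg, hg0, hgG⟩ := (AnalyticAt.analyticOrderAt_eq_natCast hG).1 hn.symm
    obtain ⟨f, hf, hfF⟩ := (natCast_le_analyticOrderAt hF).1 (hn ▸ h)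
    have hq : AnalyticAt ℂ (fun u => f u / g u) (chartAt ℂ x x) := hf.div hg hg0
    refine ⟨fun y => f (chartAt ℂ x y) / g (chartAt ℂ x y), ?_, ?_⟩
    · refine hq.congr ?_
      filter_upwards [(chartAt ℂ x).open_target.mem_nhds (mem_chart_target ℂ x)] with u hu
      simp [(chartAt ℂ x).right_inv hu]
    · filter_upwards [(tendsto_chartAt x).eventually hgG, (tendsto_chartAt x).eventually hfF,
        eventually_chartAt_symm x, (tendsto_chartAt x).eventually
          (hg.continuousAt.eventually_ne hg0)] with y h1 h2 h3 h4
      simp only [Function.comp_apply, h3] at h1 h2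
      rw [h1, h2, smul_eq_mul, smul_eq_mul]
      field_simp

/-- The coordinate centred at `x`. -/
def coordAt (x : P1) (y : P1) : ℂ := chartAt ℂ x y - chartAt ℂ x x

@[simp] lemma coordAt_self (x : P1) : coordAt x x = 0 := sub_self _

lemma eventually_coordAt_comp (x : P1) : (coordAt x ∘ (chartAt ℂ x).symm) =ᶠ[𝓝 (chartAt ℂ x x)]
    fun u => u - chartAt ℂ x x := by
  filter_upwards [(chartAt ℂ x).open_target.mem_nhds (mem_chart_target ℂ x)] with u hu
  simp [coordAt, (chartAt ℂ x).right_inv hu]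

lemma holAt_coordAt (x : P1) : HolAt (coordAt x) x :=
  (analyticAt_id.sub analyticAt_const).congr (eventually_coordAt_comp x).symm

lemma ordAt_coordAt (x : P1) : ordAt (coordAt x) x = 1 := by
  rw [ordAt, analyticOrderAt_congr (eventually_coordAt_comp x)]
  exact ((analyticAt_id.sub analyticAt_const).analyticOrderAt_eq_natCast (n := 1)).2
    ⟨fun _ => 1, analyticAt_const, one_ne_zero, by simp⟩

lemma ordAt_eq_zero {F : P1 → ℂ} {x : P1} (hF : HolAt F x) : ordAt F x = 0 ↔ F x ≠ 0 := by
  rw [ordAt, AnalyticAt.analyticOrderAt_eq_zero hF, Function.comp_apply, chartAt_symm_chartAt]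

/-- A holomorphic function that vanishes at `x` is divisible by the coordinate centred at `x`. -/
lemma exists_eq_mul_coordAt {F : P1 → ℂ} {x : P1} (hF : HolAt F x) (h0 : F x = 0) :
    ∃ q : P1 → ℂ, HolAt q x ∧ ∀ᶠ y in 𝓝 x, F y = q y * coordAt x y := by
  refine exists_eq_mul_of_ordAt_le hF (holAt_coordAt x) ?_
  rw [ordAt_coordAt, Order.one_le_iff_ne_zero, Ne, ordAt_eq_zero hF]
  exact not_not.2 h0

lemma coordAt_ne_zero (x : P1) : ∀ᶠ y in 𝓝[≠] x, coordAt x y ≠ 0 := by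
  filter_upwards [tendsto_chartAt_nhdsNE x self_mem_nhdsWithin] with y hy
  exact sub_ne_zero.2 hy

namespace HasOrderAt

variable {F G : P1 → ℂ} {x : P1} {m n : ℤ}

lemma congr (h : HasOrderAt F x n) (hFG : F =ᶠ[𝓝[≠] x] G) : HasOrderAt G x n := by
  have h' := (tendsto_chartAt_symm_nhdsNE x).eventually hFG
  exact ⟨h.1.congr h', (meromorphicOrderAt_congr h').symm.trans h.2⟩

lemma mul (hF : HasOrderAt F x m) (hG : HasOrderAt G x n) :
    HasOrderAt (fun y => F y * G y) x (m + n) := by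
  refine ⟨hF.1.mul hG.1, ?_⟩
  have := meromorphicOrderAt_mul hF.1 hG.1
  rw [hF.2, hG.2] at this
  exact_mod_cast this

lemma inv (hF : HasOrderAt F x m) : HasOrderAt (fun y => (F y)⁻¹) x (-m) := by
  refine ⟨hF.1.inv, ?_⟩
  have := meromorphicOrderAt_inv (f := F ∘ (chartAt ℂ x).symm) (x := chartAt ℂ x x)
  rw [hF.2] at this
  exact_mod_cast this

lemma unique (hF : HasOrderAt F x m) (hF' : HasOrderAt F x n) : m = n := by
  have := hF.2.symm.trans hF'.2
  exact_mod_cast this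

end HasOrderAt

lemma HolAt.hasOrderAt {F : P1 → ℂ} {x : P1} {n : ℕ} (hF : HolAt F x) (h : ordAt F x = n) :
    HasOrderAt F x n := by
  refine ⟨AnalyticAt.meromorphicAt hF, ?_⟩
  rw [AnalyticAt.meromorphicOrderAt_eq hF]
  change ENat.map Nat.cast (ordAt F x) = _
  rw [h]
  simp

lemma HolAt.hasOrderAt_zero {F : P1 → ℂ} {x : P1} (hF : HolAt F x) (h : F x ≠ 0) :
    HasOrderAt F x 0 := by
  exact_mod_cast hF.hasOrderAt (n := 0) ((ordAt_eq_zero hF).2 h)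

end Holomorphic

section Functions

open Filter Topology

namespace Fun

variable {U V : Opens P1}

open Classical in
/-- The extension by zero of a holomorphic function on `U`. -/
def ext0 (g : Fun U) (x : P1) : ℂ := if hx : x ∈ U then g.value x hx else 0

lemma ext0_of_mem (g : Fun U) {x : P1} (hx : x ∈ U) : g.ext0 x = g.value x hx := dif_pos hx

lemma holAt_ext0 (g : Fun U) {x : P1} (hx : x ∈ U) : HolAt g.ext0 x := by
  have h1 : ContMDiffAt 𝓘(ℂ) 𝓘(ℂ) ∞ (fun y : U => g.ext0 y) ⟨x, hx⟩ := by
    have h2 := (show ContMDiffMap 𝓘(ℂ) 𝓘(ℂ) U ℂ ∞ from g).contMDiff ⟨x, hx⟩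
    convert h2 using 1
    ext y
    exact ext0_of_mem g y.2
  have h3 := (contMDiffAt_iff.1 (contMDiffAt_subtype_iff.1 h1)).2
  simp only [mfld_simps, contDiffWithinAt_univ] at h3
  rw [HolAt, Complex.analyticAt_iff_eventually_differentiableAt]
  have h4 : ContDiffAt ℂ 1 (g.ext0 ∘ (chartAt ℂ x).symm) (chartAt ℂ x x) :=
    ContDiffAt.of_le h3 (by exact_mod_cast le_top)
  filter_upwards [h4.eventually (by simp)] with u hu
  exact hu.differentiableAt (by simp)

/-- A function that is holomorphic at all points of `U`, as a section of the structure sheaf. -/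
def ofHol (F : P1 → ℂ) (hF : ∀ x ∈ U, HolAt F x) : Fun U :=
  (⟨fun x : U => F x, fun x => by
    refine contMDiffAt_subtype_iff.2 (contMDiffAt_iff.2 ⟨(hF x x.2).continuousAt, ?_⟩)
    simp only [mfld_simps, contDiffWithinAt_univ]
    exact AnalyticAt.contDiffAt (hF x x.2)⟩ : ContMDiffMap 𝓘(ℂ) 𝓘(ℂ) U ℂ ∞)

@[simp] lemma ext0_ofHol {F : P1 → ℂ} (hF : ∀ x ∈ U, HolAt F x) {x : P1} (hx : x ∈ U) :
    (ofHol F hF).ext0 x = F x := ext0_of_mem _ hx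

lemma ext {g g' : Fun U} (h : ∀ x ∈ U, g.ext0 x = g'.ext0 x) : g = g' := by
  refine ContMDiffMap.ext (f := (g : ContMDiffMap 𝓘(ℂ) 𝓘(ℂ) U ℂ ∞))
    (g := (g' : ContMDiffMap 𝓘(ℂ) 𝓘(ℂ) U ℂ ∞)) fun x => ?_
  have := h x x.2
  rwa [ext0_of_mem g x.2, ext0_of_mem g' x.2] at this

/-- Evaluation at a point of `U`. -/
def eval (x : P1) (hx : x ∈ U) : Fun U →+* ℂ where
  toFun g := g.value x hx
  map_one' := rfl
  map_mul' _ _ := rfl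
  map_zero' := rfl
  map_add' _ _ := rfl

lemma eval_apply (g : Fun U) {x : P1} (hx : x ∈ U) : eval x hx g = g.ext0 x :=
  (ext0_of_mem g hx).symm

lemma ext0_mul (g g' : Fun U) {x : P1} (hx : x ∈ U) : (g * g').ext0 x = g.ext0 x * g'.ext0 x := by
  simp only [← eval_apply _ hx, map_mul]

lemma ext0_zero (x : P1) : (0 : Fun U).ext0 x = 0 := by
  by_cases hx : x ∈ U
  · rw [← eval_apply _ hx, map_zero]
  · exact dif_neg hx

lemma ext0_one {x : P1} (hx : x ∈ U) : (1 : Fun U).ext0 x = 1 := by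
  rw [← eval_apply _ hx, map_one]

lemma ext0_sum {ι : Type*} (s : Finset ι) (g : ι → Fun U) {x : P1} (hx : x ∈ U) :
    (∑ i ∈ s, g i).ext0 x = ∑ i ∈ s, (g i).ext0 x := by
  simp only [← eval_apply _ hx, map_sum]

/-- Restriction of holomorphic functions. -/
def res (h : V ≤ U) : Fun U →+* Fun V := (structureSheaf.obj.map (homOfLE h).op).hom

@[simp] lemma ext0_res (h : V ≤ U) (g : Fun U) {x : P1} (hx : x ∈ V) :
    (res h g).ext0 x = g.ext0 x := by
  rw [ext0_of_mem _ hx, ext0_of_mem _ (h hx)]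
  rfl

/-- The identity theorem, in the form that a function without zeros off a point is not a zero
divisor. -/
lemma eq_zero_of_mul_eq_zero {a c : Fun V} {p : P1} (hc : ∀ y ∈ V, y ≠ p → c.ext0 y ≠ 0)
    (h : a * c = 0) : a = 0 := by
  have h1 : ∀ y ∈ V, y ≠ p → a.ext0 y = 0 := fun y hy hyp => by
    have := congrArg (fun g : Fun V => g.ext0 y) h
    simp only [ext0_mul _ _ hy, ext0_zero] at this
    exact (mul_eq_zero.1 this).resolve_right (hc y hy hyp)
  refine ext fun x hx => ?_
  rw [ext0_zero]
  rcases eq_or_ne x p with rfl | hxp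
  · refine ((a.holAt_ext0 hx).eq_zero_of_frequently (Eventually.frequently ?_)).self_of_nhds
    filter_upwards [self_mem_nhdsWithin, nhdsWithin_le_nhds (V.isOpen.mem_nhds hx)] with y hy hy'
    exact h1 y hy' hy
  · exact h1 x hx hxp

end Fun

end Functions

/-! ### Sections of sheaves of modules -/

section Sections

variable {A B C E : Mod} {U V W : Opens P1}

/-- The action of a morphism on sections. -/
def app (f : A ⟶ B) (U : Opens P1) : Sec A U →ₗ[Fun U] Sec B U := (f.val.app (op U)).hom

@[simp] lemma app_id (s : Sec A U) : app (𝟙 A) U s = s := rfl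

@[simp] lemma app_comp (f : A ⟶ B) (g : B ⟶ C) (s : Sec A U) :
    app (f ≫ g) U s = app g U (app f U s) := rfl

@[simp] lemma app_zero (s : Sec A U) : app (0 : A ⟶ B) U s = 0 := rfl

lemma app_restrict (f : A ⟶ B) (h : V ≤ U) (s : Sec A U) :
    app f V (restrict A h s) = restrict B h (app f U s) :=
  PresheafOfModules.naturality_apply f.val (homOfLE h).op s

lemma restrict_add (h : V ≤ U) (s t : Sec E U) :
    restrict E h (s + t) = restrict E h s + restrict E h t :=
  map_add (E.val.map (homOfLE h).op).hom s t

@[simp] lemma restrict_zero (h : V ≤ U) : restrict E h (0 : Sec E U) = 0 :=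
  map_zero (E.val.map (homOfLE h).op).hom

lemma restrict_sum {ι : Type*} (h : V ≤ U) (t : Finset ι) (s : ι → Sec E U) :
    restrict E h (∑ i ∈ t, s i) = ∑ i ∈ t, restrict E h (s i) :=
  map_sum (E.val.map (homOfLE h).op).hom s t

lemma restrict_smul (h : V ≤ U) (a : Fun U) (s : Sec E U) :
    restrict E h (a • s) = Fun.res h a • restrict E h s :=
  E.val.map_smul (homOfLE h).op a s

@[simp] lemma restrict_restrict (h : V ≤ U) (h' : W ≤ V) (s : Sec E U) :
    restrict E h' (restrict E h s) = restrict E (h'.trans h) s :=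
  (E.val.map_comp_apply (homOfLE h).op (homOfLE h').op s).symm

@[simp] lemma restrict_self (h : U ≤ U) (s : Sec E U) : restrict E h s = s := by
  have h1 : (homOfLE h).op = 𝟙 (op U) := rfl
  rw [restrict, h1, E.val.map_id]
  rfl

/-- The underlying sheaf of abelian groups. -/
def toTopSheaf (E : Mod) : TopCat.Sheaf AddCommGrpCat.{0} (TopCat.of P1) :=
  ⟨E.val.presheaf, E.isSheaf⟩

lemma eq_of_locally_eq {s t : Sec E U}
    (h : ∀ x ∈ U, ∃ (V : Opens P1) (hV : V ≤ U), x ∈ V ∧ restrict E hV s = restrict E hV t) :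
    s = t := by
  choose V hV hxV hst using h
  refine (toTopSheaf E).eq_of_locally_eq' (fun x : U => V x x.2) U (fun x => homOfLE (hV x x.2))
    (fun x hx => ?_) s t fun x => hst x x.2
  exact Opens.mem_iSup.2 ⟨⟨x, hx⟩, hxV x hx⟩

lemma exists_glue {ι : Type} (V : ι → Opens P1) (s : ∀ i, Sec E (V i))
    (h : ∀ i j, restrict E inf_le_left (s i) = restrict E (inf_le_right : V i ⊓ V j ≤ V j) (s j))
    (hU : U ≤ iSup V) (hV : ∀ i, V i ≤ U) :
    ∃ t : Sec E U, ∀ i, restrict E (hV i) t = s i := by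
  let s' : ∀ i, ToType ((toTopSheaf E).obj.obj (op (V i))) := s
  obtain ⟨t, ht, -⟩ := (toTopSheaf E).existsUnique_gluing' V U (fun i => homOfLE (hV i)) hU s' h
  exact ⟨t, ht⟩

lemma app_injective (f : A ⟶ B) [Mono f] (U : Opens P1) : Function.Injective (app f U) := by
  have : Mono ((SheafOfModules.evaluation structureSheaf (op U)).map f) := inferInstance
  exact (ModuleCat.mono_iff_injective _).1 this

lemma exists_app_eq_of_exact {S : ShortComplex Mod} (hS : S.Exact) [Mono S.f] {s : Sec S.X₂ U}
    (hs : app S.g U s = 0) : ∃ t, app S.f U t = s := by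
  have : (SheafOfModules.evaluation structureSheaf (op U)).PreservesZeroMorphisms :=
    ⟨fun _ _ => rfl⟩
  have h1 := hS.map_of_mono_of_preservesKernel
    (SheafOfModules.evaluation structureSheaf (op U)) inferInstance inferInstance
  exact (ShortComplex.moduleCat_exact_iff _).1 h1 s hs

lemma isZero_of_isZero_sheafification (P : PresheafOfModules structureSheaf.obj)
    (h : IsZero ((PresheafOfModules.sheafification (𝟙 structureSheaf.obj)).obj P))
    (s : P.obj (op U)) : ∀ x ∈ U, ∃ (V : Opens P1) (hV : V ≤ U), x ∈ V ∧
      P.map (homOfLE hV).op s = 0 := by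
  intro x hx
  have h1 : toSheafify (Opens.grothendieckTopology (TopCat.of P1)) P.presheaf = 0 := by
    have h2 : IsZero
        ((PresheafOfModules.sheafification (𝟙 structureSheaf.obj)).obj P).val.presheaf :=
      (Functor.map_isZero (SheafOfModules.forget _ ⋙ PresheafOfModules.toPresheaf _) h)
    exact h2.eq_of_tgt _ _
  have h3 := Presheaf.equalizerSieve_mem (Opens.grothendieckTopology (TopCat.of P1))
    (toSheafify (Opens.grothendieckTopology (TopCat.of P1)) P.presheaf) s 0 (by rw [h1]; rfl)
  obtain ⟨V, f, hf, hxV⟩ := h3 x hx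
  refine ⟨V, leOfHom f, hxV, ?_⟩
  have h4 : P.presheaf.map f.op s = P.presheaf.map f.op 0 := hf
  rw [map_zero] at h4
  exact h4

lemma epi_map_of_isIso_counit {C D : Type*} [Category* C] [Category* D] {F : C ⥤ D} {G : D ⥤ C}
    (adj : F ⊣ G) [IsIso adj.counit] {X Y : D} (f : X ⟶ Y) [Epi f] : Epi (F.map (G.map f)) := by
  have h : F.map (G.map f) = adj.counit.app X ≫ f ≫ inv (adj.counit.app Y) := by
    rw [← Category.assoc]
    exact (IsIso.eq_comp_inv _).2 (adj.counit.naturality f)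
  rw [h]
  exact epi_comp' inferInstance (epi_comp' inferInstance inferInstance)

/-- Epimorphisms of sheaves of modules are locally surjective: the sheafification of the cokernel
presheaf vanishes. -/
lemma exists_local_lift (f : A ⟶ B) [Epi f] (s : Sec B U) {x : P1} (hx : x ∈ U) :
    ∃ (V : Opens P1) (hV : V ≤ U), x ∈ V ∧ ∃ t : Sec A V, app f V t = restrict B hV s := by
  let F := PresheafOfModules.sheafification.{0} (𝟙 structureSheaf.obj)
  let adj := PresheafOfModules.sheafificationAdjunction.{0} (𝟙 structureSheaf.obj)
  let π := cokernel.π f.val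
  have h0 : IsIso adj.counit :=
    inferInstanceAs (IsIso (PresheafOfModules.sheafificationAdjunction.{0}
      (𝟙 structureSheaf.obj)).counit)
  have h1 : Epi (F.map f.val) := by
    exact epi_map_of_isIso_counit adj f
  have h5 : IsZero (F.obj (cokernel f.val)) := by
    have : F.PreservesEpimorphisms := Functor.preservesEpimorphisms_of_adjunction adj
    have h6 : F.map f.val ≫ F.map π = 0 := by
      have := Functor.preservesZeroMorphisms_of_isLeftAdjoint F
      rw [← F.map_comp, cokernel.condition, F.map_zero]
    exact IsZero.of_epi_eq_zero (F.map π) (zero_of_epi_comp _ h6)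
  obtain ⟨V, hV, hxV, h⟩ := isZero_of_isZero_sheafification _ h5 (π.app (op U) s) x hx
  refine ⟨V, hV, hxV, ?_⟩
  rw [← PresheafOfModules.naturality_apply] at h
  have h7 : Function.Exact (f.val.app (op V)) (π.app (op V)) := by
    have h8 : (ShortComplex.mk f.val π (cokernel.condition _)).Exact :=
      ShortComplex.exact_cokernel _
    have := h8.map (PresheafOfModules.evaluation structureSheaf.obj (op V))
    exact (ShortComplex.ShortExact.moduleCat_exact_iff_function_exact _).1 this
  exact (h7 _).1 h

end Sections

/-! ### Local bases -/

section Bases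

open Filter Topology

variable {A B C E : Mod} {U V W : Opens P1}
  {ι κ : Type*} [Fintype ι] [Fintype κ]

/-- A frame of `E` over `U`, indexed by an arbitrary finite type. -/
def IsBasisOn (E : Mod) (U : Opens P1) (e : ι → Sec E U) : Prop :=
  ∀ (V : Opens P1) (h : V ≤ U),
    Function.Bijective fun a : ι → Fun V => ∑ i, a i • restrict E h (e i)

lemma isFrame_iff {r : ℕ} {e : Fin r → Sec E U} : IsFrame E U e ↔ IsBasisOn E U e := by
  refine forall₂_congr fun V h => and_congr ?_ ?_
  · rw [Fintype.linearIndependent_iff]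
    constructor
    · intro H a a' haa'
      have := H (fun i => a i - a' i) (by
        simp only [sub_smul, Finset.sum_sub_distrib]
        exact sub_eq_zero.2 haa')
      exact funext fun i => sub_eq_zero.1 (this i)
    · intro H a ha i
      exact congrFun (H (a₁ := a) (a₂ := 0) (by simpa using ha)) i
  · rw [Submodule.eq_top_iff']
    exact forall_congr' fun s => Submodule.mem_span_range_iff_exists_fun _

namespace IsBasisOn

variable {e : ι → Sec E U} (he : IsBasisOn E U e)

include he

lemma restrict (h : V ≤ U) : IsBasisOn E V (fun i => restrict E h (e i)) := fun W hW => by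
  simpa only [restrict_restrict] using he W (hW.trans h)

lemma comp_equiv (σ : κ ≃ ι) : IsBasisOn E U (e ∘ σ) := fun V h => by
  have h1 : (fun a : κ → Fun V => ∑ i, a i • Twistor.restrict E h ((e ∘ σ) i)) =
      (fun a : ι → Fun V => ∑ i, a i • Twistor.restrict E h (e i)) ∘
        (σ.arrowCongr (Equiv.refl _)) := by
    funext a
    simp only [Function.comp_apply, Equiv.arrowCongr_apply, Equiv.refl_apply, Function.comp_def]
    exact Fintype.sum_equiv σ _ _ fun i => by simp
  rw [h1]
  exact (he V h).comp (Equiv.bijective _)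

/-- The coordinates of a section. -/
def coord (h : V ≤ U) (s : Sec E V) : ι → Fun V := ((he V h).2 s).choose

lemma sum_coord (h : V ≤ U) (s : Sec E V) :
    ∑ i, he.coord h s i • Twistor.restrict E h (e i) = s := ((he V h).2 s).choose_spec

lemma coord_unique (h : V ≤ U) {s : Sec E V} {a : ι → Fun V}
    (ha : ∑ i, a i • Twistor.restrict E h (e i) = s) : he.coord h s = a :=
  (he V h).1 ((he.sum_coord h s).trans ha.symm)

lemma coord_restrict (h : V ≤ U) (h' : W ≤ V) (s : Sec E V) (i : ι) :
    he.coord (h'.trans h) (Twistor.restrict E h' s) i = Fun.res h' (he.coord h s i) := by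
  refine congrFun (he.coord_unique (a := fun i => Fun.res h' (he.coord h s i)) _ ?_) i
  conv_rhs => rw [← he.sum_coord h s]
  simp only [restrict_sum, restrict_smul, restrict_restrict]

lemma coord_sum {μ : Type*} (t : Finset μ) (h : V ≤ U) (a : μ → Fun V) (s : μ → Sec E V) (i : ι) :
    he.coord h (∑ j ∈ t, a j • s j) i = ∑ j ∈ t, a j * he.coord h (s j) i := by
  refine congrFun (he.coord_unique (a := fun i => ∑ j ∈ t, a j * he.coord h (s j) i) _ ?_) i
  conv_rhs => enter [2, j]; rw [← he.sum_coord h (s j)]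
  simp only [Finset.sum_smul, Finset.smul_sum, smul_smul]
  exact Finset.sum_comm

lemma coord_zero (h : V ≤ U) (i : ι) : he.coord h (0 : Sec E V) i = 0 :=
  congrFun (he.coord_unique (a := 0) h (by simp)) i

omit he in
/-- Bases may be recognized locally, thanks to the uniqueness of coordinates. -/
lemma of_locally (hinj : ∀ (V : Opens P1) (h : V ≤ U) (a : ι → Fun V),
      ∑ i, a i • Twistor.restrict E h (e i) = 0 → a = 0)
    (hsurj : ∀ (V : Opens P1) (h : V ≤ U) (s : Sec E V), ∀ x ∈ V, ∃ (W : Opens P1) (hW : W ≤ V),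
      x ∈ W ∧ ∃ a : ι → Fun W,
        ∑ i, a i • Twistor.restrict E (hW.trans h) (e i) = Twistor.restrict E hW s) :
    IsBasisOn E U e := by
  have hinj' : ∀ (V : Opens P1) (h : V ≤ U),
      Function.Injective fun a : ι → Fun V => ∑ i, a i • Twistor.restrict E h (e i) := by
    intro V h a a' haa'
    refine sub_eq_zero.1 (hinj V h (a - a') ?_)
    simp only [Pi.sub_apply, sub_smul, Finset.sum_sub_distrib]
    exact sub_eq_zero.2 haa'
  refine fun V h => ⟨hinj' V h, fun s => ?_⟩
  choose W hW hxW a ha using hsurj V h s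
  have hres : ∀ x hx (W' : Opens P1) (h' : W' ≤ W x hx),
      ∑ i, Fun.res h' (a x hx i) • Twistor.restrict E (h'.trans ((hW x hx).trans h)) (e i) =
        Twistor.restrict E (h'.trans (hW x hx)) s := by
    intro x hx W' h'
    have := congrArg (Twistor.restrict E h') (ha x hx)
    simpa only [restrict_sum, restrict_smul, restrict_restrict] using this
  have hcompat : ∀ x hx y hy z, z ∈ W x hx → z ∈ W y hy →
      ∀ i, (a x hx i).ext0 z = (a y hy i).ext0 z := by
    intro x hx y hy z hzx hzy i
    have h1 := (hres x hx (W x hx ⊓ W y hy) inf_le_left).trans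
      (hres y hy (W x hx ⊓ W y hy) inf_le_right).symm
    have h2 := congrFun (hinj' _ _ h1) i
    have h3 := congrArg (fun g => Fun.ext0 g z) h2
    have hz : z ∈ W x hx ⊓ W y hy := ⟨hzx, hzy⟩
    simpa only [Fun.ext0_res _ _ hz] using h3
  classical
  have hhol : ∀ i, ∀ x ∈ V,
      HolAt (fun y => if hy : y ∈ V then (a y hy i).ext0 y else 0) x := by
    intro i x hx
    refine ((a x hx i).holAt_ext0 (hxW x hx)).congr ?_
    filter_upwards [(W x hx).isOpen.mem_nhds (hxW x hx)] with y hy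
    rw [dif_pos (hW x hx hy)]
    exact hcompat x hx y _ y hy (hxW y _) i
  refine ⟨fun i => Fun.ofHol _ (hhol i), eq_of_locally_eq fun x hx => ?_⟩
  refine ⟨W x hx, hW x hx, hxW x hx, ?_⟩
  rw [← ha x hx, restrict_sum]
  refine Finset.sum_congr rfl fun i _ => ?_
  rw [restrict_smul, restrict_restrict]
  congr 1
  refine Fun.ext fun y hy => ?_
  rw [Fun.ext0_res _ _ hy, Fun.ext0_ofHol (hhol i) (hW x hx hy), dif_pos (hW x hx hy)]
  exact (hcompat x hx y _ y hy (hxW y _) i).symm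

omit he in
lemma coord_mul_coord [DecidableEq ι] (he : IsBasisOn E U e) {e' : κ → Sec E U}
    (he' : IsBasisOn E U e') {x : P1} (hx : x ∈ U) :
    (Matrix.of fun i j => (he'.coord le_rfl (e i) j).ext0 x) *
      (Matrix.of fun i j => (he.coord le_rfl (e' i) j).ext0 x) = 1 := by
  ext i k
  have h1 : he.coord le_rfl (e i) k = if i = k then 1 else 0 := by
    refine congrFun (he.coord_unique (a := fun k => if i = k then 1 else 0) le_rfl ?_) k
    simp
  have h2 := he.coord_sum Finset.univ le_rfl (he'.coord le_rfl (e i)) e' k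
  have h3 := he'.sum_coord le_rfl (e i)
  simp only [restrict_self] at h3
  rw [h3, h1] at h2
  have h4 := congrArg (fun g => Fun.ext0 g x) h2
  simp only [Fun.ext0_sum _ _ hx, Fun.ext0_mul _ _ hx] at h4
  rw [Matrix.mul_apply, Matrix.one_apply]
  simp only [Matrix.of_apply]
  rw [← h4]
  split_ifs
  · exact Fun.ext0_one hx
  · exact Fun.ext0_zero x

/-- Two bases over neighbourhoods of a point have the same number of elements. -/
lemma card_eq {U' : Opens P1} {e' : κ → Sec E U'} (he' : IsBasisOn E U' e') {x : P1}
    (hx : x ∈ U) (hx' : x ∈ U') : Fintype.card ι = Fintype.card κ := by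
  classical
  have hb := he.restrict (inf_le_left : U ⊓ U' ≤ U)
  have hb' := he'.restrict (inf_le_right : U ⊓ U' ≤ U')
  exact Matrix.square_of_invertible _ _ (coord_mul_coord hb hb' ⟨hx, hx'⟩)
    (coord_mul_coord hb' hb ⟨hx, hx'⟩)

/-- An elementary change of basis: multiples of one basis vector are added to the others. -/
lemma add_smul [DecidableEq ι] (i₀ : ι) {q : ι → Fun U} (hq : q i₀ = 0) :
    IsBasisOn E U (fun i => e i + q i • e i₀) := by
  intro V h
  let T : Fun V → (ι → Fun V) → ι → Fun V := fun c a i =>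
    a i + c * (if i = i₀ then ∑ j, a j * Fun.res h (q j) else 0)
  have hT : ∀ c c', c + c' = 0 → ∀ a, T c (T c' a) = a := by
    intro c c' hc a
    have h1 : ∑ j, T c' a j * Fun.res h (q j) = ∑ j, a j * Fun.res h (q j) := by
      refine Finset.sum_congr rfl fun j _ => ?_
      simp only [T]
      split_ifs with hj
      · rw [hj, hq, map_zero, mul_zero, mul_zero]
      · rw [mul_zero, add_zero]
    funext i
    simp only [T] at h1 ⊢
    rw [h1]
    split_ifs
    · rw [add_assoc, ← add_mul, add_comm c' c, hc, zero_mul, add_zero]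
    · simp
  have h1 : (fun a : ι → Fun V => ∑ i, a i • Twistor.restrict E h (e i + q i • e i₀)) =
      (fun a : ι → Fun V => ∑ i, a i • Twistor.restrict E h (e i)) ∘ T 1 := by
    funext a
    simp only [Function.comp_apply, T, restrict_add, restrict_smul, smul_add,
      Finset.sum_add_distrib,
      one_mul, _root_.add_smul, ite_smul, zero_smul, Finset.sum_ite_eq', Finset.mem_univ, if_true,
      Finset.sum_smul, smul_smul]
  rw [h1]
  exact (he V h).comp (Function.bijective_iff_has_inverse.2
      ⟨T (-1), hT _ _ (by simp), hT _ _ (by simp)⟩)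

end IsBasisOn

/-- Among finitely many holomorphic functions near a point, one divides the others. -/
lemma exists_dvd_all {x : P1} (hx : x ∈ U) (s : Finset ι) (c : ι → Fun U) :
    ∃ (V : Opens P1) (hV : V ≤ U), x ∈ V ∧ ((∀ i ∈ s, Fun.res hV (c i) = 0) ∨
      ∃ i₀ ∈ s, (∀ y ∈ V, y ≠ x → (c i₀).ext0 y ≠ 0) ∧
        ∃ q : ι → Fun V, ∀ i ∈ s, Fun.res hV (c i) = q i * Fun.res hV (c i₀)) := by
  rcases s.eq_empty_or_nonempty with rfl | hs
  · exact ⟨U, le_rfl, hx, Or.inl (by simp)⟩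
  obtain ⟨i₀, hi₀, hmin⟩ := s.exists_min_image (fun i => ordAt (c i).ext0 x) hs
  have hhol : ∀ i, HolAt (c i).ext0 x := fun i => (c i).holAt_ext0 hx
  have hdiv : ∀ i, ∃ q : P1 → ℂ, HolAt q x ∧
      (i ∈ s → ∀ᶠ y in 𝓝 x, (c i).ext0 y = q y * (c i₀).ext0 y) := fun i => by
    by_cases hi : i ∈ s
    · obtain ⟨q, hq, hq'⟩ := exists_eq_mul_of_ordAt_le (hhol i) (hhol i₀) (hmin i hi)
      exact ⟨q, hq, fun _ => hq'⟩
    · exact ⟨_, HolAt.const 0, fun h => absurd h hi⟩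
  choose q hq hq' using hdiv
  have e0 : ∀ᶠ y in 𝓝 x, y ∈ U := U.isOpen.mem_nhds hx
  have e1 : ∀ᶠ y in 𝓝 x, y ∈ U ∧ (∀ i, HolAt (q i) y) ∧
      ∀ i, i ∈ s → (c i).ext0 y = q i y * (c i₀).ext0 y := by
    refine e0.and ((eventually_all.2 fun i =>
      (hq i).eventually).and (eventually_all.2 fun i => ?_))
    by_cases hi : i ∈ s
    · filter_upwards [hq' i hi] with y hy _ using hy
    · exact Eventually.of_forall fun y h => absurd h hi
  rcases (hhol i₀).eventually_eq_zero_or_ne_zero with h0 | h0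
  · obtain ⟨V, hV, hVo, hxV⟩ := eventually_nhds_iff.1 (e1.and h0)
    refine ⟨⟨V, hVo⟩, fun y hy => (hV y hy).1.1, hxV, Or.inl fun i hi => Fun.ext fun y hy => ?_⟩
    rw [Fun.ext0_res _ _ hy, (hV y hy).1.2.2 i hi, (hV y hy).2, mul_zero, Fun.ext0_zero]
  · rw [eventually_nhdsWithin_iff] at h0
    obtain ⟨V, hV, hVo, hxV⟩ := eventually_nhds_iff.1 (e1.and h0)
    have hVU : (⟨V, hVo⟩ : Opens P1) ≤ U := fun y hy => (hV y hy).1.1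
    have hqV : ∀ i, ∀ y ∈ (⟨V, hVo⟩ : Opens P1), HolAt (q i) y := fun i y hy => (hV y hy).1.2.1 i
    refine ⟨⟨V, hVo⟩, hVU, hxV, Or.inr ⟨i₀, hi₀, fun y hy => (hV y hy).2,
      fun i => Fun.ofHol (q i) (hqV i), fun i hi => Fun.ext fun y hy => ?_⟩⟩
    rw [Fun.ext0_mul _ _ hy, Fun.ext0_res _ _ hy, Fun.ext0_res _ _ hy, Fun.ext0_ofHol (hqV i) hy,
      (hV y hy).1.2.2 i hi]

end Bases

/-! ### Kernels and images of morphisms of bundles -/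

section LocallyFree

open Filter Topology

variable {A B C E : Mod} {U V W : Opens P1}
  {ι κ : Type*} [Fintype ι] [Fintype κ]

lemma IsBasisOn.coord_add_smul {e : ι → Sec E U} (he : IsBasisOn E U e) (h : V ≤ U)
    (s t : Sec E V) (a : Fun V) (i : ι) :
    he.coord h (s + a • t) i = he.coord h s i + a * he.coord h t i := by
  refine congrFun (he.coord_unique (a := fun i => he.coord h s i + a * he.coord h t i) h ?_) i
  conv_rhs => rw [← he.sum_coord h s, ← he.sum_coord h t]
  simp only [_root_.add_smul, Finset.sum_add_distrib, Finset.smul_sum, smul_smul]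

/-- Column reduction: near every point, a morphism kills some of the vectors of a suitable basis of
its source and is injective on the span of the others. One coordinate of the target is treated after
the other; its pivot is a function that divides the remaining entries of the row. -/
lemma exists_reduced_basis (f : A ⟶ B) {x : P1} (hx : x ∈ U) {e : ι → Sec A U}
    (he : IsBasisOn A U e) {b : κ → Sec B U} (hb : IsBasisOn B U b) :
    ∃ (V : Opens P1) (_ : V ≤ U) (_ : x ∈ V) (e' : ι → Sec A V) (S : Finset ι), IsBasisOn A V e' ∧
      (∀ i ∉ S, app f V (e' i) = 0) ∧ ∀ (W : Opens P1) (h : W ≤ V) (a : ι → Fun W),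
        ∑ i, a i • restrict B h (app f V (e' i)) = 0 → ∀ i ∈ S, a i = 0 := by
  classical
  have key : ∀ K : Finset κ, ∃ (V : Opens P1) (hV : V ≤ U) (_ : x ∈ V) (e' : ι → Sec A V)
      (S : Finset ι), IsBasisOn A V e' ∧
      (∀ k ∈ K, ∀ i ∉ S, hb.coord hV (app f V (e' i)) k = 0) ∧
      ∀ (W : Opens P1) (h : W ≤ V) (a : ι → Fun W),
        (∀ k ∈ K, ∑ i, a i * Fun.res h (hb.coord hV (app f V (e' i)) k) = 0) →
          ∀ i ∈ S, a i = 0 := by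
    intro K
    induction K using Finset.induction_on with
    | empty => exact ⟨U, le_rfl, hx, e, ∅, he, by simp, by simp⟩
    | insert k₀ K _ ih =>
      obtain ⟨V, hV, hxV, e', S, he', hzero, hind⟩ := ih
      obtain ⟨V', hV', hxV', hdvd⟩ :=
        exists_dvd_all hxV Sᶜ fun i => hb.coord hV (app f V (e' i)) k₀
      rcases hdvd with h0 | ⟨i₀, hi₀, hne, q, hq⟩
      · have hcoord : ∀ i k, hb.coord (hV'.trans hV) (app f V' (restrict A hV' (e' i))) k =
            Fun.res hV' (hb.coord hV (app f V (e' i)) k) := fun i k => by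
          rw [app_restrict, hb.coord_restrict hV hV']
        refine ⟨V', hV'.trans hV, hxV', fun i => restrict A hV' (e' i), S, he'.restrict hV', ?_, ?_⟩
        · intro k hk i hi
          rw [hcoord]
          rcases Finset.mem_insert.1 hk with rfl | hk
          · exact h0 i (Finset.mem_compl.2 hi)
          · rw [hzero k hk i hi, map_zero]
        · intro W h a ha
          refine hind W (h.trans hV') a fun k hk => ?_
          have := ha k (Finset.mem_insert_of_mem hk)
          simp only [hcoord] at this
          exact this
      · let p : ι → Fun V' := fun i => if i ∈ S ∨ i = i₀ then 0 else -q i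
        have hi₀S : i₀ ∉ S := Finset.mem_compl.1 hi₀
        have hcoord : ∀ i k, hb.coord (hV'.trans hV) (app f V' (restrict A hV' (e' i) +
            p i • restrict A hV' (e' i₀))) k = Fun.res hV' (hb.coord hV (app f V (e' i)) k) +
              p i * Fun.res hV' (hb.coord hV (app f V (e' i₀)) k) := fun i k => by
          rw [map_add, map_smul, hb.coord_add_smul, app_restrict, app_restrict,
            hb.coord_restrict hV hV', hb.coord_restrict hV hV']
        refine ⟨V', hV'.trans hV, hxV', _, insert i₀ S,
          (he'.restrict hV').add_smul i₀ (q := p) (by simp [p]), ?_, ?_⟩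
        · intro k hk i hi
          rw [hcoord]
          rw [Finset.mem_insert, not_or] at hi
          rcases Finset.mem_insert.1 hk with rfl | hk
          · rw [hq i (Finset.mem_compl.2 hi.2)]
            simp only [p, hi.1, hi.2, or_self, if_false]
            rw [neg_mul, add_neg_cancel]
          · rw [hzero k hk i hi.2, hzero k hk i₀ hi₀S, map_zero, mul_zero, add_zero]
        · intro W h a ha
          simp only [hcoord] at ha
          simp only [map_add, map_mul] at ha
          have haS : ∀ i ∈ S, a i = 0 := by
            refine hind W (h.trans hV') a fun k hk => ?_
            have := ha k (Finset.mem_insert_of_mem hk)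
            rw [hzero k hk i₀ hi₀S] at this
            simp only [map_zero, mul_zero, add_zero] at this
            exact this
          have ha₀ := ha k₀ (Finset.mem_insert_self _ _)
          rw [Finset.sum_eq_single i₀] at ha₀
          · have hp : p i₀ = 0 := by simp [p]
            rw [hp, map_zero, zero_mul, add_zero] at ha₀
            intro i hi
            rcases Finset.mem_insert.1 hi with rfl | hi
            · refine Fun.eq_zero_of_mul_eq_zero (p := x) (fun y hy hyx => ?_) ha₀
              rw [Fun.ext0_res _ _ hy, Fun.ext0_res _ _ (h hy)]
              exact hne y (h hy) hyx
            · exact haS i hi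
          · intro i _ hi
            by_cases hiS : i ∈ S
            · rw [haS i hiS, zero_mul]
            · rw [hq i (Finset.mem_compl.2 hiS)]
              simp only [p, hi, hiS, or_self, if_false]
              rw [map_mul, map_neg, neg_mul, add_neg_cancel, mul_zero]
          · simp
  obtain ⟨V, hV, hxV, e', S, he', hzero, hind⟩ := key Finset.univ
  refine ⟨V, hV, hxV, e', S, he', fun i hi => ?_, fun W h a ha => hind W h a fun k _ => ?_⟩
  · rw [← hb.sum_coord hV (app f V (e' i))]
    exact Finset.sum_eq_zero fun k _ => by rw [hzero k (Finset.mem_univ k) i hi, zero_smul]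
  · have := hb.coord_sum Finset.univ (h.trans hV) a (fun i => restrict B h (app f V (e' i))) k
    rw [ha, hb.coord_zero] at this
    simp only [hb.coord_restrict hV h] at this
    exact this.symm

lemma isBundleOfRank_of_basis {r : ℕ} (h : ∀ x : P1, ∃ U : Opens P1, x ∈ U ∧
    ∃ (ι : Type) (_ : Fintype ι) (e : ι → Sec E U), IsBasisOn E U e ∧ Fintype.card ι = r) :
    IsBundleOfRank E r := by
  intro x
  obtain ⟨U, hxU, ι, _, e, he, hr⟩ := h x
  exact ⟨U, hxU, _, isFrame_iff.2 (he.comp_equiv (Fintype.equivFinOfCardEq hr).symm)⟩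

lemma IsBundleOfRank.exists_basis {r : ℕ} (h : IsBundleOfRank E r) (x : P1) :
    ∃ U : Opens P1, x ∈ U ∧ ∃ e : Fin r → Sec E U, IsBasisOn E U e := by
  obtain ⟨U, hxU, e, he⟩ := h x
  exact ⟨U, hxU, e, isFrame_iff.1 he⟩

lemma IsBundleOfRank.unique {r s : ℕ} (h : IsBundleOfRank E r) (h' : IsBundleOfRank E s) :
    r = s := by
  obtain ⟨U, hU, e, he⟩ := h.exists_basis OnePoint.infty
  obtain ⟨U', hU', e', he'⟩ := h'.exists_basis OnePoint.infty
  simpa using he.card_eq he' hU hU'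

/-- A locally free sheaf has constant rank, because the projective line is connected. -/
lemma isBundle_of_basis (h : ∀ x : P1, ∃ U : Opens P1, x ∈ U ∧
    ∃ (ι : Type) (_ : Fintype ι) (e : ι → Sec E U), IsBasisOn E U e) : IsBundle E := by
  choose U hxU ι _ e he using h
  have hloc : IsLocallyConstant fun x => Fintype.card (ι x) := by
    rw [IsLocallyConstant.iff_exists_open]
    exact fun x => ⟨U x, (U x).isOpen, hxU x, fun y hy => (he y).card_eq (he x) (hxU y) hy⟩
  refine ⟨Fintype.card (ι OnePoint.infty), isBundleOfRank_of_basis fun x => ⟨U x, hxU x, ι x, _,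
    e x, he x, ?_⟩⟩
  exact hloc.apply_eq_of_isPreconnected isPreconnected_univ trivial trivial

lemma IsBundle.exists_reduced_basis (hA : IsBundle A) (hB : IsBundle B) (f : A ⟶ B) (x : P1) :
    ∃ (V : Opens P1) (_ : x ∈ V) (ι : Type) (_ : Fintype ι) (e : ι → Sec A V) (S : Finset ι),
      IsBasisOn A V e ∧ (∀ i ∉ S, app f V (e i) = 0) ∧
      ∀ (W : Opens P1) (h : W ≤ V) (a : ι → Fun W),
        ∑ i, a i • restrict B h (app f V (e i)) = 0 → ∀ i ∈ S, a i = 0 := by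
  obtain ⟨r, hr⟩ := hA
  obtain ⟨s, hs⟩ := hB
  obtain ⟨U, hxU, e, he⟩ := hr.exists_basis x
  obtain ⟨U', hxU', b, hb⟩ := hs.exists_basis x
  obtain ⟨V, -, hxV, e', S, h⟩ := Twistor.exists_reduced_basis f (U := U ⊓ U') ⟨hxU, hxU'⟩
    (he.restrict inf_le_left) (hb.restrict inf_le_right)
  exact ⟨V, hxV, _, _, e', S, h⟩

lemma sum_subtype_smul {R M : Type*} [Ring R] [AddCommGroup M] [Module R M] (p : ι → Prop)
    [DecidablePred p] [hF : Fintype {i // p i}] (a : {i // p i} → R) (m : ι → M) :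
    ∑ i : {i // p i}, a i • m i = ∑ i, (if h : p i then a ⟨i, h⟩ else 0) • m i := by
  have h1 := Finset.sum_subtype (F := hF) (Finset.univ.filter p) (p := p) (by simp)
    (fun i => (if h : p i then a ⟨i, h⟩ else 0) • m i)
  rw [Finset.sum_filter_of_ne] at h1
  · rw [h1]
    exact Finset.sum_congr rfl fun i _ => by rw [dif_pos i.2]
  · intro i _ hi
    by_contra h
    exact hi (by rw [dif_neg h, zero_smul])

/-- The kernel of a morphism of bundles is a bundle. -/
lemma IsBundle.of_exact_left {S : ShortComplex Mod} (hS : S.Exact) [Mono S.f]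
    (h₂ : IsBundle S.X₂) (h₃ : IsBundle S.X₃) : IsBundle S.X₁ := by
  classical
  refine isBundle_of_basis fun x => ?_
  obtain ⟨V, hxV, ι, _, e, T, he, hzero, hind⟩ := h₂.exists_reduced_basis h₃ S.g x
  have hk : ∀ i : {i // i ∉ T}, ∃ k : Sec S.X₁ V, app S.f V k = e i := fun i =>
    exists_app_eq_of_exact hS (hzero i i.2)
  choose k hk using hk
  have happ : ∀ (W : Opens P1) (h : W ≤ V) (a : {i // i ∉ T} → Fun W),
      app S.f W (∑ i, a i • restrict S.X₁ h (k i)) =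
        ∑ i, (if hi : i ∉ T then a ⟨i, hi⟩ else 0) • restrict S.X₂ h (e i) := by
    intro W h a
    rw [← sum_subtype_smul, map_sum]
    exact Finset.sum_congr rfl fun i _ => by rw [map_smul, app_restrict, hk]
  refine ⟨V, hxV, {i // i ∉ T}, inferInstance, k, fun W h => ⟨fun a a' haa' => ?_, fun s => ?_⟩⟩
  · have h1 := congrArg (app S.f W) haa'
    simp only [happ] at h1
    have h2 := (he W h).1 h1
    funext i
    have := congrFun h2 i
    simpa only [dif_pos i.2] using this
  · refine ⟨fun i => he.coord h (app S.f W s) i, app_injective S.f W ?_⟩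
    simp only [happ]
    have h1 := he.sum_coord h (app S.f W s)
    have h2 : app S.g W (app S.f W s) = 0 := by
      rw [← app_comp, S.zero, app_zero]
    have h3 : ∀ i ∈ T, he.coord h (app S.f W s) i = 0 := by
      refine hind W h _ ?_
      rw [← h2]
      conv_rhs => rw [← h1]
      rw [map_sum]
      exact Finset.sum_congr rfl fun i _ => by rw [map_smul, app_restrict]
    conv_rhs => rw [← h1]
    refine Finset.sum_congr rfl fun i _ => ?_
    by_cases hi : i ∈ T
    · rw [h3 i hi, dif_neg (not_not.2 hi)]
    · rw [dif_pos hi]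

/-- The image of a morphism of bundles is a bundle. -/
lemma IsBundle.of_epi_mono {I : Mod} (p : A ⟶ I) (m : I ⟶ B) [Epi p] [Mono m] (hA : IsBundle A)
    (hB : IsBundle B) : IsBundle I := by
  classical
  refine isBundle_of_basis fun x => ?_
  obtain ⟨V, hxV, ι, _, e, T, he, hzero, hind⟩ := hA.exists_reduced_basis hB (p ≫ m) x
  have hp : ∀ i ∉ T, app p V (e i) = 0 := fun i hi => by
    refine app_injective m V ?_
    rw [map_zero, ← app_comp, hzero i hi]
  refine ⟨V, hxV, {i // i ∈ T}, inferInstance, fun i => app p V (e i),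
    IsBasisOn.of_locally (fun W h a ha => ?_) fun W h s y hy => ?_⟩
  · have h1 := congrArg (app m W) ha
    rw [sum_subtype_smul (fun i => i ∈ T) a (fun i => restrict I h (app p V (e i)))] at h1
    have h2 := hind W h (fun i => if hi : i ∈ T then a ⟨i, hi⟩ else 0) (by
      rw [map_zero, map_sum] at h1
      rw [← h1]
      exact Finset.sum_congr rfl fun i _ => by rw [map_smul, app_restrict, app_comp])
    funext i
    have h3 := h2 i i.2
    rw [dif_pos i.2] at h3
    exact h3
  · obtain ⟨W', hW', hyW', t, ht⟩ := exists_local_lift p s hy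
    refine ⟨W', hW', hyW', fun i => he.coord (hW'.trans h) t i, ?_⟩
    rw [← ht]
    conv_rhs => rw [← he.sum_coord (hW'.trans h) t]
    refine (sum_subtype_smul (fun i => i ∈ T) (fun i => he.coord (hW'.trans h) t i)
      (fun i => restrict I (hW'.trans h) (app p V (e i)))).trans ?_
    rw [map_sum]
    refine Finset.sum_congr rfl fun i _ => ?_
    rw [map_smul, app_restrict]
    by_cases hi : i ∈ T
    · rw [dif_pos hi]
    · rw [hp i hi, restrict_zero, smul_zero, smul_zero]

end LocallyFree

/-! ### Extensions of bundles -/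

section Extensions

open Filter Topology

variable {A B C E : Mod} {U V W : Opens P1}
  {ι κ : Type*} [Fintype ι] [Fintype κ]

lemma Mod.hom_ext {f g : A ⟶ B} (h : ∀ U s, app f U s = app g U s) : f = g := by
  apply SheafOfModules.hom_ext
  apply PresheafOfModules.hom_ext
  intro U
  ext s
  exact h U.unop s

lemma exists_finite_inf (V : κ → Opens P1) {x : P1} (hx : x ∈ U) (hV : ∀ k, x ∈ V k) :
    ∃ W : Opens P1, x ∈ W ∧ W ≤ U ∧ ∀ k, W ≤ V k :=
  ⟨⟨U ∩ ⋂ k, V k, U.isOpen.inter (isOpen_iInter_of_finite fun k => (V k).isOpen)⟩,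
    ⟨hx, Set.mem_iInter.2 hV⟩, fun _ h => h.1, fun k _ h => Set.mem_iInter.1 h.2 k⟩

lemma exists_local_lift_family (f : A ⟶ B) [Epi f] (s : κ → Sec B U) {x : P1} (hx : x ∈ U) :
    ∃ (V : Opens P1) (hV : V ≤ U), x ∈ V ∧ ∃ t : κ → Sec A V,
      ∀ k, app f V (t k) = restrict B hV (s k) := by
  choose V hV hxV t ht using fun k => exists_local_lift f (s k) hx
  obtain ⟨W, hxW, hWU, hWV⟩ := exists_finite_inf V hx hxV
  refine ⟨W, hWU, hxW, fun k => restrict A (hWV k) (t k), fun k => ?_⟩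
  rw [app_restrict, ht, restrict_restrict]

/-- A basis of a subobject and lifts of a basis of the quotient form a basis of an extension. -/
lemma isBasisOn_sum_elim {S : ShortComplex Mod} (hS : S.Exact) [Mono S.f]
    {a : ι → Sec S.X₁ U} (ha : IsBasisOn S.X₁ U a) {c : κ → Sec S.X₂ U}
    (hc : IsBasisOn S.X₃ U fun k => app S.g U (c k)) :
    IsBasisOn S.X₂ U (Sum.elim (fun i => app S.f U (a i)) c) := by
  intro V h
  have hsum : ∀ x : ι ⊕ κ → Fun V,
      ∑ i, x i • restrict S.X₂ h (Sum.elim (fun i => app S.f U (a i)) c i) =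
        app S.f V (∑ i, x (.inl i) • restrict S.X₁ h (a i)) +
          ∑ k, x (.inr k) • restrict S.X₂ h (c k) := by
    intro x
    rw [Fintype.sum_sum_type, map_sum]
    congr 1
    refine Finset.sum_congr rfl fun i _ => ?_
    rw [map_smul, app_restrict]
    rfl
  have hg : ∀ s, app S.g V (app S.f V s) = 0 := fun s => by rw [← app_comp, S.zero, app_zero]
  have hgc : ∀ y : κ → Fun V, app S.g V (∑ k, y k • restrict S.X₂ h (c k)) =
      ∑ k, y k • restrict S.X₃ h (app S.g U (c k)) := by
    intro y
    rw [map_sum]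
    exact Finset.sum_congr rfl fun i _ => by rw [map_smul, app_restrict]
  constructor
  · intro x x' hxx'
    simp only [hsum] at hxx'
    have h1 := congrArg (app S.g V) hxx'
    simp only [map_add, hg, hgc, zero_add] at h1
    have h2 := (hc V h).1 h1
    have h3 : (fun k => x (.inr k)) = fun k => x' (.inr k) := h2
    have h4 : ∀ k, x (.inr k) = x' (.inr k) := congrFun h3
    simp only [h4] at hxx'
    have h5 := congrFun ((ha V h).1 (app_injective S.f V (add_right_cancel hxx')))
    funext i
    rcases i with i | k
    · exact h5 i
    · exact h4 k
  · intro s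
    obtain ⟨y, hy⟩ := (hc V h).2 (app S.g V s)
    have h1 : app S.g V (s - ∑ k, y k • restrict S.X₂ h (c k)) = 0 := by
      rw [map_sub, hgc, sub_eq_zero]
      exact hy.symm
    obtain ⟨t, ht⟩ := exists_app_eq_of_exact hS h1
    refine ⟨Sum.elim (ha.coord h t) y, ?_⟩
    simp only [hsum, Sum.elim_inl, Sum.elim_inr, ha.sum_coord, ht, sub_add_cancel]

/-- Near every point, an extension of bundles has a basis adapted to the extension. -/
lemma exists_adapted_basis {S : ShortComplex Mod} (hS : S.ShortExact) {r s : ℕ}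
    (h₁ : IsBundleOfRank S.X₁ r) (h₃ : IsBundleOfRank S.X₃ s) (x : P1) :
    ∃ (U : Opens P1) (_ : x ∈ U) (a : Fin r → Sec S.X₁ U) (c : Fin s → Sec S.X₂ U),
      IsBasisOn S.X₁ U a ∧ IsBasisOn S.X₃ U (fun k => app S.g U (c k)) := by
  have := hS.epi_g
  obtain ⟨U₁, hx₁, a, ha⟩ := h₁.exists_basis x
  obtain ⟨U₃, hx₃, c, hc⟩ := h₃.exists_basis x
  obtain ⟨V, hV, hxV, t, ht⟩ := exists_local_lift_family S.g c hx₃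
  refine ⟨U₁ ⊓ V, ⟨hx₁, hxV⟩, fun i => restrict _ inf_le_left (a i),
    fun k => restrict _ inf_le_right (t k), ha.restrict _, ?_⟩
  have h := hc.restrict (inf_le_right.trans hV : U₁ ⊓ V ≤ U₃)
  convert h using 2 with k
  rw [app_restrict, ht, restrict_restrict]

lemma IsBundleOfRank.of_shortExact {S : ShortComplex Mod} (hS : S.ShortExact) {r s : ℕ}
    (h₁ : IsBundleOfRank S.X₁ r) (h₃ : IsBundleOfRank S.X₃ s) : IsBundleOfRank S.X₂ (r + s) := by
  have := hS.mono_f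
  refine isBundleOfRank_of_basis fun x => ?_
  obtain ⟨U, hxU, a, c, ha, hc⟩ := exists_adapted_basis hS h₁ h₃ x
  exact ⟨U, hxU, _, _, _, isBasisOn_sum_elim hS.exact ha hc, by simp⟩

lemma isBundleOfRank_zero_iff : IsBundleOfRank E 0 ↔ IsZero E := by
  constructor
  · intro h
    rw [IsZero.iff_id_eq_zero]
    refine Mod.hom_ext fun U s => ?_
    rw [app_id, app_zero]
    refine eq_of_locally_eq fun x hx => ?_
    obtain ⟨V, hxV, e, he⟩ := h.exists_basis x
    refine ⟨U ⊓ V, inf_le_left, ⟨hx, hxV⟩, ?_⟩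
    rw [← he.sum_coord inf_le_right (restrict E inf_le_left s)]
    simp
  · intro h
    have h0 : ∀ U (s : Sec E U), s = 0 := fun U s => by
      rw [← app_id s, (IsZero.iff_id_eq_zero E).1 h, app_zero]
    refine isBundleOfRank_of_basis fun x => ⟨⊤, trivial, Fin 0, inferInstance, Fin.elim0,
      fun V _ => ⟨fun _ _ _ => Subsingleton.elim _ _, fun s => ⟨Fin.elim0, ?_⟩⟩, by simp⟩
    rw [h0 V s]
    simp

/-- Sections whose matrix in a basis is invertible at a point form a basis near that point. -/
lemma exists_isBasisOn_of_det_ne_zero [DecidableEq ι] {e : ι → Sec E U} (he : IsBasisOn E U e)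
    (s : ι → Sec E U) {x : P1} (hx : x ∈ U)
    (hdet : (Matrix.of fun i j => (he.coord le_rfl (s i) j).ext0 x).det ≠ 0) :
    ∃ (V : Opens P1) (hV : V ≤ U), x ∈ V ∧ IsBasisOn E V fun i => restrict E hV (s i) := by
  let N : ι → ι → P1 → ℂ := fun i j => (he.coord le_rfl (s i) j).ext0
  have hN : ∀ i j, ∀ y ∈ U, HolAt (N i j) y := fun i j y hy => Fun.holAt_ext0 _ hy
  have hdet' : HolAt (fun y => (Matrix.of fun i j => N i j y).det) x :=
    HolAt.det fun i j => hN i j x hx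
  have e1 := (hdet'.continuousAt.eventually_ne hdet).and (U.isOpen.mem_nhds hx)
  obtain ⟨V, hV, hVo, hxV⟩ := eventually_nhds_iff.1 e1
  have hVU : (⟨V, hVo⟩ : Opens P1) ≤ U := fun y hy => (hV y hy).2
  have hP : ∀ i j, ∀ y ∈ (⟨V, hVo⟩ : Opens P1),
      HolAt (fun y => (Matrix.of fun i j => N i j y)⁻¹ i j) y := by
    intro i j y hy
    simp only [Matrix.inv_def, Ring.inverse_eq_inv', Matrix.smul_apply, smul_eq_mul,
      Matrix.adjugate_apply]
    refine HolAt.mul (HolAt.inv (HolAt.det fun i j => hN i j y (hVU hy)) (hV y hy).1) ?_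
    have h2 : ∀ k l, HolAt (fun z => (Matrix.of fun i j => N i j z).updateRow j (Pi.single i 1) k l)
        y := by
      intro k l
      by_cases hk : k = j
      · simp only [Matrix.updateRow_apply, hk, if_true]
        exact HolAt.const _
      · simp only [Matrix.updateRow_apply, hk, if_false]
        exact hN k l y (hVU hy)
    exact HolAt.det h2
  refine ⟨⟨V, hVo⟩, hVU, hxV, fun W hW => ?_⟩
  let N' : Matrix ι ι (Fun W) := Matrix.of fun i j =>
      Fun.res (hW.trans hVU) (he.coord le_rfl (s i) j)
  let P' : Matrix ι ι (Fun W) := Matrix.of fun i j => Fun.res hW (Fun.ofHol _ (hP i j))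
  have hNP : N' * P' = 1 ∧ P' * N' = 1 := by
    constructor
    all_goals
      ext i j
      refine Fun.ext fun y hy => ?_
      rw [Matrix.mul_apply, Fun.ext0_sum _ _ hy, Matrix.one_apply]
      simp only [N', P', Matrix.of_apply, Fun.ext0_mul _ _ hy, Fun.ext0_res _ _ hy,
        Fun.ext0_ofHol _ (hW hy)]
      have hu : IsUnit (Matrix.of fun i j => N i j y).det := isUnit_iff_ne_zero.2 (hV y (hW hy)).1
    · have := congrFun (congrFun (Matrix.mul_nonsing_inv _ hu) i) j
      rw [Matrix.mul_apply, Matrix.one_apply] at this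
      refine this.trans ?_
      split_ifs
      · exact (Fun.ext0_one hy).symm
      · exact (Fun.ext0_zero y).symm
    · have := congrFun (congrFun (Matrix.nonsing_inv_mul _ hu) i) j
      rw [Matrix.mul_apply, Matrix.one_apply] at this
      refine this.trans ?_
      split_ifs
      · exact (Fun.ext0_one hy).symm
      · exact (Fun.ext0_zero y).symm
  have h1 : (fun a : ι → Fun W => ∑ i, a i • restrict E hW (restrict E hVU (s i))) =
      (fun a : ι → Fun W => ∑ i, a i • restrict E (hW.trans hVU) (e i)) ∘
        fun a => Matrix.vecMul a N' := by
    funext a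
    have h2 : ∀ i, restrict E hW (restrict E hVU (s i)) =
        ∑ j, N' i j • restrict E (hW.trans hVU) (e j) := fun i => by
      conv_lhs => rw [← he.sum_coord le_rfl (s i)]
      simp only [restrict_sum, restrict_smul, restrict_restrict]
      rfl
    simp only [h2, Function.comp_apply, Matrix.vecMul, dotProduct, Finset.smul_sum, Finset.sum_smul,
      smul_smul]
    exact Finset.sum_comm
  rw [h1]
  refine (he W _).comp (Function.bijective_iff_has_inverse.2 ⟨fun a => Matrix.vecMul a P',
    fun a => ?_, fun a => ?_⟩)
  · change Matrix.vecMul (Matrix.vecMul a N') P' = a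
    rw [Matrix.vecMul_vecMul, hNP.1, Matrix.vecMul_one]
  · change Matrix.vecMul (Matrix.vecMul a P') N' = a
    rw [Matrix.vecMul_vecMul, hNP.2, Matrix.vecMul_one]

/-- A constant function on `U`. -/
def Fun.const (U : Opens P1) (c : ℂ) : Fun U := Fun.ofHol (fun _ => c) fun _ _ => HolAt.const c

lemma Fun.ext0_const (c : ℂ) {x : P1} (hx : x ∈ U) : (Fun.const U c).ext0 x = c :=
  Fun.ext0_ofHol _ hx

end Extensions

/-! ### Torsion in the cokernel of a monomorphism of bundles -/

section Torsion

open Filter Topology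

variable {A B C E : Mod} {U V W : Opens P1}
  {ι κ : Type*} [Fintype ι] [Fintype κ]

lemma eventually_mem_opens {x : P1} (hx : x ∈ U) : ∀ᶠ y in 𝓝 x, y ∈ U := U.isOpen.mem_nhds hx

/-- The coordinate at `x` vanishing at `x`, as a function on a neighbourhood of `x` where it has no
other zero. -/
lemma exists_coordAt_fun {x : P1} (hx : x ∈ U) : ∃ (V : Opens P1) (_ : V ≤ U) (_ : x ∈ V)
    (z : Fun V), (∀ y ∈ V, z.ext0 y = coordAt x y) ∧ ∀ y ∈ V, y ≠ x → coordAt x y ≠ 0 := by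
  have e0 := coordAt_ne_zero x
  rw [eventually_nhdsWithin_iff] at e0
  obtain ⟨V, hV, hVo, hxV⟩ := eventually_nhds_iff.1 (((eventually_mem_opens hx).and
    (holAt_coordAt x).eventually).and e0)
  have hz : ∀ y ∈ (⟨V, hVo⟩ : Opens P1), HolAt (coordAt x) y := fun y hy => (hV y hy).1.2
  exact ⟨⟨V, hVo⟩, fun y hy => (hV y hy).1.1, hxV, Fun.ofHol _ hz, fun y hy => Fun.ext0_ofHol hz hy,
    fun y hy => (hV y hy).2⟩

lemma Fun.exists_inv {g : Fun U} (hg : ∀ y ∈ U, g.ext0 y ≠ 0) : ∃ g' : Fun U, g' * g = 1 := by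
  have h : ∀ y ∈ U, HolAt (fun y => (g.ext0 y)⁻¹) y := fun y hy => (g.holAt_ext0 hy).inv (hg y hy)
  refine ⟨Fun.ofHol _ h, Fun.ext fun y hy => ?_⟩
  rw [Fun.ext0_mul _ _ hy, Fun.ext0_ofHol h hy, Fun.ext0_one hy, inv_mul_cancel₀ (hg y hy)]

lemma Fun.exists_nhds_ne_zero (g : Fun U) {x : P1} (hx : x ∈ U) (hg : g.ext0 x ≠ 0) :
    ∃ (V : Opens P1) (_ : V ≤ U), x ∈ V ∧ ∀ y ∈ V, g.ext0 y ≠ 0 := by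
  obtain ⟨V, hV, hVo, hxV⟩ := eventually_nhds_iff.1
    (((g.holAt_ext0 hx).continuousAt.eventually_ne hg).and (U.isOpen.mem_nhds hx))
  exact ⟨⟨V, hVo⟩, fun y hy => (hV y hy).2, hxV, fun y hy => (hV y hy).1⟩

/-- Division by the coordinate at `x` of a family of functions that vanish at `x`. -/
lemma exists_eq_mul_coordAt_family (g : κ → Fun U) {x : P1} (hx : x ∈ U)
    (hg : ∀ k, (g k).ext0 x = 0) :
    ∃ (V : Opens P1) (_ : V ≤ U), x ∈ V ∧ ∃ q : κ → Fun V, ∀ k, ∀ y ∈ V,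
      (g k).ext0 y = coordAt x y * (q k).ext0 y := by
  choose q hq hq' using fun k => exists_eq_mul_coordAt ((g k).holAt_ext0 hx) (hg k)
  obtain ⟨V, hV, hVo, hxV⟩ := eventually_nhds_iff.1 ((eventually_mem_opens hx).and
    ((eventually_all.2 hq').and (eventually_all.2 fun k => (hq k).eventually)))
  refine ⟨⟨V, hVo⟩, fun y hy => (hV y hy).1, hxV, fun k => Fun.ofHol (q k) fun y hy =>
    (hV y hy).2.2 k, fun k y hy => ?_⟩
  rw [Fun.ext0_ofHol _ hy, (hV y hy).2.1 k, mul_comm]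

/-- If the values at `x` of a basis of the subsheaf are linearly independent in the fibre of the
bundle, then the quotient has a basis near `x`. A linear relation between these values yields a
section of the subsheaf that vanishes at `x` as a section of the bundle, hence the coordinate times
a section of the bundle, whose image in the quotient is torsion. -/
lemma exists_basis_or_torsion {S : ShortComplex Mod} (hS : S.ShortExact) {x : P1} (hx : x ∈ U)
    {ι : Type} [Fintype ι] {a : ι → Sec S.X₁ U} (ha : IsBasisOn S.X₁ U a)
    {κ : Type} [Fintype κ] {b : κ → Sec S.X₂ U} (hb : IsBasisOn S.X₂ U b) :
    (∃ (V : Opens P1) (_ : x ∈ V) (μ : Type) (_ : Fintype μ) (c : μ → Sec S.X₃ V),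
      IsBasisOn S.X₃ V c) ∨
    ∃ (V : Opens P1) (_ : x ∈ V) (z : Fun V) (t : Sec S.X₃ V),
      (∀ y ∈ V, z.ext0 y = coordAt x y) ∧ (∀ y ∈ V, y ≠ x → coordAt x y ≠ 0) ∧ z • t = 0 ∧
      ∀ (W : Opens P1) (h : W ≤ V), x ∈ W → restrict S.X₃ h t ≠ 0 := by
  classical
  have := hS.mono_f
  have := hS.epi_g
  have hgf : ∀ (W : Opens P1) s, app S.g W (app S.f W s) = 0 := fun W s => by
    rw [← app_comp, S.zero, app_zero]
  let v : ι → κ → ℂ := fun i k => (hb.coord le_rfl (app S.f U (a i)) k).ext0 x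
  by_cases hv : LinearIndependent ℂ v
  · left
    -- The values at `x` of the sections of the subsheaf are completed to a basis by constants.
    let d := Module.Basis.sumExtend hv
    let J := Module.Basis.sumExtendIndex hv
    have hfin : Finite (ι ⊕ J) := Module.Finite.finite_basis d
    have hfinJ : Finite J := Finite.of_injective (Sum.inr : J → ι ⊕ J) Sum.inr_injective
    have := Fintype.ofFinite J
    let σ : κ ≃ ι ⊕ J := (Pi.basisFun ℂ κ).indexEquiv d
    let c : J → Sec S.X₂ U := fun j => ∑ k, Fun.const U (d (.inr j) k) • restrict S.X₂ le_rfl (b k)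
    let s : ι ⊕ J → Sec S.X₂ U := Sum.elim (fun i => app S.f U (a i)) c
    have hval : ∀ i k, (hb.coord le_rfl (s i) k).ext0 x = d i k := by
      rintro (i | j) k
      · have : d (.inl i) = v i := by
          simp only [d, Module.Basis.sumExtend, Module.Basis.reindex_apply,
            Module.Basis.extend_apply_self]
          rfl
        rw [this]
        rfl
      · have : hb.coord le_rfl (s (.inr j)) k = Fun.const U (d (.inr j) k) :=
          congrFun (hb.coord_unique (a := fun k => Fun.const U (d (.inr j) k)) le_rfl rfl) k
        rw [this, Fun.ext0_const _ hx]
    have hdet : (Matrix.of fun i j => (hb.coord le_rfl ((s ∘ σ) i) j).ext0 x).det ≠ 0 := by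
      have h1 : LinearIndependent ℂ (fun k => d (σ k)) := d.linearIndependent.comp σ σ.injective
      have h2 : (Matrix.of fun i j => (hb.coord le_rfl ((s ∘ σ) i) j).ext0 x) =
          Matrix.of fun k => d (σ k) := by
        ext i j
        exact hval (σ i) j
      rw [h2]
      exact (Matrix.isUnit_iff_isUnit_det _).1 (Matrix.linearIndependent_rows_iff_isUnit.1 h1)
        |>.ne_zero
    obtain ⟨V, hV, hxV, hs⟩ := exists_isBasisOn_of_det_ne_zero hb (s ∘ σ) hx hdet
    have hs' : IsBasisOn S.X₂ V fun i => restrict S.X₂ hV (s i) := by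
      convert hs.comp_equiv σ.symm using 1
      funext i
      simp
    have hsum : ∀ (W : Opens P1) (h : W ≤ V) (y : ι ⊕ J → Fun W),
        app S.g W (∑ i, y i • restrict S.X₂ h (restrict S.X₂ hV (s i))) =
          ∑ j, y (.inr j) • restrict S.X₃ h (restrict S.X₃ hV (app S.g U (c j))) := by
      intro W h y
      rw [map_sum, Fintype.sum_sum_type]
      rw [Finset.sum_eq_zero, zero_add]
      · refine Finset.sum_congr rfl fun j _ => ?_
        rw [map_smul, app_restrict, app_restrict]
        rfl
      · intro i _
        rw [map_smul, app_restrict, app_restrict]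
        change _ • restrict _ _ (restrict _ _ (app S.g U (app S.f U (a i)))) = _
        rw [hgf, restrict_zero, restrict_zero, smul_zero]
    refine ⟨V, hxV, J, inferInstance, fun j => restrict S.X₃ hV (app S.g U (c j)),
      IsBasisOn.of_locally (fun W h y hy => ?_) fun W h t y hy => ?_⟩
    · have h1 := hsum W h (Sum.elim 0 y)
      simp only [Sum.elim_inr] at h1
      rw [hy] at h1
      obtain ⟨t, ht⟩ := exists_app_eq_of_exact hS.exact h1
      rw [← ha.sum_coord (h.trans hV) t, map_sum] at ht
      have h2 : ∑ i, (Sum.elim (ha.coord (h.trans hV) t) 0 : ι ⊕ J → Fun W) i •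
          restrict S.X₂ h (restrict S.X₂ hV (s i)) = app S.f W
            (∑ i, ha.coord (h.trans hV) t i • restrict S.X₁ (h.trans hV) (a i)) := by
        rw [Fintype.sum_sum_type, map_sum]
        simp only [Sum.elim_inl, Sum.elim_inr, Pi.zero_apply, zero_smul, Finset.sum_const_zero,
          add_zero]
        refine Finset.sum_congr rfl fun i _ => ?_
        rw [map_smul, app_restrict, restrict_restrict]
        rfl
      rw [map_sum, ht] at h2
      have h3 := (hs' W h).1 h2
      funext j
      exact (congrFun h3 (.inr j)).symm
    · obtain ⟨W', hW', hyW', u, hu⟩ := exists_local_lift S.g t hy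
      refine ⟨W', hW', hyW', fun j => hs'.coord (hW'.trans h) u (.inr j), ?_⟩
      rw [← hsum, hs'.sum_coord, hu]
  · right
    -- A section of the subsheaf that vanishes at `x` only as a section of the bundle.
    obtain ⟨l, hl, i₀, hi₀⟩ := Fintype.not_linearIndependent_iff.1 hv
    let s : Sec S.X₁ U := ∑ i, Fun.const U (l i) • restrict S.X₁ le_rfl (a i)
    have hs0 : ∀ k, (hb.coord le_rfl (app S.f U s) k).ext0 x = 0 := by
      intro k
      have h1 : app S.f U s = ∑ i, Fun.const U (l i) • app S.f U (a i) := by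
        simp only [s, map_sum, map_smul, restrict_self]
      rw [h1, hb.coord_sum, Fun.ext0_sum _ _ hx]
      simp only [Fun.ext0_mul _ _ hx, Fun.ext0_const _ hx]
      have := congrFun hl k
      simpa [v] using this
    obtain ⟨V₁, hV₁, hxV₁, q, hq⟩ := exists_eq_mul_coordAt_family _ hx hs0
    obtain ⟨V, hV, hxV, z, hz, hne⟩ := exists_coordAt_fun hxV₁
    let u : Sec S.X₂ V := ∑ k, Fun.res hV (q k) • restrict S.X₂ (hV.trans hV₁) (b k)
    have hzu : z • u = restrict S.X₂ (hV.trans hV₁) (app S.f U s) := by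
      conv_rhs => rw [← hb.sum_coord le_rfl (app S.f U s)]
      simp only [u, Finset.smul_sum, restrict_sum, restrict_smul, restrict_restrict, smul_smul]
      refine Finset.sum_congr rfl fun k _ => ?_
      congr 1
      refine Fun.ext fun y hy => ?_
      rw [Fun.ext0_mul _ _ hy, Fun.ext0_res _ _ hy, Fun.ext0_res _ _ hy, hz y hy, hq k y (hV hy)]
    refine ⟨V, hxV, z, app S.g V u, hz, hne, ?_, fun W h hxW h0 => hi₀ ?_⟩
    · rw [← map_smul, hzu, app_restrict, hgf, restrict_zero]
    · rw [← app_restrict] at h0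
      obtain ⟨t, ht⟩ := exists_app_eq_of_exact hS.exact h0
      have h1 : restrict S.X₁ (h.trans (hV.trans hV₁)) s = Fun.res h z • t := by
        refine app_injective S.f W ?_
        rw [map_smul, ht, ← restrict_smul, hzu, restrict_restrict, app_restrict]
      have h2 := ha.coord_restrict le_rfl (h.trans (hV.trans hV₁)) s i₀
      have h3 : ha.coord le_rfl s i₀ = Fun.const U (l i₀) :=
        congrFun (ha.coord_unique (a := fun i => Fun.const U (l i)) le_rfl rfl) i₀
      have h4 := ha.coord_sum {()} (h.trans (hV.trans hV₁)) (fun _ => Fun.res h z) (fun _ => t) i₀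
      rw [Finset.sum_singleton, Finset.sum_singleton] at h4
      have h5 := congrArg (fun g => Fun.ext0 g x) ((h1 ▸ h2).symm.trans h4)
      simpa only [h3, Fun.ext0_res _ _ hxW, Fun.ext0_const _ hx, Fun.ext0_mul _ _ hxW, hz x hxV,
        coordAt_self, zero_mul] using h5

end Torsion

section Unit

open Filter Topology

variable {A B C E : Mod} {U V W : Opens P1}

/-- The structure sheaf, as a sheaf of modules over itself. -/
abbrev unit : Mod := SheafOfModules.unit structureSheaf

/-- A holomorphic function, as a section of the structure sheaf. -/
def asSec (g : Fun U) : Sec unit U := g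

lemma exists_asSec_eq (s : Sec unit U) : ∃ g : Fun U, asSec g = s := ⟨s, rfl⟩

lemma restrict_asSec (h : V ≤ U) (g : Fun U) :
    restrict unit h (asSec g) = asSec (Fun.res h g) := rfl

lemma smul_asSec (g g' : Fun U) : g • asSec g' = asSec (g * g') := rfl

/-- The morphism from the structure sheaf defined by a global section. -/
def homOfSection (t : Sec E ⊤) : unit ⟶ E :=
  E.unitHomEquiv.symm (PresheafOfModules.sectionsMk (fun U => restrict E (le_top : U.unop ≤ ⊤) t)
    fun _ _ f => restrict_restrict le_top (leOfHom f.unop) t)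

lemma app_homOfSection (t : Sec E ⊤) (g : Fun U) :
    app (homOfSection t) U (asSec g) = g • restrict E le_top t := by
  have h1 : app (homOfSection t) U (asSec 1) = restrict E le_top t :=
    congrFun (congrArg Subtype.val (E.unitHomEquiv.apply_symm_apply
      (PresheafOfModules.sectionsMk (fun U => restrict E (le_top : U.unop ≤ ⊤) t)
        fun _ _ f => restrict_restrict le_top (leOfHom f.unop) t))) (op U)
  rw [← h1, ← map_smul, smul_asSec, mul_one]

lemma exists_app_kernel {f : A ⟶ B} {s : Sec A U} (hs : app f U s = 0) :
    ∃ t, app (kernel.ι f) U t = s :=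
  exists_app_eq_of_exact (S := ShortComplex.mk (kernel.ι f) f (kernel.condition f))
    (ShortComplex.exact_kernel f) hs

/-- The open complement of a point. -/
def complPt (x : P1) : Opens P1 := ⟨{x}ᶜ, isOpen_compl_singleton⟩

/-- `J`, embedded into the structure sheaf by `j`, is the ideal sheaf of the point `x`. -/
def IsIdealOfPoint {J : Mod} (j : J ⟶ unit) (x : P1) : Prop :=
  (∃ k : Unit → Sec J (complPt x), IsBasisOn J (complPt x) k ∧
    ∀ i, app j _ (k i) = asSec 1) ∧
  ∃ (V : Opens P1) (_ : x ∈ V) (z : Fun V) (k : Unit → Sec J V), IsBasisOn J V k ∧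
    (∀ i, app j _ (k i) = asSec z) ∧ ∀ y ∈ V, z.ext0 y = coordAt x y

set_option maxHeartbeats 1000000 in
/-- A torsion section near a point extends by zero to a global section, which is annihilated by
exactly the functions that vanish at the point. -/
lemma exists_hom_of_torsion {x : P1} (hx : x ∈ V) {z : Fun V} {t : Sec C V}
    (hz : ∀ y ∈ V, z.ext0 y = coordAt x y) (hne : ∀ y ∈ V, y ≠ x → coordAt x y ≠ 0)
    (hzt : z • t = 0) (ht : ∀ (W : Opens P1) (h : W ≤ V), x ∈ W → restrict C h t ≠ 0) :
    ∃ τ : unit ⟶ C, IsIdealOfPoint (kernel.ι τ) x := by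
  have hoff : ∀ (W : Opens P1) (h : W ≤ V), x ∉ W → restrict C h t = 0 := by
    intro W h hxW
    obtain ⟨g', hg'⟩ := Fun.exists_inv
          (g := Fun.res h z) fun y hy => by
      rw [Fun.ext0_res _ _ hy, hz y (h hy)]
      exact hne y (h hy) fun hyx => hxW (hyx ▸ hy)
    rw [← one_smul (Fun W) (restrict C h t), ← hg', mul_smul, ← restrict_smul, hzt, restrict_zero,
      smul_zero]
  obtain ⟨T, hT⟩ := exists_glue (E := C) (U := ⊤) (ι := Bool) (fun b => bif b then V else complPt x)
    (fun b => match b with | true => t | false => 0) (by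
      rintro (_ | _) (_ | _)
      · rfl
      · refine (restrict_zero _).trans (hoff (complPt x ⊓ V) inf_le_right fun h => h.1 rfl).symm
      · refine (hoff (V ⊓ complPt x) inf_le_left fun h => h.2 rfl).trans (restrict_zero _).symm
      · rfl) (by
      intro y _
      rw [Opens.mem_iSup]
      by_cases hy : y = x
      · exact ⟨true, hy ▸ hx⟩
      · exact ⟨false, hy⟩) fun _ => le_top
  have hTV : restrict C le_top T = t := hT true
  have hT0 : restrict C le_top T = (0 : Sec C (complPt x)) := hT false
  have hTW : ∀ (W : Opens P1) (h : W ≤ V), restrict C (le_top : W ≤ ⊤) T = restrict C h t := by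
    intro W h
    rw [← hTV, restrict_restrict]
  obtain ⟨τ, hτ⟩ : ∃ τ : unit ⟶ C, ∀ (W : Opens P1) (g : Fun W),
      app τ W (asSec g) = g • restrict C le_top T :=
    ⟨homOfSection T, fun W g => app_homOfSection T g⟩
  refine ⟨τ, ?_, V, hx, z, ?_⟩
  · obtain ⟨k, hk⟩ := exists_app_kernel (f := τ) (U := complPt x) (s := asSec 1)
      (by rw [hτ, hT0, smul_zero])
    refine ⟨fun _ => k, fun W h => ?_, fun _ => hk⟩
    have h1 : ∀ a : Unit → Fun W, app (kernel.ι τ) W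
        (∑ i, a i • restrict _ h k) = asSec (a ()) := by
      intro a
      rw [Fintype.sum_unique, map_smul, app_restrict, hk, restrict_asSec, map_one, smul_asSec,
        mul_one]
    constructor
    · intro a a' haa'
      have h2 := congrArg (app (kernel.ι τ) W) haa'
      simp only [h1] at h2
      funext i
      exact h2
    · intro s
      refine ⟨fun _ => app (kernel.ι τ) W s, app_injective (kernel.ι τ) W ?_⟩
      exact h1 _
  · obtain ⟨k, hk⟩ := exists_app_kernel (f := τ) (U := V) (s := asSec z)
      (by rw [hτ, hTV, hzt])
    have h1 : ∀ (W : Opens P1) (h : W ≤ V) (a : Unit → Fun W), app (kernel.ι τ) W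
        (∑ i, a i • restrict _ h k) = asSec (a () * Fun.res h z) := by
      intro W h a
      rw [Fintype.sum_unique, map_smul, app_restrict, hk, restrict_asSec, smul_asSec]
    refine ⟨fun _ => k, IsBasisOn.of_locally (fun W h a ha => ?_) fun W h s y hy => ?_,
      fun _ => hk, hz⟩
    · have h2 := (h1 W h a).symm.trans (congrArg (app (kernel.ι τ) W) ha)
      rw [map_zero] at h2
      have h3 : a () * Fun.res h z = 0 := h2
      have h4 := Fun.eq_zero_of_mul_eq_zero (p := x) (fun y hy hyx => by
        rw [Fun.ext0_res _ _ hy, hz y (h hy)]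
        exact hne y (h hy) hyx) h3
      funext i
      exact h4
    · obtain ⟨g, hg⟩ := exists_asSec_eq (app (kernel.ι τ) W s)
      suffices h5 : ∃ (W' : Opens P1) (hW' : W' ≤ W) (_ : y ∈ W') (q : Fun W'),
          Fun.res hW' g = q * Fun.res (hW'.trans h) z by
        obtain ⟨W', hW', hyW', q, hq⟩ := h5
        refine ⟨W', hW', hyW', fun _ => q, app_injective (kernel.ι τ) W' ?_⟩
        rw [h1, app_restrict, ← hg, restrict_asSec, hq]
      by_cases hyx : y = x
      · subst hyx
        have hgT : g • restrict C (le_top : W ≤ ⊤) T = 0 := by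
          rw [← hτ, hg, ← app_comp, kernel.condition, app_zero]
        have hg0 : g.ext0 y = 0 := by
          by_contra hg0
          obtain ⟨W', hW', hyW', hne'⟩ := g.exists_nhds_ne_zero hy hg0
          obtain ⟨g', hg'⟩ := Fun.exists_inv (g := Fun.res hW' g) fun w hw => by
            rw [Fun.ext0_res _ _ hw]
            exact hne' w hw
          refine ht W' (hW'.trans h) hyW' ?_
          rw [← hTW, ← one_smul (Fun W') (restrict C le_top T), ← hg', mul_smul,
            ← restrict_restrict (le_top : W ≤ ⊤) hW', ← restrict_smul, hgT, restrict_zero,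
            smul_zero]
        obtain ⟨W', hW', hyW', q, hq⟩ := exists_eq_mul_coordAt_family (fun _ : Unit => g) hy
          fun _ => hg0
        refine ⟨W', hW', hyW', q (), Fun.ext fun w hw => ?_⟩
        rw [Fun.ext0_mul _ _ hw, Fun.ext0_res _ _ hw, Fun.ext0_res _ _ hw, hz w (h (hW' hw)),
          hq () w hw, mul_comm]
      · obtain ⟨g', hg'⟩ := Fun.exists_inv
          (g := Fun.res (inf_le_left.trans h : W ⊓ complPt x ≤ V) z)
          fun w hw => by
            rw [Fun.ext0_res _ _ hw, hz w (h hw.1)]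
            exact hne w (h hw.1) hw.2
        exact ⟨W ⊓ complPt x, inf_le_left, ⟨hy, hyx⟩, Fun.res inf_le_left g * g', by
          rw [mul_assoc, hg', mul_one]⟩

/-- The cokernel of a monomorphism of bundles is a bundle, or there is a section of the cokernel
whose annihilator is the ideal sheaf of a point. -/
lemma isBundle_or_exists_torsion {S : ShortComplex Mod} (hS : S.ShortExact) (h₁ : IsBundle S.X₁)
    (h₂ : IsBundle S.X₂) :
    IsBundle S.X₃ ∨ ∃ (τ : unit ⟶ S.X₃) (x : P1), IsIdealOfPoint (kernel.ι τ) x := by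
  obtain ⟨r, hr⟩ := h₁
  obtain ⟨s, hs⟩ := h₂
  by_cases H : ∀ x : P1, ∃ U : Opens P1, x ∈ U ∧
    ∃ (ι : Type) (_ : Fintype ι) (e : ι → Sec S.X₃ U), IsBasisOn S.X₃ U e
  · exact Or.inl (isBundle_of_basis H)
  · right
    push Not at H
    obtain ⟨x, hx⟩ := H
    obtain ⟨U, hxU, a, ha⟩ := hr.exists_basis x
    obtain ⟨U', hxU', b, hb⟩ := hs.exists_basis x
    rcases exists_basis_or_torsion hS (U := U ⊓ U') ⟨hxU, hxU'⟩ (ha.restrict inf_le_left)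
      (hb.restrict inf_le_right) with ⟨V, hxV, μ, _, c, hc⟩ | ⟨V, hxV, z, t, hz, hne, hzt, ht⟩
    · exact absurd hc (hx V hxV μ _ c)
    · obtain ⟨τ, hτ⟩ := exists_hom_of_torsion hxV hz hne hzt ht
      exact ⟨τ, x, hτ⟩

end Unit

/-! ### Transition determinants and degrees -/

section Transition

open Filter Topology

variable {A B C E : Mod} {U U' U'' V W : Opens P1} {ι : Type*} [Fintype ι]

namespace IsBasisOn

variable {e : ι → Sec E U} (he : IsBasisOn E U e) {e' : ι → Sec E U'} (he' : IsBasisOn E U' e')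
  {e'' : ι → Sec E U''} (he'' : IsBasisOn E U'' e'')

/-- The coordinates in the basis `e` of the value at a point of a section over `U'`. -/
def val (s : Sec E U') (x : P1) (i : ι) : ℂ :=
  (he.coord (inf_le_left : U ⊓ U' ≤ U) (Twistor.restrict E inf_le_right s) i).ext0 x

lemma val_eq_coord (s : Sec E U') {x : P1} (h : W ≤ U) (h' : W ≤ U') (hx : x ∈ W) (i : ι) :
    he.val s x i = (he.coord h (Twistor.restrict E h' s) i).ext0 x := by
  have h1 := he.coord_restrict (inf_le_left : U ⊓ U' ≤ U) (le_inf h h')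
    (Twistor.restrict E inf_le_right s) i
  rw [restrict_restrict] at h1
  have h2 := congrArg (fun g => Fun.ext0 g x) h1
  simp only [Fun.ext0_res _ _ hx] at h2
  exact h2.symm

lemma val_sum {μ : Type*} (t : Finset μ) (a : μ → Fun W) (s : μ → Sec E W) (h : W ≤ U) {x : P1}
    (hx : x ∈ W) (i : ι) :
    he.val (∑ j ∈ t, a j • s j) x i = ∑ j ∈ t, (a j).ext0 x * he.val (s j) x i := by
  rw [he.val_eq_coord _ h le_rfl hx, restrict_self, he.coord_sum, Fun.ext0_sum _ _ hx]
  refine Finset.sum_congr rfl fun j _ => ?_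
  rw [Fun.ext0_mul _ _ hx, he.val_eq_coord _ h le_rfl hx, restrict_self]

lemma val_restrict (s : Sec E U') {x : P1} (h : W ≤ U') (hx : x ∈ W) (hxU : x ∈ U) (i : ι) :
    he.val (Twistor.restrict E h s) x i = he.val s x i := by
  rw [he.val_eq_coord (W := U ⊓ W) _ inf_le_left inf_le_right ⟨hxU, hx⟩,
    he.val_eq_coord (W := U ⊓ W) _ inf_le_left (inf_le_right.trans h) ⟨hxU, hx⟩, restrict_restrict]

lemma val_change {κ : Type*} [Fintype κ] {e' : κ → Sec E U'} (he' : IsBasisOn E U' e')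
    (s : Sec E U'') {x : P1} (hx : x ∈ U) (hx' : x ∈ U') (hx'' : x ∈ U'') (i : ι) :
    he.val s x i = ∑ j, he.val (e' j) x i * he'.val s x j := by
  have hW : x ∈ U ⊓ (U' ⊓ U'') := ⟨hx, hx', hx''⟩
  have h1 : U ⊓ (U' ⊓ U'') ≤ U' := inf_le_right.trans inf_le_left
  have h2 : U ⊓ (U' ⊓ U'') ≤ U'' := inf_le_right.trans inf_le_right
  rw [← he.val_restrict s h2 hW hx, ← he'.sum_coord h1 (Twistor.restrict E h2 s),
    he.val_sum _ _ _ inf_le_left hW]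
  refine Finset.sum_congr rfl fun j _ => ?_
  rw [he.val_restrict _ h1 hW hx, he'.val_eq_coord s h1 h2 hW, mul_comm]

lemma val_self [DecidableEq ι] {x : P1} (hx : x ∈ U) (i j : ι) :
    he.val (e j) x i = if i = j then 1 else 0 := by
  rw [he.val_eq_coord (e j) le_rfl le_rfl hx]
  have h1 : he.coord le_rfl (Twistor.restrict E le_rfl (e j)) i = if i = j then 1 else 0 := by
    refine congrFun (he.coord_unique (a := fun i => if i = j then 1 else 0) le_rfl ?_) i
    simp
  rw [h1]
  split_ifs
  · exact Fun.ext0_one hx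
  · exact Fun.ext0_zero x

lemma holAt_val (s : Sec E U') {x : P1} (hx : x ∈ U) (hx' : x ∈ U') (i : ι) :
    HolAt (fun y => he.val s y i) x :=
  Fun.holAt_ext0 _ (show x ∈ U ⊓ U' from ⟨hx, hx'⟩)

variable [DecidableEq ι]

/-- The determinant of the matrix that expresses the sections `e'` in terms of the basis `e`. -/
def transDet (e' : ι → Sec E U') (x : P1) : ℂ := (Matrix.of fun i j => he.val (e' j) x i).det

lemma transDet_self {x : P1} (hx : x ∈ U) : he.transDet e x = 1 := by
  have : (Matrix.of fun i j => he.val (e j) x i) = 1 := by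
    ext i j
    rw [Matrix.of_apply, he.val_self hx, Matrix.one_apply]
  rw [transDet, this, Matrix.det_one]

include he' in
lemma transDet_mul (s : ι → Sec E U'') {x : P1} (hx : x ∈ U) (hx' : x ∈ U') (hx'' : x ∈ U'') :
    he.transDet e' x * he'.transDet s x = he.transDet s x := by
  rw [transDet, transDet, transDet, ← Matrix.det_mul]
  congr 1
  ext i j
  exact (he.val_change he' (s j) hx hx' hx'' i).symm

include he' in
lemma transDet_ne_zero {x : P1} (hx : x ∈ U) (hx' : x ∈ U') : he.transDet e' x ≠ 0 := by
  have h := he.transDet_mul he' e hx hx' hx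
  rw [he.transDet_self hx] at h
  exact left_ne_zero_of_mul_eq_one h

lemma holAt_transDet (s : ι → Sec E U') {x : P1} (hx : x ∈ U) (hx' : x ∈ U') :
    HolAt (he.transDet s) x :=
  HolAt.det (M := fun i j y => he.val (s j) y i) fun i j => he.holAt_val (s j) hx hx' i

include he' in
lemma hasOrderAt_transDet {x : P1} (hx : x ∈ U) (hx' : x ∈ U') : HasOrderAt (he.transDet e') x 0 :=
  (he.holAt_transDet e' hx hx').hasOrderAt_zero (he.transDet_ne_zero he' hx hx')

lemma val_comp_equiv {κ : Type*} [Fintype κ] (σ : κ ≃ ι) (s : Sec E U') {x : P1}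
    (hx : x ∈ U) (hx' : x ∈ U') (k : κ) :
    (he.comp_equiv σ).val s x k = he.val s x (σ k) := by
  rw [he.val_change (he.comp_equiv σ) s hx hx hx', Finset.sum_eq_single k]
  · rw [Function.comp_apply, he.val_self hx, if_pos rfl, one_mul]
  · intro j _ hj
    rw [Function.comp_apply, he.val_self hx, if_neg (fun h => hj (σ.injective h.symm)), zero_mul]
  · simp

lemma transDet_comp_equiv {κ : Type*} [Fintype κ] [DecidableEq κ] (σ : κ ≃ ι) (s : ι → Sec E U')
    {x : P1} (hx : x ∈ U) (hx' : x ∈ U') :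
    (he.comp_equiv σ).transDet (s ∘ σ) x = he.transDet s x := by
  rw [transDet, transDet, ← Matrix.det_submatrix_equiv_self σ]
  congr 1
  ext i j
  exact he.val_comp_equiv σ (s (σ j)) hx hx' i

end IsBasisOn

lemma MeromorphicDetSection.coeff_eq_transDet_mul {r : ℕ} (σ : MeromorphicDetSection E r)
    {e : Fin r → Sec E U} (he : IsBasisOn E U e) {e' : Fin r → Sec E U'} (he' : IsBasisOn E U' e')
    {x : P1} (hx : x ∈ U) (hx' : x ∈ U') :
    σ.coeff U e x = he.transDet e' x * σ.coeff U' e' x := by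
  refine (σ.coeff_eq U U' e e' (isFrame_iff.2 he) (isFrame_iff.2 he')
    (Matrix.of fun i j => he.coord inf_le_left (restrict E inf_le_right (e' j)) i)
    (fun j => (he.sum_coord inf_le_left _).symm) x ⟨hx, hx'⟩).trans ?_
  congr 2
  ext i j
  exact (Fun.ext0_of_mem _ _).symm

/-- A meromorphic section of the determinant may be given by its coefficients in a family of local
bases that cover the projective line. -/
lemma hasDegree_of_local {r : ℕ} [DecidableEq ι] (hr : Fintype.card ι = r) {U : P1 → Opens P1}
    (hU : ∀ x, x ∈ U x) {e : ∀ x, ι → Sec E (U x)} (he : ∀ x, IsBasisOn E (U x) (e x))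
    {c : P1 → P1 → ℂ} (D : P1 →₀ ℤ) (hD : ∀ x, HasOrderAt (c x) x (D x))
    (hc : ∀ x y z, z ∈ U x → z ∈ U y → c x z = (he x).transDet (e y) z * c y z) :
    HasDegree E r (D.sum fun _ n => n) := by
  classical
  let σ : Fin r ≃ ι := (Fintype.equivFinOfCardEq hr).symm
  have hf : ∀ x, IsBasisOn E (U x) (e x ∘ σ) := fun x => (he x).comp_equiv σ
  let f : ∀ x, Fin r → Sec E (U x) := fun x => e x ∘ σ
  have hcf : ∀ x y z, z ∈ U x → z ∈ U y → c x z = (hf x).transDet (f y) z * c y z := by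
    intro x y z hx hy
    rw [(he x).transDet_comp_equiv σ (e y) hx hy]
    exact hc x y z hx hy
  have key : ∀ (V : Opens P1) (b : Fin r → Sec E V) (hb : IsBasisOn E V b) (y z : P1), z ∈ V →
      z ∈ U y → hb.transDet (f z) z * c z z = hb.transDet (f y) z * c y z := by
    intro V b hb y z hzV hzy
    rw [hcf z y z (hU z) hzy, ← mul_assoc, hb.transDet_mul (hf z) (f y) hzV (hU z) hzy]
  refine ⟨{ coeff := fun V b z => if hb : IsBasisOn E V b then hb.transDet (f z) z * c z z else 0
            divisor := D
            hasOrderAt := ?_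
            coeff_eq := ?_ }, rfl⟩
  · intro V b hb x hx
    have hb' := isFrame_iff.1 hb
    have h1 := (hb'.hasOrderAt_transDet (hf x) hx (hU x)).mul (hD x)
    rw [zero_add] at h1
    refine h1.congr (nhdsWithin_le_nhds ?_)
    filter_upwards [V.isOpen.mem_nhds hx, (U x).isOpen.mem_nhds (hU x)] with z hz hz'
    rw [dif_pos hb', key V b hb' x z hz hz']
  · intro V V' b b' hb hb' g hg x hx
    have hB := isFrame_iff.1 hb
    have hB' := isFrame_iff.1 hb'
    rw [dif_pos hB, dif_pos hB', ← mul_assoc, ← hB.transDet_mul hB' (f x) hx.1 hx.2 (hU x)]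
    congr 2
    rw [IsBasisOn.transDet]
    congr 1
    ext i j
    have h1 := congrFun (hB.coord_unique (a := fun i => g i j) inf_le_left (hg j).symm) i
    rw [Matrix.of_apply, IsBasisOn.val, h1]
    exact Fun.ext0_of_mem _ hx

end Transition

/-! ### Existence of the degree -/

section Existence

open Filter Topology Metric

/-- The affine coordinate `z`, extended by the junk value `0` at infinity. -/
def affCoord (p : P1) : ℂ := (invCoord p)⁻¹

@[simp] lemma affCoord_coe (z : ℂ) : affCoord (z : P1) = z := by simp [affCoord]

@[simp] lemma invCoord_invParam (w : ℂ) : invCoord (invParam w) = w := by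
  rcases eq_or_ne w 0 with rfl | hw
  · simp
  · simp [invParam_of_ne_zero hw]

lemma HasOrderAt.zpow {F : P1 → ℂ} {x : P1} {n : ℤ} (hF : HasOrderAt F x n) (k : ℤ) :
    HasOrderAt (fun y => F y ^ k) x (k * n) := by
  refine ⟨hF.1.zpow k, ?_⟩
  have := meromorphicOrderAt_zpow hF.1 (n := k)
  rw [hF.2] at this
  exact_mod_cast this

lemma holAt_affCoord_sub (a z : ℂ) : HolAt (fun p => affCoord p - a) (z : P1) := by
  rw [holAt_coe]
  simp only [affCoord_coe]
  exact analyticAt_id.sub analyticAt_const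

lemma hasOrderAt_affCoord_sub_self (a : ℂ) : HasOrderAt (fun p => affCoord p - a) (a : P1) 1 := by
  rw [hasOrderAt_coe]
  simp only [affCoord_coe]
  have h : AnalyticAt ℂ (fun u : ℂ => u - a) a := analyticAt_id.sub analyticAt_const
  refine ⟨h.meromorphicAt, ?_⟩
  rw [meromorphicOrderAt_eq_int_iff h.meromorphicAt]
  exact ⟨fun _ => 1, analyticAt_const, one_ne_zero, Eventually.of_forall fun z => by simp⟩

lemma hasOrderAt_affCoord_sub_of_ne {a z : ℂ} (h : z ≠ a) :
    HasOrderAt (fun p => affCoord p - a) (z : P1) 0 :=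
  (holAt_affCoord_sub a z).hasOrderAt_zero (by simpa [sub_eq_zero] using h)

lemma hasOrderAt_affCoord_sub_infty (a : ℂ) :
    HasOrderAt (fun p => affCoord p - a) OnePoint.infty (-1) := by
  have h : HasOrderAt (fun p => invCoord p) OnePoint.infty 1 := by
    rw [hasOrderAt_infty]
    simp only [invCoord_invParam]
    have hid : MeromorphicAt (fun w : ℂ => w) 0 := MeromorphicAt.id 0
    refine ⟨hid, ?_⟩
    rw [meromorphicOrderAt_eq_int_iff hid]
    exact ⟨fun _ => 1, analyticAt_const, one_ne_zero, Eventually.of_forall fun z => by simp⟩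
  have h' : HasOrderAt (fun p => 1 - a * invCoord p) OnePoint.infty 0 := by
    refine HolAt.hasOrderAt_zero ?_ (by simp)
    rw [holAt_infty]
    simp only [invCoord_invParam]
    exact analyticAt_const.sub (analyticAt_const.mul analyticAt_id)
  refine (h.inv.mul h').congr ?_
  have : ∀ᶠ p : P1 in 𝓝[≠] OnePoint.infty, p ≠ OnePoint.infty ∧ p ≠ ((0 : ℂ) : P1) :=
    (eventually_mem_nhdsWithin).and (nhdsWithin_le_nhds
      (isOpen_ne.mem_nhds (OnePoint.infty_ne_coe 0)))
  filter_upwards [this] with p hp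
  induction p using OnePoint.rec with
  | infty => exact absurd rfl hp.1
  | coe z =>
    have hz : z ≠ 0 := fun h => hp.2 (by rw [h])
    simp only [invCoord_coe, affCoord_coe]
    field_simp

variable {E : Mod} {ι : Type*} [Fintype ι] [DecidableEq ι]

/-- The determinant of a bundle in the affine coordinate. -/
def cocycleZ {U : P1 → Opens P1} (hU : ∀ x, x ∈ U x) {e : ∀ x, ι → Sec E (U x)}
    (he : ∀ x, IsBasisOn E (U x) (e x)) : UnitCocycle P1 where
  U x := {z | (z : P1) ∈ U x}
  isOpen_U x := (U x).isOpen.preimage OnePoint.continuous_coe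
  cover z := ⟨z, hU z⟩
  g x y z := (he x).transDet (e y) z
  analyticAt_g x y _ hx hy := holAt_coe.1 ((he x).holAt_transDet (e y) hx hy)
  g_ne_zero x y _ hx hy := (he x).transDet_ne_zero (he y) hx hy
  g_mul x y k _ hx hy hk := (he x).transDet_mul (he y) (e k) hx hy hk

/-- The determinant of a bundle in the coordinate at infinity. -/
def cocycleW {U : P1 → Opens P1} (hU : ∀ x, x ∈ U x) {e : ∀ x, ι → Sec E (U x)}
    (he : ∀ x, IsBasisOn E (U x) (e x)) : UnitCocycle P1 where
  U x := {w | invParam w ∈ U x}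
  isOpen_U x := (U x).isOpen.preimage continuous_invParam
  cover w := ⟨invParam w, hU _⟩
  g x y w := (he x).transDet (e y) (invParam w)
  analyticAt_g x y _ hx hy := holAt_invParam.1 ((he x).holAt_transDet (e y) hx hy)
  g_ne_zero x y _ hx hy := (he x).transDet_ne_zero (he y) hx hy
  g_mul x y k _ hx hy hk := (he x).transDet_mul (he y) (e k) hx hy hk

lemma exists_coe_or_invParam (p : P1) :
    (∃ z : ℂ, ‖z‖ < 2 ∧ p = z) ∨ ∃ w : ℂ, ‖w‖ < 1 ∧ p = invParam w ∧ ∀ z : ℂ, p = z → 2 ≤ ‖z‖ := by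
  induction p using OnePoint.rec with
  | infty => exact Or.inr ⟨0, by simp, by simp, fun z hz => absurd hz (OnePoint.infty_ne_coe z)⟩
  | coe z =>
    rcases lt_or_ge ‖z‖ 2 with h | h
    · exact Or.inl ⟨z, h, rfl⟩
    · have hz : z ≠ 0 := fun h0 => by norm_num [h0] at h
      refine Or.inr ⟨z⁻¹, ?_, (invParam_inv hz).symm, fun z' hz' => ?_⟩
      · rw [norm_inv]
        exact inv_lt_one_of_one_lt₀ (by linarith)
      · rwa [← OnePoint.coe_injective hz']

/-- Every bundle has a degree: on two discs that cover the projective line, the determinant has a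
section without zeros, and on the annulus where they meet the ratio of these sections is a power of
the coordinate, up to invertible functions on the two discs. -/
lemma IsBundleOfRank.exists_hasDegree {r : ℕ} (hE : IsBundleOfRank E r) : ∃ d, HasDegree E r d := by
  classical
  choose U hU e he using hE.exists_basis
  obtain ⟨N, hN, hKN, s, hs⟩ := UnitCocycle.trivialNear_closedBall (c := cocycleZ hU he) zero_le_two
  obtain ⟨N', hN', hKN', t, ht⟩ :=
    UnitCocycle.trivialNear_closedBall (c := cocycleW hU he) zero_le_two
  have hzN : ∀ z : ℂ, ‖z‖ ≤ 2 → z ∈ N := fun z hz => hKN (by simpa using hz)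
  have hwN : ∀ w : ℂ, ‖w‖ ≤ 2 → w ∈ N' := fun w hw => hKN' (by simpa using hw)
  have hinv : ∀ z : ℂ, 2⁻¹ ≤ ‖z‖ → z ≠ 0 ∧ ‖z⁻¹‖ ≤ 2 := by
    intro z hz
    have h0 : 0 < ‖z‖ := lt_of_lt_of_le (by norm_num) hz
    refine ⟨norm_pos_iff.1 h0, ?_⟩
    rw [norm_inv]
    exact inv_le_of_inv_le₀ (by norm_num) hz
  have hW : ∀ {z : ℂ} {y : P1}, z ≠ 0 → (z : P1) ∈ U y → z⁻¹ ∈ (cocycleW hU he).U y := by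
    intro z y h0 hy
    simpa [cocycleW, invParam_inv h0] using hy
  have hratio : ∀ z : ℂ, z ≠ 0 → z ∈ N → z⁻¹ ∈ N' → ∀ y, (z : P1) ∈ U y →
      s z z / t z z⁻¹ = s y z / t y z⁻¹ := by
    intro z h0 h1 h2 y hy
    rw [hs.eq_mul z y z h1 (hU z) hy, ht.eq_mul z y z⁻¹ h2 (hW h0 (hU z)) (hW h0 hy)]
    simp only [cocycleZ, cocycleW, invParam_inv h0]
    rw [mul_div_mul_left _ _ ((he z).transDet_ne_zero (he y) (hU z) hy)]
  obtain ⟨m, a, b, ha, hb, hab⟩ := exists_laurent_mul (r := 2⁻¹) (R := 2)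
    (h := fun z => s z z / t z z⁻¹) (by norm_num) (by norm_num) (by
      intro z h1 h2
      obtain ⟨h0, h3⟩ := hinv z h1
      have hne : t z z⁻¹ ≠ 0 := ht.ne_zero z _ (hwN _ h3) (hW h0 (hU z))
      refine ⟨?_, div_ne_zero (hs.ne_zero z z (hzN z h2) (hU z)) hne⟩
      refine ((hs.analyticAt z z (hzN z h2) (hU z)).div (AnalyticAt.fun_comp
        (ht.analyticAt z z⁻¹ (hwN _ h3) (hW h0 (hU z))) (analyticAt_inv h0)) hne).congr ?_
      filter_upwards [isOpen_ne.mem_nhds h0, hN.mem_nhds (hzN z h2),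
        (continuousAt_inv₀ h0).eventually (hN'.mem_nhds (hwN _ h3)),
        ((U z).isOpen.preimage OnePoint.continuous_coe).mem_nhds (hU z)] with u hu1 hu2 hu3 hu4
      exact (hratio u hu1 hu2 hu3 z hu4).symm)
  let F : P1 → P1 → ℂ := fun y p => s y (affCoord p) * (a (affCoord p))⁻¹ * (affCoord p - 0) ^ (-m)
  let G : P1 → P1 → ℂ := fun y p => t y (invCoord p) * b (invCoord p)
  have hFG : ∀ y (z : ℂ), 2⁻¹ < ‖z‖ → ‖z‖ < 2 → (z : P1) ∈ U y → F y z = G y z := by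
    intro y z h1 h2 hy
    obtain ⟨h0, h3⟩ := hinv z h1.le
    have e1 := hab z h1 h2
    rw [hratio z h0 (hzN z h2.le) (hwN _ h3) y hy,
      div_eq_iff (ht.ne_zero y _ (hwN _ h3) (hW h0 hy))] at e1
    have ha0 := (ha z (by simpa using h2)).2
    have hzm : z ^ m ≠ 0 := zpow_ne_zero _ h0
    simp only [F, G, affCoord_coe, invCoord_coe, sub_zero, zpow_neg]
    rw [e1]
    field_simp
  let P : P1 → Prop := fun p => ∃ z : ℂ, ‖z‖ < 2 ∧ p = z
  let c : P1 → P1 → ℂ := fun y p => if P p then F y p else G y p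
  have hcG : ∀ y (w : ℂ), ‖w‖ < 2 → invParam w ∈ U y → c y (invParam w) = G y (invParam w) := by
    intro y w hw hy
    by_cases hp : P (invParam w)
    · obtain ⟨z, hz, hwz⟩ := hp
      have hw0 : w ≠ 0 := by
        rintro rfl
        rw [invParam_zero] at hwz
        exact OnePoint.infty_ne_coe z hwz
      have hzw : z = w⁻¹ := by
        rw [invParam_of_ne_zero hw0] at hwz
        exact (OnePoint.coe_injective hwz).symm
      simp only [c]
      rw [if_pos ⟨z, hz, hwz⟩, hwz]
      refine hFG y z ?_ hz (hwz ▸ hy)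
      rw [hzw, norm_inv]
      exact (inv_lt_inv₀ (by norm_num) (norm_pos_iff.2 hw0)).2 hw
    · exact if_neg hp
  refine ⟨_, hasDegree_of_local (Fintype.card_fin r) hU he (c := c)
    (Finsupp.single ((0 : ℂ) : P1) (-m)) (fun x => ?_) fun x y p hx hy => ?_⟩
  · rcases exists_coe_or_invParam x with ⟨z, hz, rfl⟩ | ⟨w, hw, rfl, hw'⟩
    · have h1 : HasOrderAt (F z) z (Finsupp.single ((0 : ℂ) : P1) (-m) (z : P1)) := by
        have h2 : HolAt (fun p => s z (affCoord p) * (a (affCoord p))⁻¹) (z : P1) := by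
          rw [holAt_coe]
          simp only [affCoord_coe]
          exact (hs.analyticAt z z (hzN z hz.le) (hU z)).mul
            ((ha z (by simpa using hz)).1.inv (ha z (by simpa using hz)).2)
        have h3 := h2.hasOrderAt_zero (by
          rw [affCoord_coe]
          exact mul_ne_zero (hs.ne_zero z z (hzN z hz.le) (hU z))
            (inv_ne_zero (ha z (by simpa using hz)).2))
        rcases eq_or_ne z 0 with rfl | h0
        · have h4 := h3.mul ((hasOrderAt_affCoord_sub_self 0).zpow (-m))
          rw [zero_add, mul_one] at h4
          rwa [Finsupp.single_eq_same]
        · have h4 := h3.mul ((hasOrderAt_affCoord_sub_of_ne h0).zpow (-m))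
          rw [zero_add, mul_zero] at h4
          rwa [Finsupp.single_eq_of_ne (by simpa using h0)]
      refine h1.congr (nhdsWithin_le_nhds ?_)
      have h5 : ∀ᶠ p in 𝓝 (z : P1), P p := by
        refine mem_of_superset ((OnePoint.isOpenEmbedding_coe.isOpenMap _ isOpen_ball).mem_nhds
          ⟨z, (by simpa using hz : z ∈ ball (0 : ℂ) 2), rfl⟩) ?_
        rintro _ ⟨u, hu, rfl⟩
        exact ⟨u, by simpa using hu, rfl⟩
      filter_upwards [h5] with p hp
      exact (if_pos hp).symm
    · have hwU : w ∈ (cocycleW hU he).U (invParam w) := hU (invParam w)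
      have h1 : HolAt (c (invParam w)) (invParam w) := by
        rw [holAt_invParam]
        refine ((ht.analyticAt _ w (hwN w (by linarith)) hwU).mul (hb w (by
          simp only [inv_inv, mem_ball_zero_iff]; linarith)).1).congr ?_
        filter_upwards [isOpen_ball.mem_nhds (by simpa using hw : w ∈ ball (0 : ℂ) 1),
          ((U (invParam w)).isOpen.preimage continuous_invParam).mem_nhds (hU (invParam w))]
          with u hu hu'
        rw [mem_ball_zero_iff] at hu
        rw [hcG _ u (by linarith) hu']
        simp only [G, invCoord_invParam, Pi.mul_apply]
      have h2 : invParam w ≠ ((0 : ℂ) : P1) := fun h => by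
        have := hw' 0 h
        norm_num at this
      rw [Finsupp.single_eq_of_ne h2]
      refine h1.hasOrderAt_zero ?_
      rw [hcG _ w (by linarith) (hU _)]
      simp only [G, invCoord_invParam]
      exact mul_ne_zero (ht.ne_zero _ w (hwN w (by linarith)) hwU) (hb w (by
          simp only [inv_inv, mem_ball_zero_iff]; linarith)).2
  · rcases exists_coe_or_invParam p with ⟨z, hz, rfl⟩ | ⟨w, hw, rfl, hw'⟩
    · have hp : P z := ⟨z, hz, rfl⟩
      simp only [c, if_pos hp, F, affCoord_coe]
      rw [hs.eq_mul x y z (hzN z hz.le) hx hy]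
      simp only [cocycleZ]
      ring
    · rw [hcG x w (by linarith) hx, hcG y w (by linarith) hy]
      simp only [G, invCoord_invParam]
      rw [ht.eq_mul x y w (hwN w (by linarith)) hx hy]
      simp only [cocycleW]
      ring

end Existence

/-! ### Uniqueness of the degree -/

section Uniqueness

open Filter Topology

lemma exists_holAt_of_hasOrderAt {F : P1 → ℂ} {x : P1} {n : ℤ} (h : HasOrderAt F x n)
    (hn : 0 ≤ n) : ∃ g : P1 → ℂ, HolAt g x ∧ F =ᶠ[𝓝[≠] x] g := by
  obtain ⟨k, rfl⟩ := Int.eq_ofNat_of_zero_le hn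
  obtain ⟨g, hg, -, hFg⟩ := (meromorphicOrderAt_eq_int_iff h.1).1 h.2
  have h1 : AnalyticAt ℂ (fun z => (z - chartAt ℂ x x) ^ k * g z) (chartAt ℂ x x) :=
    ((analyticAt_id.sub analyticAt_const).pow k).mul hg
  refine ⟨fun y => (chartAt ℂ x y - chartAt ℂ x x) ^ k * g (chartAt ℂ x y), ?_, ?_⟩
  · refine AnalyticAt.congr h1 ?_
    filter_upwards [(chartAt ℂ x).open_target.mem_nhds (mem_chart_target ℂ x)] with u hu
    simp only [Function.comp_apply, (chartAt ℂ x).right_inv hu]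
  · filter_upwards [(tendsto_chartAt_nhdsNE x).eventually hFg,
      nhdsWithin_le_nhds (eventually_chartAt_symm x)] with y hy hy'
    simp only [Function.comp_apply, hy', smul_eq_mul, zpow_natCast] at hy
    exact hy

/-- A meromorphic function without poles extends to a holomorphic function, hence is constant. -/
lemma exists_eventually_eq_const {F : P1 → ℂ} {n : P1 → ℤ} (h : ∀ x, HasOrderAt F x (n x))
    (hn : ∀ x, 0 ≤ n x) : ∃ c : ℂ, ∀ x, F =ᶠ[𝓝[≠] x] fun _ => c := by
  choose g hg hFg using fun x => exists_holAt_of_hasOrderAt (h x) (hn x)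
  let G : P1 → ℂ := fun x => g x x
  have hG : ∀ x, G =ᶠ[𝓝 x] g x := by
    intro x
    have h1 : ∀ᶠ y in 𝓝[≠] x, F =ᶠ[𝓝[≠] y] g x := by
      have h0 := hFg x
      rw [EventuallyEq, eventually_nhdsWithin_iff] at h0
      obtain ⟨V, hV, hVo, hxV⟩ := eventually_nhds_iff.1 h0
      filter_upwards [self_mem_nhdsWithin, nhdsWithin_le_nhds (hVo.mem_nhds hxV)] with y hy hyV
      refine nhdsWithin_le_nhds ?_
      filter_upwards [hVo.mem_nhds hyV, isOpen_ne.mem_nhds hy] with w hw hw'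
      exact hV w hw hw'
    have h2 : ∀ᶠ y in 𝓝[≠] x, G y = g x y := by
      filter_upwards [h1, nhdsWithin_le_nhds (hg x).eventually] with y hy hy'
      have h3 : g y =ᶠ[𝓝[≠] y] g x := (hFg y).symm.trans hy
      have h4 := ((hg y).continuousAt.eventuallyEq_nhds_iff_eventuallyEq_nhdsNE
        hy'.continuousAt).1 h3
      exact h4.self_of_nhds
    exact eventuallyEq_nhds_of_eventuallyEq_nhdsNE h2 rfl
  have hGhol : ∀ x, HolAt G x := fun x => (hg x).congr (hG x).symm
  have hcont : Continuous G := continuous_iff_continuousAt.2 fun x => (hGhol x).continuousAt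
  obtain ⟨c, hc⟩ := Differentiable.exists_eq_const_of_bounded (f := fun z : ℂ => G z)
    (fun z => (holAt_coe.1 (hGhol z)).differentiableAt) ((isCompact_range hcont).isBounded.subset
      (Set.range_comp_subset_range ((↑) : ℂ → P1) G))
  have hGc : ∀ x, G x = c := by
    have h5 : ∀ z : ℂ, G z = c := fun z => congrFun hc z
    intro x
    exact congrFun (OnePoint.denseRange_coe.equalizer hcont continuous_const (funext h5)) x
  refine ⟨c, fun x => (hFg x).trans ?_⟩
  filter_upwards [nhdsWithin_le_nhds (hG x)] with y hy
  rw [← hy, hGc]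

lemma eq_zero_of_hasOrderAt_of_nonneg {F : P1 → ℂ} {n : P1 → ℤ} (h : ∀ x, HasOrderAt F x (n x))
    (hn : ∀ x, 0 ≤ n x) (x : P1) : n x = 0 := by
  obtain ⟨c, hc⟩ := exists_eventually_eq_const h hn
  have h1 := (h x).congr (hc x)
  rcases eq_or_ne c 0 with rfl | h0
  · have h2 := h1.2
    rw [meromorphicOrderAt_eq_top_iff.2] at h2
    · exact absurd h2 (by simp)
    · exact Eventually.of_forall fun _ => rfl
  · exact h1.unique ((HolAt.const c).hasOrderAt_zero h0)

/-- There is a meromorphic function with divisor `n - deg(n) ∞`. -/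
lemma exists_hasOrderAt_sub (n : P1 →₀ ℤ) : ∃ Q : P1 → ℂ, ∀ x,
    HasOrderAt Q x ((n - Finsupp.single OnePoint.infty (n.sum fun _ k => k) : P1 →₀ ℤ) x) := by
  induction n using Finsupp.induction_linear with
  | zero => exact ⟨fun _ => 1, fun x => by
      simpa using (HolAt.const (x := x) 1).hasOrderAt_zero one_ne_zero⟩
  | add n m hn hm =>
    obtain ⟨Q, hQ⟩ := hn
    obtain ⟨Q', hQ'⟩ := hm
    refine ⟨fun y => Q y * Q' y, fun x => ?_⟩
    convert (hQ x).mul (hQ' x) using 1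
    rw [Finsupp.sum_add_index' (fun _ => rfl) (fun _ _ _ => rfl), Finsupp.single_add]
    simp only [Finsupp.sub_apply, Finsupp.add_apply]
    ring
  | single p k =>
    rw [Finsupp.sum_single_index rfl]
    induction p using OnePoint.rec with
    | infty => exact ⟨fun _ => 1, fun x => by
        simpa using (HolAt.const (x := x) 1).hasOrderAt_zero one_ne_zero⟩
    | coe a =>
      refine ⟨fun y => (affCoord y - a) ^ k, fun x => ?_⟩
      induction x using OnePoint.rec with
      | infty =>
        have h1 := (hasOrderAt_affCoord_sub_infty a).zpow k
        rwa [Finsupp.sub_apply, Finsupp.single_eq_same,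
          Finsupp.single_eq_of_ne (OnePoint.infty_ne_coe a), zero_sub, ← mul_neg_one]
      | coe z =>
        rw [Finsupp.sub_apply, Finsupp.single_eq_of_ne (OnePoint.coe_ne_infty z), sub_zero]
        rcases eq_or_ne z a with rfl | hz
        · have h1 := (hasOrderAt_affCoord_sub_self z).zpow k
          rw [mul_one] at h1
          rwa [Finsupp.single_eq_same]
        · have h1 := (hasOrderAt_affCoord_sub_of_ne hz).zpow k
          rwa [Finsupp.single_eq_of_ne (by simpa using hz), ← mul_zero k]

/-- A meromorphic function has as many zeros as poles. -/
lemma sum_eq_zero_of_hasOrderAt {F : P1 → ℂ} (n : P1 →₀ ℤ) (h : ∀ x, HasOrderAt F x (n x)) :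
    (n.sum fun _ k => k) = 0 := by
  classical
  obtain ⟨Q, hQ⟩ := exists_hasOrderAt_sub n
  have h1 : ∀ x, HasOrderAt (fun y => F y * (Q y)⁻¹) x
      ((Finsupp.single OnePoint.infty (n.sum fun _ k => k) : P1 →₀ ℤ) x) := fun x => by
    convert (h x).mul (hQ x).inv using 1
    rw [Finsupp.sub_apply]
    ring
  have h2 : ∀ x, HasOrderAt (fun y => (F y * (Q y)⁻¹)⁻¹) x
      (-Finsupp.single OnePoint.infty (n.sum fun _ k => k) x) := fun x => (h1 x).inv
  rw [← Finsupp.single_eq_same (a := (OnePoint.infty : P1)) (b := n.sum fun _ k => k)]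
  rcases le_total 0 (n.sum fun _ k => k) with h0 | h0
  · refine eq_zero_of_hasOrderAt_of_nonneg h1 (fun x => ?_) _
    rw [Finsupp.single_apply]
    split_ifs <;> omega
  · rw [← neg_eq_zero]
    refine eq_zero_of_hasOrderAt_of_nonneg h2 (fun x => ?_) _
    rw [Finsupp.single_apply]
    split_ifs <;> omega

/-- The degree of a bundle is well defined: the ratio of two sections of the determinant is a
meromorphic function. -/
lemma HasDegree.unique {E : Mod} {r : ℕ} {d d' : ℤ} (hE : IsBundleOfRank E r)
    (h : HasDegree E r d) (h' : HasDegree E r d') : d = d' := by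
  obtain ⟨σ, rfl⟩ := h
  obtain ⟨σ', rfl⟩ := h'
  choose U hU e he using hE.exists_basis
  have h1 : ∀ x, HasOrderAt (fun y => σ.coeff (U y) (e y) y * (σ'.coeff (U y) (e y) y)⁻¹) x
      ((σ.divisor - σ'.divisor) x) := by
    intro x
    have h2 := (σ.hasOrderAt (U x) (e x) (isFrame_iff.2 (he x)) x (hU x)).mul
      (σ'.hasOrderAt (U x) (e x) (isFrame_iff.2 (he x)) x (hU x)).inv
    rw [Finsupp.sub_apply, sub_eq_add_neg]
    refine h2.congr (nhdsWithin_le_nhds ?_)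
    filter_upwards [(U x).isOpen.mem_nhds (hU x)] with y hy
    rw [σ.coeff_eq_transDet_mul (he y) (he x) (hU y) hy,
      σ'.coeff_eq_transDet_mul (he y) (he x) (hU y) hy, ← div_eq_mul_inv, ← div_eq_mul_inv,
      mul_div_mul_left _ _ ((he y).transDet_ne_zero (he x) (hU y) hy)]
  have h3 := sum_eq_zero_of_hasOrderAt _ h1
  rw [Finsupp.sum_sub_index (fun _ _ _ => rfl)] at h3
  exact sub_eq_zero.1 h3

end Uniqueness

/-! ### Additivity of the degree -/

section Additivity

open Filter Topology

variable {E F : Mod} {U U' V W : Opens P1}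

section Blocks

variable {ι κ : Type*} [Fintype ι] [Fintype κ] {S : ShortComplex Mod}
    {a : ι → Sec S.X₁ U} (ha : IsBasisOn S.X₁ U a) {c : κ → Sec S.X₂ U}
    (hc : IsBasisOn S.X₃ U fun k => app S.g U (c k))
    {e : ι ⊕ κ → Sec S.X₂ U} (he : IsBasisOn S.X₂ U e)
    (hae : ∀ i, e (.inl i) = app S.f U (a i)) (hce : ∀ k, e (.inr k) = c k)

include ha hae in
lemma val_app_f (s : Sec S.X₁ U') (x : P1) (i : ι ⊕ κ) :
    he.val (app S.f U' s) x i = Sum.elim (fun i => ha.val s x i) 0 i := by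
  have h1 : he.coord (inf_le_left : U ⊓ U' ≤ U) (restrict S.X₂ inf_le_right (app S.f U' s)) =
      Sum.elim (ha.coord inf_le_left (restrict S.X₁ inf_le_right s)) 0 := by
    refine he.coord_unique _ ?_
    rw [Fintype.sum_sum_type, ← app_restrict]
    simp only [Sum.elim_inl, Sum.elim_inr, Pi.zero_apply, zero_smul, Finset.sum_const_zero,
      add_zero, hae]
    conv_rhs => rw [← ha.sum_coord inf_le_left (restrict S.X₁ inf_le_right s)]
    rw [map_sum]
    exact Finset.sum_congr rfl fun i _ => by rw [map_smul, app_restrict]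
  rw [IsBasisOn.val, h1]
  rcases i with i | k
  · rfl
  · exact Fun.ext0_zero x

include hae hce in
lemma val_app_g (s : Sec S.X₂ U') (x : P1) (k : κ) :
    hc.val (app S.g U' s) x k = he.val s x (.inr k) := by
  have h1 : hc.coord (inf_le_left : U ⊓ U' ≤ U) (restrict S.X₃ inf_le_right (app S.g U' s)) =
      fun k => he.coord inf_le_left (restrict S.X₂ inf_le_right s) (.inr k) := by
    refine hc.coord_unique _ ?_
    rw [← app_restrict]
    conv_rhs => rw [← he.sum_coord inf_le_left (restrict S.X₂ inf_le_right s)]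
    rw [map_sum, Fintype.sum_sum_type]
    symm
    refine (congrArg₂ (· + ·) (Finset.sum_eq_zero fun i _ => ?_) rfl).trans ((zero_add _).trans ?_)
    · rw [map_smul, app_restrict, hae, ← app_comp, S.zero, app_zero, restrict_zero, smul_zero]
    · exact Finset.sum_congr rfl fun i _ => by rw [map_smul, app_restrict, hce]
  rw [IsBasisOn.val, h1, IsBasisOn.val]

include hae hce in
/-- In bases adapted to an extension, transition matrices are block triangular. -/
lemma transDet_of_exact [DecidableEq ι] [DecidableEq κ] {a' : ι → Sec S.X₁ U'}
    {c' : κ → Sec S.X₂ U'} {e' : ι ⊕ κ → Sec S.X₂ U'}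
    (hae' : ∀ i, e' (.inl i) = app S.f U' (a' i)) (hce' : ∀ k, e' (.inr k) = c' k) (x : P1) :
    he.transDet e' x = ha.transDet a' x * hc.transDet (fun k => app S.g U' (c' k)) x := by
  rw [IsBasisOn.transDet, ← Matrix.fromBlocks_toBlocks (Matrix.of fun i j => he.val (e' j) x i)]
  have h21 : (Matrix.of fun i j => he.val (e' j) x i).toBlocks₂₁ = 0 := by
    ext i j
    simp only [Matrix.toBlocks₂₁, Matrix.of_apply, hae', val_app_f ha he hae, Sum.elim_inr]
    rfl
  rw [h21, Matrix.det_fromBlocks_zero₂₁]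
  congr 2
  · ext i j
    simp only [Matrix.toBlocks₁₁, Matrix.of_apply, hae', val_app_f ha he hae, Sum.elim_inl]
  · ext i j
    simp only [Matrix.toBlocks₂₂, Matrix.of_apply, hce']
    exact (val_app_g hc he hae hce _ _ _).symm

end Blocks

/-- The degree is additive in short exact sequences. -/
lemma HasDegree.of_shortExact {S : ShortComplex Mod} (hS : S.ShortExact) {r s : ℕ} {d d' : ℤ}
    (h₁ : IsBundleOfRank S.X₁ r) (h₃ : IsBundleOfRank S.X₃ s) (hd : HasDegree S.X₁ r d)
    (hd' : HasDegree S.X₃ s d') : HasDegree S.X₂ (r + s) (d + d') := by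
  have := hS.mono_f
  obtain ⟨σ, rfl⟩ := hd
  obtain ⟨σ', rfl⟩ := hd'
  choose U hU a c ha hc using exists_adapted_basis hS h₁ h₃
  have he := fun x => isBasisOn_sum_elim hS.exact (ha x) (hc x)
  rw [← Finsupp.sum_add_index' (fun _ => rfl) (fun _ _ _ => rfl)]
  refine hasDegree_of_local (by simp) hU he (c := fun x z => σ.coeff (U x) (a x) z *
    σ'.coeff (U x) (fun k => app S.g (U x) (c x k)) z) (σ.divisor + σ'.divisor)
    (fun x => ?_) fun x y z hx hy => ?_
  · exact (σ.hasOrderAt _ _ (isFrame_iff.2 (ha x)) x (hU x)).mul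
      (σ'.hasOrderAt _ _ (isFrame_iff.2 (hc x)) x (hU x))
  · rw [transDet_of_exact (ha x) (hc x) (he x) (fun _ => rfl) (fun _ => rfl) (a' := a y)
      (c' := c y) (fun _ => rfl) (fun _ => rfl), σ.coeff_eq_transDet_mul (ha x) (ha y) hx hy,
      σ'.coeff_eq_transDet_mul (hc x) (hc y) hx hy]
    ring

lemma hasDegree_zero (hE : IsZero E) : HasDegree E 0 0 := by
  choose U hU e he using (isBundleOfRank_zero_iff.2 hE).exists_basis
  refine hasDegree_of_local (Fintype.card_fin 0) hU he (c := fun _ _ => 1) 0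
    (fun x => (HolAt.const 1).hasOrderAt_zero one_ne_zero) fun x y z hx hy => ?_
  rw [IsBasisOn.transDet, Matrix.det_isEmpty, one_mul]

lemma asSec_injective : Function.Injective (asSec (U := U)) := fun _ _ h => h

lemma isBasisOn_unit : IsBasisOn unit U (fun _ : Unit => asSec 1) := by
  intro V h
  have h1 : ∀ a : Unit → Fun V, ∑ i, a i • restrict unit h (asSec 1) = asSec (a ()) := by
    intro a
    rw [Fintype.sum_unique, restrict_asSec, map_one, smul_asSec, mul_one]
  constructor
  · intro a a' haa'
    simp only [h1] at haa'
    funext i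
    exact haa'
  · intro s
    obtain ⟨g, rfl⟩ := exists_asSec_eq s
    exact ⟨fun _ => g, h1 _⟩

lemma isBundleOfRank_unit : IsBundleOfRank unit 1 :=
  isBundleOfRank_of_basis fun _ => ⟨⊤, trivial, Unit, _, _, isBasisOn_unit, rfl⟩

lemma hasDegree_unit : HasDegree unit 1 0 := by
  refine hasDegree_of_local (Fintype.card_unit) (U := fun _ => ⊤) (fun _ => trivial)
    (fun _ => isBasisOn_unit) (c := fun _ _ => 1) 0 (fun x => ?_) fun x y z hx hy => ?_
  · exact (HolAt.const 1).hasOrderAt_zero one_ne_zero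
  · rw [isBasisOn_unit.transDet_self hx, one_mul]

lemma hasOrderAt_coordAt (x : P1) : HasOrderAt (coordAt x) x 1 :=
  (holAt_coordAt x).hasOrderAt (n := 1) (ordAt_coordAt x)

lemma IsIdealOfPoint.exists_basis {J : Mod} {j : J ⟶ unit} {p : P1} (h : IsIdealOfPoint j p)
    (x : P1) : ∃ (U : Opens P1) (_ : x ∈ U) (k : Unit → Sec J U) (u : Fun U), IsBasisOn J U k ∧
      (∀ i, app j _ (k i) = asSec u) ∧ HasOrderAt u.ext0 x (Finsupp.single p (1 : ℤ) x) := by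
  obtain ⟨⟨k, hk, hk1⟩, V, hpV, z, k', hk', hkz, hz⟩ := h
  rcases eq_or_ne x p with rfl | hx
  · refine ⟨V, hpV, k', z, hk', hkz, ?_⟩
    rw [Finsupp.single_eq_same]
    refine (hasOrderAt_coordAt x).congr (nhdsWithin_le_nhds ?_)
    filter_upwards [V.isOpen.mem_nhds hpV] with y hy
    exact (hz y hy).symm
  · refine ⟨complPt p, hx, k, 1, hk, hk1, ?_⟩
    rw [Finsupp.single_eq_of_ne hx]
    refine (Fun.holAt_ext0 _ (show x ∈ complPt p from hx)).hasOrderAt_zero ?_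
    rw [Fun.ext0_one (show x ∈ complPt p from hx)]
    exact one_ne_zero

lemma IsIdealOfPoint.isBundleOfRank {J : Mod} {j : J ⟶ unit} {p : P1} (h : IsIdealOfPoint j p) :
    IsBundleOfRank J 1 := isBundleOfRank_of_basis fun x => by
  obtain ⟨U, hU, k, -, hk, -⟩ := h.exists_basis x
  exact ⟨U, hU, Unit, _, k, hk, rfl⟩

/-- The ideal sheaf of a point has degree `-1`: the constant function `1` is a section with a pole
at that point. -/
lemma IsIdealOfPoint.hasDegree {J : Mod} {j : J ⟶ unit} {p : P1} (h : IsIdealOfPoint j p) :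
    HasDegree J 1 (-1) := by
  choose U hU k u hk hu hord using h.exists_basis
  have hsum : ((-Finsupp.single p (1 : ℤ)).sum fun _ n => n) = -1 := by
    rw [← Finsupp.single_neg, Finsupp.sum_single_index rfl]
  rw [← hsum]
  refine hasDegree_of_local Fintype.card_unit hU hk (c := fun x z => ((u x).ext0 z)⁻¹) _
    (fun x => (hord x).inv) fun x y z hx hy => ?_
  have h1 : (u y).ext0 z = (hk x).transDet (k y) z * (u x).ext0 z := by
    have h2 := (hk x).sum_coord inf_le_left (restrict J (inf_le_right : U x ⊓ U y ≤ U y) (k y ()))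
    have h3 := congrArg (app j _) h2
    rw [Fintype.sum_unique, map_smul, app_restrict, app_restrict, hu, hu, restrict_asSec,
      restrict_asSec, smul_asSec] at h3
    have h4 := asSec_injective h3
    have h5 := congrArg (fun g => Fun.ext0 g z) h4
    have hz : z ∈ U x ⊓ U y := ⟨hx, hy⟩
    simp only [Fun.ext0_mul _ _ hz, Fun.ext0_res _ _ hz] at h5
    rw [← h5, IsBasisOn.transDet, Matrix.det_unique]
    rfl
  have h2 := (hk x).transDet_ne_zero (hk y) hx hy
  rw [h1, mul_inv, ← mul_assoc, mul_inv_cancel₀ h2, one_mul]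

end Additivity

/-! ### Semistable bundles -/

section Kernels

variable {C : Type*} [Category* C] [Abelian C]

lemma shortExact_kernel_image {A B : C} (f : A ⟶ B) :
    (ShortComplex.mk (kernel.ι f) (Abelian.factorThruImage f) (by
      rw [← cancel_mono (Abelian.image.ι f), Category.assoc, Abelian.image.fac,
        kernel.condition, zero_comp])).ShortExact where
  exact := by
    refine ShortComplex.exact_of_f_is_kernel _ (KernelFork.IsLimit.ofι' _ _ fun {W} k hk => ?_)
    refine ⟨kernel.lift f k ?_, kernel.lift_ι _ _ _⟩
    rw [← Abelian.image.fac f, ← Category.assoc, hk, zero_comp]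

lemma shortExact_image_cokernel {A B : C} (f : A ⟶ B) :
    (ShortComplex.mk (Abelian.image.ι f) (cokernel.π f) (kernel.condition _)).ShortExact where
  exact := ShortComplex.exact_kernel _
  epi_g := inferInstanceAs (Epi (cokernel.π f))

/-- The kernels of parallel sides of a cartesian square agree. -/
lemma exact_of_isPullback {J F P X Y : C} {j : J ⟶ F} {h : F ⟶ Y} {g : X ⟶ Y} {q : P ⟶ X}
    {p : P ⟶ F} (sq : IsPullback q p g h) (w : j ≫ h = 0) (hj : (ShortComplex.mk j h w).Exact)
    [Mono j] :
    ∃ (l : J ⟶ P) (w' : l ≫ q = 0), l ≫ p = j ∧ Mono l ∧ (ShortComplex.mk l q w').Exact := by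
  have hlp : sq.lift 0 j (by rw [zero_comp, w]) ≫ p = j := sq.lift_snd _ _ _
  have hlq : sq.lift 0 j (by rw [zero_comp, w]) ≫ q = 0 := sq.lift_fst _ _ _
  have hm : Mono (sq.lift 0 j (by rw [zero_comp, w])) := by
    have : Mono (sq.lift 0 j (by rw [zero_comp, w]) ≫ p) := by rwa [hlp]
    exact mono_of_mono _ p
  refine ⟨_, hlq, hlp, hm, ShortComplex.exact_of_f_is_kernel _
    (KernelFork.IsLimit.ofι' _ _ fun {W} k hk => ?_)⟩
  have hk' : (k ≫ p) ≫ h = 0 := by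
    rw [Category.assoc, ← sq.w, ← Category.assoc, hk, zero_comp]
  refine ⟨hj.lift (k ≫ p) hk', sq.hom_ext ?_ ?_⟩
  · rw [Category.assoc, hlq, comp_zero]
    exact hk.symm
  · rw [Category.assoc, hlp]
    exact hj.lift_f _ _

lemma nonempty_kernel_iso_of_isPullback {F P X Y : C} {h : F ⟶ Y} {g : X ⟶ Y} {q : P ⟶ X}
    {p : P ⟶ F} (sq : IsPullback q p g h) : Nonempty (kernel h ≅ kernel q) := by
  obtain ⟨l, w', -, hl, hex⟩ := exact_of_isPullback sq (kernel.condition h)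
    (ShortComplex.exact_kernel h)
  exact ⟨IsLimit.conePointUniqueUpToIso hex.fIsKernel (limit.isLimit _)⟩

/-- An extension may be pulled back. -/
lemma exists_pullback_shortExact {S : ShortComplex C} (hS : S.ShortExact) {F : C} (h : F ⟶ S.X₃) :
    ∃ (P : C) (i : S.X₁ ⟶ P) (p : P ⟶ F) (q : P ⟶ S.X₂) (w : i ≫ p = 0),
      (ShortComplex.mk i p w).ShortExact ∧ IsPullback q p S.g h := by
  have := hS.mono_f
  have := hS.epi_g
  have sq := IsPullback.of_hasPullback S.g h
  obtain ⟨l, w', -, hl, hex⟩ := exact_of_isPullback sq.flip S.zero hS.exact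
  have : Epi (pullback.snd S.g h) := Abelian.epi_pullback_of_epi_f _ _
  exact ⟨_, l, _, _, w', { exact := hex }, sq⟩

end Kernels

section Semistable

open scoped ZeroObject

variable {A B C E F : Mod} {r s : ℕ} {d d' w : ℤ}

/-- `E` is a bundle of rank `r` and degree `d`. -/
def Deg (E : Mod) (r : ℕ) (d : ℤ) : Prop := IsBundleOfRank E r ∧ HasDegree E r d

lemma IsBundle.exists_deg (hE : IsBundle E) : ∃ r d, Deg E r d := by
  obtain ⟨r, hr⟩ := hE
  obtain ⟨d, hd⟩ := hr.exists_hasDegree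
  exact ⟨r, d, hr, hd⟩

lemma Deg.isBundle (h : Deg E r d) : IsBundle E := ⟨r, h.1⟩

lemma Deg.unique (h : Deg E r d) (h' : Deg E s d') : r = s ∧ d = d' := by
  obtain rfl := h.1.unique h'.1
  exact ⟨rfl, HasDegree.unique h.1 h.2 h'.2⟩

lemma Deg.of_shortExact {S : ShortComplex Mod} (hS : S.ShortExact) (h₁ : Deg S.X₁ r d)
    (h₃ : Deg S.X₃ s d') : Deg S.X₂ (r + s) (d + d') :=
  ⟨.of_shortExact hS h₁.1 h₃.1, .of_shortExact hS h₁.1 h₃.1 h₁.2 h₃.2⟩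

lemma deg_zero (hE : IsZero E) : Deg E 0 0 := ⟨isBundleOfRank_zero_iff.2 hE, hasDegree_zero hE⟩

lemma Deg.of_iso (h : Deg E r d) (e : E ≅ F) : Deg F r d := by
  have hS : (ShortComplex.mk (0 : (0 : Mod) ⟶ F) e.inv zero_comp).ShortExact :=
    { exact := (ShortComplex.exact_iff_mono _ rfl).2 inferInstance
      mono_f := (isZero_zero Mod).mono _
      epi_g := inferInstanceAs (Epi e.inv) }
  simpa using Deg.of_shortExact hS (deg_zero (isZero_zero _)) h

lemma IsBundle.of_iso (h : IsBundle E) (e : E ≅ F) : IsBundle F := by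
  obtain ⟨r, d, hd⟩ := h.exists_deg
  exact (hd.of_iso e).isBundle

lemma IsBundle.of_shortExact {S : ShortComplex Mod} (hS : S.ShortExact) (h₁ : IsBundle S.X₁)
    (h₃ : IsBundle S.X₃) : IsBundle S.X₂ := by
  obtain ⟨r, d, hd⟩ := h₁.exists_deg
  obtain ⟨s, d', hd'⟩ := h₃.exists_deg
  exact (hd.of_shortExact hS hd').isBundle

lemma isBundle_zero (hE : IsZero E) : IsBundle E := (deg_zero hE).isBundle

/-- The numerical invariants of the kernel and of the image of a morphism of bundles. -/
lemma exists_deg_kernel_image (hA : Deg A r d) (hB : IsBundle B) (f : A ⟶ B) :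
    ∃ (k i : ℕ) (dk di : ℤ), Deg (kernel f) k dk ∧ Deg (Abelian.image f) i di ∧
      r = k + i ∧ d = dk + di := by
  have hI : IsBundle (Abelian.image f) := IsBundle.of_epi_mono (Abelian.factorThruImage f)
    (Abelian.image.ι f) hA.isBundle hB
  have hK : IsBundle (kernel f) := IsBundle.of_exact_left
    (S := ShortComplex.mk (kernel.ι f) (Abelian.factorThruImage f) _)
    (shortExact_kernel_image f).exact hA.isBundle hI
  obtain ⟨k, dk, hk⟩ := hK.exists_deg
  obtain ⟨i, di, hi⟩ := hI.exists_deg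
  obtain ⟨h1, h2⟩ := hA.unique (hk.of_shortExact (shortExact_kernel_image f) hi)
  exact ⟨k, i, dk, di, hk, hi, h1, h2⟩

namespace IsSemistableOfSlope

lemma exists_deg (h : IsSemistableOfSlope E w) : ∃ r : ℕ, Deg E r (w * r) := by
  obtain ⟨r, hr, hd, -⟩ := h
  exact ⟨r, hr, hd⟩

lemma isBundle (h : IsSemistableOfSlope E w) : IsBundle E :=
  let ⟨_, hr⟩ := h.exists_deg
  hr.isBundle

lemma le_of_mono (h : IsSemistableOfSlope E w) (i : F ⟶ E) [Mono i] (hF : Deg F s d) :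
    d ≤ w * s := by
  obtain ⟨r, -, -, hsub⟩ := h
  exact hsub F i s d hF.1 hF.2

lemma of_deg (hE : Deg E r (w * r))
    (h : ∀ (F : Mod) (i : F ⟶ E) [Mono i] (s : ℕ) (d : ℤ), Deg F s d → d ≤ w * s) :
    IsSemistableOfSlope E w :=
  ⟨r, hE.1, hE.2, fun F i _ s d h₁ h₂ => h F i s d ⟨h₁, h₂⟩⟩

lemma of_isZero (hE : IsZero E) (w : ℤ) : IsSemistableOfSlope E w := by
  refine of_deg (r := 0) (by simpa using deg_zero hE) fun F i _ s d hF => ?_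
  obtain ⟨rfl, rfl⟩ := hF.unique (deg_zero (hE.of_mono i))
  simp

lemma of_iso (h : IsSemistableOfSlope E w) (e : E ≅ F) : IsSemistableOfSlope F w := by
  obtain ⟨r, hr⟩ := h.exists_deg
  exact of_deg (hr.of_iso e) fun G i _ s d hG => h.le_of_mono (i ≫ e.inv) hG

/-- A subsheaf of the same slope is semistable. -/
lemma of_mono (h : IsSemistableOfSlope E w) (i : F ⟶ E) [Mono i] (hF : Deg F s (w * s)) :
    IsSemistableOfSlope F w :=
  of_deg hF fun _ j _ _ _ hG => h.le_of_mono (j ≫ i) hG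

lemma hom_eq_zero {a b : ℤ} (hA : IsSemistableOfSlope A a) (hB : IsSemistableOfSlope B b)
    (hab : b < a) (f : A ⟶ B) : f = 0 := by
  obtain ⟨r, hr⟩ := hA.exists_deg
  obtain ⟨k, i, dk, di, hk, hi, h1, h2⟩ := exists_deg_kernel_image hr hB.isBundle f
  have h3 := hA.le_of_mono (kernel.ι f) hk
  have h4 := hB.le_of_mono (Abelian.image.ι f) hi
  have h5 : (a - b) * i ≤ 0 := by
    rw [h1] at h2
    push_cast at h2
    linarith
  have h6 : i = 0 := by
    by_contra h0
    have : (0 : ℤ) < i := by exact_mod_cast Nat.pos_of_ne_zero h0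
    nlinarith
  subst h6
  rw [← Abelian.image.fac f, (isBundleOfRank_zero_iff.1 hi.1).eq_zero_of_tgt
    (Abelian.factorThruImage f), zero_comp]

section Morphisms

variable (hA : IsSemistableOfSlope A w) (hB : IsSemistableOfSlope B w) (f : A ⟶ B)

include hA hB

/-- The kernel and the image of a morphism of semistable bundles of slope `w` have slope `w`: their
slopes are at most `w`, and so is the slope of the source, which lies between these slopes. -/
lemma exists_deg_kernel_image : ∃ k i : ℕ, Deg (kernel f) k (w * k) ∧
    Deg (Abelian.image f) i (w * i) := by
  obtain ⟨r, hr⟩ := hA.exists_deg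
  obtain ⟨k, i, dk, di, hk, hi, h1, h2⟩ := Twistor.exists_deg_kernel_image hr hB.isBundle f
  have h3 := hA.le_of_mono (kernel.ι f) hk
  have h4 := hB.le_of_mono (Abelian.image.ι f) hi
  rw [h1] at h2
  push_cast at h2
  obtain rfl : dk = w * k := by linarith
  obtain rfl : di = w * i := by linarith
  exact ⟨k, i, hk, hi⟩

lemma isSemistable_kernel : IsSemistableOfSlope (kernel f) w := by
  obtain ⟨k, i, hk, -⟩ := hA.exists_deg_kernel_image hB f
  exact hA.of_mono (kernel.ι f) hk

/-- The cokernel of a morphism of semistable bundles of slope `w` is a bundle. Otherwise, a section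
of the cokernel annihilated by the ideal sheaf of a point provides a subsheaf of the target of the
same rank as the image of the morphism, but of larger degree. -/
lemma isBundle_cokernel : IsBundle (cokernel f) := by
  obtain ⟨-, i, -, hi⟩ := hA.exists_deg_kernel_image hB f
  have hS := shortExact_image_cokernel f
  have key : IsBundle (cokernel f) ∨ ∃ (τ : unit ⟶ cokernel f) (x : P1),
      IsIdealOfPoint (kernel.ι τ) x := isBundle_or_exists_torsion hS hi.isBundle hB.isBundle
  rcases key with h | ⟨τ, x, hτ⟩
  · exact h
  exfalso
  obtain ⟨P, a, p, q, w₀, hP, sq⟩ : ∃ (P : Mod) (a : Abelian.image f ⟶ P) (p : P ⟶ unit)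
      (q : P ⟶ B) (w₀ : a ≫ p = 0), (ShortComplex.mk a p w₀).ShortExact ∧
        IsPullback q p (cokernel.π f) τ := exists_pullback_shortExact hS τ
  have hPdeg : Deg P (i + 1) (w * i + 0) :=
    Deg.of_shortExact hP hi ⟨isBundleOfRank_unit, hasDegree_unit⟩
  obtain ⟨k, i', dk, di', hk, hi', h1, h2⟩ :=
    Twistor.exists_deg_kernel_image hPdeg hB.isBundle q
  -- The kernel of `P ⟶ B` is the ideal sheaf.
  have hJ : Deg (kernel q) 1 (-1) := by
    obtain ⟨iso⟩ := nonempty_kernel_iso_of_isPullback sq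
    have hJ' : Deg (kernel τ) 1 (-1) := ⟨hτ.isBundleOfRank, hτ.hasDegree⟩
    exact hJ'.of_iso iso
  obtain ⟨rfl, rfl⟩ := hk.unique hJ
  have h3 := hB.le_of_mono (Abelian.image.ι q) hi'
  obtain rfl : i = i' := by omega
  linarith

lemma isSemistable_cokernel : IsSemistableOfSlope (cokernel f) w := by
  obtain ⟨-, i, -, hi⟩ := hA.exists_deg_kernel_image hB f
  have hS := shortExact_image_cokernel f
  obtain ⟨c, dc, hc⟩ := (hA.isBundle_cokernel hB f).exists_deg
  obtain ⟨r, hr⟩ := hB.exists_deg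
  obtain ⟨h1, h2⟩ := hr.unique (Deg.of_shortExact hS hi hc)
  rw [h1] at h2
  push_cast at h2
  obtain rfl : dc = w * c := by linarith
  refine of_deg hc fun F j _ s d hF => ?_
  obtain ⟨P, a, p, q, w₀, hP, sq⟩ := exists_pullback_shortExact hS j
  have : Mono q := ⟨fun u v huv => sq.hom_ext huv (by
    rw [← cancel_mono j, Category.assoc, Category.assoc, ← sq.w, ← Category.assoc, huv,
      Category.assoc])⟩
  have h3 := hB.le_of_mono q (Deg.of_shortExact hP hi hF)
  push_cast at h3
  linarith

end Morphisms

lemma of_shortExact {S : ShortComplex Mod} (hS : S.ShortExact) (h₁ : IsSemistableOfSlope S.X₁ w)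
    (h₃ : IsSemistableOfSlope S.X₃ w) : IsSemistableOfSlope S.X₂ w := by
  have := hS.mono_f
  obtain ⟨r, hr⟩ := h₁.exists_deg
  obtain ⟨s, hs⟩ := h₃.exists_deg
  refine of_deg (r := r + s) (by
    push_cast
    rw [mul_add]
    exact hr.of_shortExact hS hs) fun F j _ t d hF => ?_
  obtain ⟨k, i, dk, di, hk, hi, h1, h2⟩ :=
    Twistor.exists_deg_kernel_image hF h₃.isBundle (j ≫ S.g)
  have hw : (kernel.ι (j ≫ S.g) ≫ j) ≫ S.g = 0 := by
    rw [Category.assoc, kernel.condition]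
  have : Mono (hS.exact.lift _ hw) := by
    have : Mono (hS.exact.lift _ hw ≫ S.f) := by
      rw [hS.exact.lift_f]
      infer_instance
    exact mono_of_mono _ S.f
  have h3 := h₁.le_of_mono (hS.exact.lift _ hw) hk
  have h4 := h₃.le_of_mono (Abelian.image.ι (j ≫ S.g)) hi
  rw [h1, h2]
  push_cast
  linarith

end IsSemistableOfSlope

end Semistable

/-! ### Filtered objects of an abelian category -/

section Snake

universe v u

variable {C : Type u} [Category.{v} C] [Abelian C]

/-- The row of kernels of a morphism of short complexes. -/
abbrev kernelRow {S T : ShortComplex C} (φ : S ⟶ T) : ShortComplex C :=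
  ShortComplex.mk (kernel.map φ.τ₁ φ.τ₂ S.f T.f φ.comm₁₂)
    (kernel.map φ.τ₂ φ.τ₃ S.g T.g φ.comm₂₃) (by
      rw [← cancel_mono (kernel.ι _)]
      simp)

/-- The row of cokernels of a morphism of short complexes. -/
abbrev cokernelRow {S T : ShortComplex C} (φ : S ⟶ T) : ShortComplex C :=
  ShortComplex.mk (cokernel.map φ.τ₁ φ.τ₂ S.f T.f φ.comm₁₂)
    (cokernel.map φ.τ₂ φ.τ₃ S.g T.g φ.comm₂₃) (by
      rw [← cancel_epi (cokernel.π _)]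
      simp)

/-- The inclusion of the row of kernels. -/
abbrev kernelRowι {S T : ShortComplex C} (φ : S ⟶ T) : kernelRow φ ⟶ S :=
  ⟨kernel.ι _, kernel.ι _, kernel.ι _, (kernel.lift_ι _ _ _).symm, (kernel.lift_ι _ _ _).symm⟩

instance {S T : ShortComplex C} (φ : S ⟶ T) : Mono (kernelRowι φ) :=
  ⟨fun _ _ h => ShortComplex.hom_ext _ _
    ((cancel_mono (kernel.ι φ.τ₁)).1 (congrArg ShortComplex.Hom.τ₁ h))
    ((cancel_mono (kernel.ι φ.τ₂)).1 (congrArg ShortComplex.Hom.τ₂ h))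
    ((cancel_mono (kernel.ι φ.τ₃)).1 (congrArg ShortComplex.Hom.τ₃ h))⟩

/-- The projection to the row of cokernels. -/
abbrev cokernelRowπ {S T : ShortComplex C} (φ : S ⟶ T) : T ⟶ cokernelRow φ :=
  ⟨cokernel.π _, cokernel.π _, cokernel.π _, cokernel.π_desc _ _ _, cokernel.π_desc _ _ _⟩

instance {S T : ShortComplex C} (φ : S ⟶ T) : Epi (cokernelRowπ φ) :=
  ⟨fun _ _ h => ShortComplex.hom_ext _ _
    ((cancel_epi (cokernel.π φ.τ₁)).1 (congrArg ShortComplex.Hom.τ₁ h))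
    ((cancel_epi (cokernel.π φ.τ₂)).1 (congrArg ShortComplex.Hom.τ₂ h))
    ((cancel_epi (cokernel.π φ.τ₃)).1 (congrArg ShortComplex.Hom.τ₃ h))⟩

/-- The input of the snake lemma given by a morphism of short exact sequences. -/
def snakeInput {S T : ShortComplex C} (φ : S ⟶ T) (hS : S.ShortExact) (hT : T.ShortExact) :
    ShortComplex.SnakeInput C where
  L₀ := kernelRow φ
  L₁ := S
  L₂ := T
  L₃ := cokernelRow φ
  v₀₁ := kernelRowι φ
  v₁₂ := φ
  v₂₃ := cokernelRowπ φ
  w₀₂ := by ext <;> exact kernel.condition _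
  w₁₃ := by ext <;> exact cokernel.condition _
  h₀ := by
    refine KernelFork.IsLimit.ofι' _ _ fun {W} k hk => ⟨⟨kernel.lift _ k.τ₁ ?_,
      kernel.lift _ k.τ₂ ?_,
      kernel.lift _ k.τ₃ ?_, ?_, ?_⟩, ?_⟩
    · rw [← ShortComplex.comp_τ₁, hk, ShortComplex.zero_τ₁]
    · rw [← ShortComplex.comp_τ₂, hk, ShortComplex.zero_τ₂]
    · rw [← ShortComplex.comp_τ₃, hk, ShortComplex.zero_τ₃]
    · rw [← cancel_mono (kernel.ι _)]
      simp [kernelRow, k.comm₁₂]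
    · rw [← cancel_mono (kernel.ι _)]
      simp [kernelRow, k.comm₂₃]
    · ext <;> simp
  h₃ := by
    refine CokernelCofork.IsColimit.ofπ' _ _ fun {W} k hk => ⟨⟨cokernel.desc _ k.τ₁ ?_,
      cokernel.desc _ k.τ₂ ?_, cokernel.desc _ k.τ₃ ?_, ?_, ?_⟩, ?_⟩
    · rw [← ShortComplex.comp_τ₁, hk, ShortComplex.zero_τ₁]
    · rw [← ShortComplex.comp_τ₂, hk, ShortComplex.zero_τ₂]
    · rw [← ShortComplex.comp_τ₃, hk, ShortComplex.zero_τ₃]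
    · rw [← cancel_epi (cokernel.π _)]
      simp [cokernelRow, k.comm₁₂]
    · rw [← cancel_epi (cokernel.π _)]
      simp [cokernelRow, k.comm₂₃]
    · ext <;> simp
  L₁_exact := hS.exact
  epi_L₁_g := hS.epi_g
  L₂_exact := hT.exact
  mono_L₂_f := hT.mono_f

/-- If there is no morphism for the connecting homomorphism to be, the snake falls apart. -/
lemma shortExact_of_hom_eq_zero {S T : ShortComplex C} (φ : S ⟶ T) (hS : S.ShortExact)
    (hT : T.ShortExact) (h : ∀ δ : kernel φ.τ₃ ⟶ cokernel φ.τ₁, δ = 0) :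
    (kernelRow φ).ShortExact ∧ (cokernelRow φ).ShortExact := by
  let D := snakeInput φ hS hT
  have hδ : D.δ = 0 := h D.δ
  have hm : Mono D.L₁.f := hS.mono_f
  have he : Epi D.L₂.g := hT.epi_g
  have h1 : Epi D.L₀.g := (D.L₁'.exact_iff_epi hδ).1 D.L₁'_exact
  have h2 : Mono D.L₃.f := (D.L₂'.exact_iff_mono hδ).1 D.L₂'_exact
  exact ⟨{ exact := D.L₀_exact, mono_f := D.mono_L₀_f, epi_g := h1 },
    { exact := D.L₃_exact, mono_f := h2, epi_g := D.epi_L₃_g }⟩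

end Snake

section Subobjects

universe v u

variable {C : Type u} [Category.{v} C] [Abelian C]

lemma factors_iff_comp_cokernel {X Y : C} (P : Subobject Y) (f : X ⟶ Y) :
    P.Factors f ↔ f ≫ cokernel.π P.arrow = 0 := by
  constructor
  · intro h
    rw [← P.factorThru_arrow f h, Category.assoc, cokernel.condition, comp_zero]
  · intro h
    have hex : (ShortComplex.mk P.arrow (cokernel.π P.arrow) (cokernel.condition _)).Exact :=
      ShortComplex.exact_cokernel _
    have : Mono (ShortComplex.mk P.arrow (cokernel.π P.arrow) (cokernel.condition _)).f :=
      inferInstanceAs (Mono P.arrow)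
    have h2 : hex.lift f h ≫ P.arrow = f := hex.lift_f f h
    rw [← h2]
    exact Subobject.factors_comp_arrow _

lemma factors_of_epi_comp {X X' Y : C} {P : Subobject Y} (e : X' ⟶ X) [Epi e] {f : X ⟶ Y}
    (h : P.Factors (e ≫ f)) : P.Factors f := by
  rw [factors_iff_comp_cokernel] at h ⊢
  rw [← cancel_epi e, ← Category.assoc, h, comp_zero]

lemma imageSubobject_le_iff {X Y : C} (f : X ⟶ Y) (P : Subobject Y) :
    imageSubobject f ≤ P ↔ P.Factors f := by
  constructor
  · intro h
    refine Subobject.factors_of_le f h ?_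
    have := imageSubobject_factors_comp_self (f := f) (𝟙 _)
    rwa [Category.id_comp] at this
  · intro h
    exact imageSubobject_le f (P.factorThru f h) (P.factorThru_arrow f h)

lemma imageSubobject_epi_comp_mono {X Y Z : C} (e : X ⟶ Y) [Epi e] (m : Y ⟶ Z) [Mono m] :
    imageSubobject (e ≫ m) = Subobject.mk m := by
  refine le_antisymm ((imageSubobject_le_iff _ _).2 ((Subobject.mk_factors_iff _ _).2 ⟨e, rfl⟩)) ?_
  have h : (imageSubobject (e ≫ m)).Factors m := by
    refine factors_of_epi_comp e ?_
    exact (imageSubobject_le_iff _ _).1 le_rfl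
  exact Subobject.mk_le_of_comm _ (Subobject.factorThru_arrow _ _ h)

lemma imageSubobject_of_epi {X Y : C} (e : X ⟶ Y) [Epi e] : imageSubobject e = ⊤ := by
  have h : (imageSubobject e).Factors (𝟙 Y) := by
    refine factors_of_epi_comp e ?_
    rw [Category.comp_id]
    exact (imageSubobject_le_iff _ _).1 le_rfl
  have h' := Subobject.factors_of_factors_right (⊤ : Subobject Y).arrow h
  exact top_le_iff.1 (Subobject.le_of_comm _ ((Subobject.factorThru_arrow _ _ h').trans
    (Category.comp_id _)))

omit [Abelian C] in
lemma isZero_mk {X Y : C} (m : X ⟶ Y) [Mono m] (h : IsZero X) :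
    IsZero ((Subobject.mk m : Subobject Y) : C) := h.of_iso (Subobject.underlyingIso m)

namespace FilteredObj

variable {A B : FilteredObj C}

/-- The graded pieces, computed with any representatives of the subobjects of the filtration. -/
def grIso (A : FilteredObj C) (i : ℤ) {X Y : C} (m : X ⟶ A.obj) (n : Y ⟶ A.obj) [Mono m] [Mono n]
    (hm : A.W (i - 1) = Subobject.mk m) (hn : A.W i = Subobject.mk n) (u : X ⟶ Y) (hu : u ≫ n = m) :
    A.gr i ≅ cokernel u :=
  cokernel.mapIso _ _ (Subobject.isoOfEqMk _ m hm) (Subobject.isoOfEqMk _ n hn) (by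
    rw [← cancel_mono n]
    simp [hu])

variable (f : A ⟶ B)

/-- The morphism induced between the members of the filtrations. -/
def mapW (i : ℤ) : (A.W i : C) ⟶ (B.W i : C) := (B.W i).factorThru _ (f.factors i)

omit [Abelian C] in
lemma mapW_arrow (i : ℤ) : mapW f i ≫ (B.W i).arrow = (A.W i).arrow ≫ f.hom :=
  Subobject.factorThru_arrow _ _ _

/-- The inclusion of a member of the filtration into another one. -/
def incl (A : FilteredObj C) {i j : ℤ} (h : i ≤ j) : (A.W i : C) ⟶ (A.W j : C) :=
  Subobject.ofLE _ _ (A.monotone h)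

instance {i j : ℤ} (h : i ≤ j) : Mono (A.incl h) := inferInstanceAs (Mono (Subobject.ofLE _ _ _))

omit [Abelian C] in
lemma incl_arrow {i j : ℤ} (h : i ≤ j) : A.incl h ≫ (A.W j).arrow = (A.W i).arrow :=
  Subobject.ofLE_arrow _

omit [Abelian C] in
lemma incl_arrow_assoc {i j : ℤ} (h : i ≤ j) {X : C} (g : A.obj ⟶ X) :
    A.incl h ≫ (A.W j).arrow ≫ g = (A.W i).arrow ≫ g := by
  rw [← Category.assoc, incl_arrow]

omit [Abelian C] in
lemma mapW_incl {i j : ℤ} (h : i ≤ j) : mapW f i ≫ B.incl h = A.incl h ≫ mapW f j := by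
  rw [← cancel_mono (B.W j).arrow, Category.assoc, incl_arrow, Category.assoc, mapW_arrow,
    mapW_arrow, incl_arrow_assoc]

/-- The extension of the graded piece of index `i` by the preceding member of the filtration. -/
def grSeq (A : FilteredObj C) (i : ℤ) : ShortComplex C :=
  ShortComplex.mk (A.incl (sub_one_lt i).le) (cokernel.π (A.incl (sub_one_lt i).le))
    (cokernel.condition (A.incl (sub_one_lt i).le))

lemma shortExact_grSeq (A : FilteredObj C) (i : ℤ) : (A.grSeq i).ShortExact where
  exact := ShortComplex.exact_cokernel _
  mono_f := inferInstanceAs (Mono (A.incl (sub_one_lt i).le))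
  epi_g := coequalizer.π_epi

/-- The morphism of extensions induced by a morphism of filtered objects. -/
def grSeqMap (i : ℤ) : A.grSeq i ⟶ B.grSeq i where
  τ₁ := mapW f (i - 1)
  τ₂ := mapW f i
  τ₃ := cokernel.map (A.incl (sub_one_lt i).le) (B.incl (sub_one_lt i).le) (mapW f (i - 1))
    (mapW f i) (mapW_incl f (sub_one_lt i).le).symm
  comm₁₂ := mapW_incl f (sub_one_lt i).le
  comm₂₃ := (cokernel.π_desc _ _ _).symm

/-- The inclusion of the kernel of a restriction of `f` into the kernel of `f`. -/
def kerMap (i : ℤ) : kernel (mapW f i) ⟶ kernel f.hom :=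
  kernel.map _ _ (A.W i).arrow (B.W i).arrow (mapW_arrow f i)

instance (i : ℤ) : Mono (kerMap f i) := by
  have : Mono (kerMap f i ≫ kernel.ι f.hom) := by
    rw [kerMap, kernel.map, kernel.lift_ι]
    infer_instance
  exact mono_of_mono _ (kernel.ι f.hom)

lemma ker_W_eq (i : ℤ) : (ker f).W i = Subobject.mk (kerMap f i) := by
  have hk : kerMap f i ≫ kernel.ι f.hom = kernel.ι (mapW f i) ≫ (A.W i).arrow :=
    kernel.lift_ι _ _ _
  have sq := Subobject.isPullback (kernel.ι f.hom) (A.W i)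
  change (Subobject.pullback (kernel.ι f.hom)).obj (A.W i) = Subobject.mk (kerMap f i)
  refine le_antisymm (Subobject.le_mk_of_comm (kernel.lift _ (Subobject.pullbackπ _ _) ?_) ?_)
    (Subobject.mk_le_of_comm (sq.lift (kernel.ι (mapW f i)) (kerMap f i) hk.symm)
      (sq.lift_snd _ _ _))
  · rw [← cancel_mono (B.W i).arrow, Category.assoc, mapW_arrow, ← Category.assoc, sq.w,
      Category.assoc, kernel.condition, comp_zero, zero_comp]
  · rw [← cancel_mono (kernel.ι f.hom), Category.assoc, hk, kernel.lift_ι_assoc]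
    exact sq.w

/-- The morphism from the cokernel of a restriction of `f` to the cokernel of `f`. -/
def cokerMap (i : ℤ) : cokernel (mapW f i) ⟶ cokernel f.hom :=
  cokernel.map _ _ (A.W i).arrow (B.W i).arrow (mapW_arrow f i)

lemma π_cokerMap (i : ℤ) :
    cokernel.π (mapW f i) ≫ cokerMap f i = (B.W i).arrow ≫ cokernel.π f.hom := cokernel.π_desc _ _ _

/-- The morphism induced between the graded pieces. -/
def grMap (i : ℤ) : A.gr i ⟶ B.gr i := (grSeqMap f i).τ₃

/-- The inclusion of the kernel of one restriction of `f` into the kernel of the next one. -/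
def kerIncl (i : ℤ) : kernel (mapW f (i - 1)) ⟶ kernel (mapW f i) :=
  kernel.map _ _ (A.incl (sub_one_lt i).le) (B.incl (sub_one_lt i).le)
    (mapW_incl f (sub_one_lt i).le)

lemma kerIncl_kerMap (i : ℤ) : kerIncl f i ≫ kerMap f i = kerMap f (i - 1) := by
  rw [← cancel_mono (kernel.ι f.hom)]
  simp [kerMap, kerIncl, incl_arrow]

/-- The morphism from the cokernel of one restriction of `f` to the cokernel of the next one. -/
def cokerIncl (i : ℤ) : cokernel (mapW f (i - 1)) ⟶ cokernel (mapW f i) :=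
  cokernel.map _ _ (A.incl (sub_one_lt i).le) (B.incl (sub_one_lt i).le)
    (mapW_incl f (sub_one_lt i).le)

lemma cokerIncl_cokerMap (i : ℤ) : cokerIncl f i ≫ cokerMap f i = cokerMap f (i - 1) := by
  rw [← cancel_epi (cokernel.π (mapW f (i - 1)))]
  simp [cokerMap, cokerIncl, incl_arrow_assoc]

lemma coker_W_eq (i : ℤ) [Mono (cokerMap f i)] :
    (coker f).W i = Subobject.mk (cokerMap f i) := by
  rw [← imageSubobject_epi_comp_mono (cokernel.π (mapW f i)), π_cokerMap]
  rfl

end FilteredObj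

end Subobjects

/-! ### Strictness -/

section Strictness

universe v u

variable {C : Type u} [Category.{v} C] [Abelian C]

/-- The formal properties of the semistable bundles of integral slopes that are responsible for the
strictness of morphisms: objects of type `i` form an abelian subcategory that is closed under
extensions, and there are no morphisms from larger to smaller types. -/
structure IsPureFamily (T : ℤ → C → Prop) : Prop where
  of_isZero : ∀ {X : C} (_ : IsZero X) (i : ℤ), T i X
  of_iso : ∀ {X Y : C} {i : ℤ} (_ : T i X) (_ : X ≅ Y), T i Y
  hom_eq_zero : ∀ {X Y : C} {i j : ℤ} (_ : T i X) (_ : T j Y) (_ : j < i) (f : X ⟶ Y), f = 0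
  kernel : ∀ {X Y : C} {i : ℤ} (_ : T i X) (_ : T i Y) (f : X ⟶ Y), T i (kernel f)
  cokernel : ∀ {X Y : C} {i : ℤ} (_ : T i X) (_ : T i Y) (f : X ⟶ Y), T i (cokernel f)
  of_shortExact : ∀ {S : ShortComplex C} {i : ℤ} (_ : S.ShortExact) (_ : T i S.X₁)
    (_ : T i S.X₃), T i S.X₂

/-- A finite filtration whose graded piece of index `i` is of type `i`. -/
structure IsMixed (T : ℤ → C → Prop) (A : FilteredObj C) : Prop where
  eventually_zero : ∃ a : ℤ, IsZero (A.W a : C)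
  eventually_top : ∃ b : ℤ, A.W b = ⊤
  gr : ∀ i, T i (A.gr i)

namespace FilteredObj

omit [Abelian C] in
lemma isZero_of_le [HasZeroMorphisms C] {A : FilteredObj C} {i j : ℤ} (h : i ≤ j)
    (hj : IsZero (A.W j : C)) : IsZero (A.W i : C) := hj.of_mono (A.incl h)

omit [Abelian C] in
lemma eq_top_of_le {A : FilteredObj C} {i j : ℤ} (h : i ≤ j) (hi : A.W i = ⊤) : A.W j = ⊤ :=
  top_le_iff.1 (hi ▸ A.monotone h)

end FilteredObj

namespace IsMixed

open FilteredObj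

variable {T : ℤ → C → Prop} (hT : IsPureFamily T) {A B : FilteredObj C} (hA : IsMixed T A)
  (hB : IsMixed T B) (f : A ⟶ B)

/-- There are no morphisms from objects of type larger than `i` to `Q`. -/
def HomVanishes (T : ℤ → C → Prop) (i : ℤ) (Q : C) : Prop :=
  ∀ (j : ℤ) (P : C), i < j → T j P → ∀ g : P ⟶ Q, g = 0

include hT hA hB

lemma exists_rows_of_homVanishes (i : ℤ)
    (h : HomVanishes T (i - 1) (cokernel (mapW f (i - 1)))) :
    (∃ (p : kernel (mapW f i) ⟶ kernel (grMap f i)) (w : kerIncl f i ≫ p = 0),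
      (ShortComplex.mk (kerIncl f i) p w).ShortExact) ∧
    ∃ (p : cokernel (mapW f i) ⟶ cokernel (grMap f i)) (w : cokerIncl f i ≫ p = 0),
      (ShortComplex.mk (cokerIncl f i) p w).ShortExact := by
  have hrows := shortExact_of_hom_eq_zero (grSeqMap f i) (A.shortExact_grSeq i)
    (B.shortExact_grSeq i) (h i _ (sub_one_lt i) (hT.kernel (hA.gr i) (hB.gr i) (grMap f i)))
  exact ⟨⟨(kernelRow (grSeqMap f i)).g, (kernelRow (grSeqMap f i)).zero, hrows.1⟩,
    (cokernelRow (grSeqMap f i)).g, (cokernelRow (grSeqMap f i)).zero, hrows.2⟩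

lemma homVanishes_step (i : ℤ) (h : HomVanishes T (i - 1) (cokernel (mapW f (i - 1)))) :
    HomVanishes T i (cokernel (mapW f i)) := by
  intro j P hj hP g
  obtain ⟨p, w, hrow⟩ := (exists_rows_of_homVanishes hT hA hB f i h).2
  have hg : g ≫ p = 0 := hT.hom_eq_zero hP (hT.cokernel (hA.gr i) (hB.gr i) (grMap f i)) hj _
  have := hrow.mono_f
  have h1 : hrow.exact.lift g hg ≫ cokerIncl f i = g := hrow.exact.lift_f g hg
  rw [← h1, h j P (by linarith) hP (hrow.exact.lift g hg)]
  exact zero_comp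

/-- The cokernel of the restriction of `f` to `W i` is an iterated extension of objects of types at
most `i`. -/
lemma homVanishes (i : ℤ) : HomVanishes T i (cokernel (mapW f i)) := by
  obtain ⟨a, ha⟩ := hB.eventually_zero
  have h0 : ∀ i ≤ a, HomVanishes T i (cokernel (mapW f i)) := fun i hi j P _ _ g =>
    ((isZero_of_le hi ha).of_epi (cokernel.π (mapW f i))).eq_of_tgt _ _
  rcases le_total i a with hi | hi
  · exact h0 i hi
  induction i, hi using Int.leInduction with
  | base => exact h0 a le_rfl
  | succ i _ ih =>
    refine homVanishes_step hT hA hB f (i + 1) ?_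
    rwa [add_sub_cancel_right]

/-- The kernels of the restrictions of `f` and of the graded pieces of `f` form exact sequences, and
so do the cokernels. -/
lemma exists_rows (i : ℤ) :
    (∃ (p : kernel (mapW f i) ⟶ kernel (grMap f i)) (w : kerIncl f i ≫ p = 0),
      (ShortComplex.mk (kerIncl f i) p w).ShortExact) ∧
    ∃ (p : cokernel (mapW f i) ⟶ cokernel (grMap f i)) (w : cokerIncl f i ≫ p = 0),
      (ShortComplex.mk (cokerIncl f i) p w).ShortExact :=
  exists_rows_of_homVanishes hT hA hB f i (homVanishes hT hA hB f (i - 1))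

lemma mono_cokerMap (i : ℤ) : Mono (cokerMap f i) := by
  obtain ⟨a, ha⟩ := hA.eventually_top
  obtain ⟨b, hb⟩ := hB.eventually_top
  have h0 : ∀ i, max a b ≤ i → Mono (cokerMap f i) := by
    intro i hi
    have h1 : IsIso (A.W i).arrow :=
      (Subobject.isIso_iff_mk_eq_top _).2 (by
        rw [Subobject.mk_arrow, eq_top_of_le ((le_max_left _ _).trans hi) ha])
    have h2 : IsIso (B.W i).arrow :=
      (Subobject.isIso_iff_mk_eq_top _).2 (by
        rw [Subobject.mk_arrow, eq_top_of_le ((le_max_right _ _).trans hi) hb])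
    have : cokerMap f i = (cokernel.mapIso (mapW f i) f.hom (asIso (A.W i).arrow)
      (asIso (B.W i).arrow) (mapW_arrow f i)).hom := rfl
    rw [this]
    infer_instance
  rcases le_total (max a b) i with hi | hi
  · exact h0 i hi
  induction i, hi using Int.leInductionDown with
  | base => exact h0 _ le_rfl
  | pred i _ ih =>
    obtain ⟨p, w, hrow⟩ := (exists_rows hT hA hB f i).2
    have : Mono (cokerIncl f i) := hrow.mono_f
    rw [← cokerIncl_cokerMap]
    exact mono_comp _ _

/-- Morphisms of mixed objects are strict. -/
lemma strict (i : ℤ) :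
    imageSubobject ((A.W i).arrow ≫ f.hom) = imageSubobject f.hom ⊓ B.W i := by
  refine le_antisymm (le_inf (imageSubobject_comp_le _ _)
    ((imageSubobject_le_iff _ _).2 (f.factors i))) ?_
  have := mono_cokerMap hT hA hB f i
  let X := imageSubobject f.hom ⊓ B.W i
  let t : (X : C) ⟶ (B.W i : C) := Subobject.ofLE _ _ inf_le_right
  have ht : t ≫ (B.W i).arrow = X.arrow := Subobject.ofLE_arrow _
  have h1 : X.arrow ≫ cokernel.π f.hom = 0 := by
    have h2 : Subobject.ofLE X (imageSubobject f.hom) inf_le_left ≫ (imageSubobject f.hom).arrow =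
      X.arrow := Subobject.ofLE_arrow _
    rw [← h2, Category.assoc, imageSubobject_arrow_comp_eq_zero (cokernel.condition f.hom),
      comp_zero]
  have h3 : t ≫ cokernel.π (mapW f i) = 0 := by
    rw [← cancel_mono (cokerMap f i), Category.assoc, π_cokerMap, ← Category.assoc, ht, h1,
      zero_comp]
  have h4 : (imageSubobject ((A.W i).arrow ≫ f.hom)).Factors
      (Abelian.image.ι (mapW f i) ≫ (B.W i).arrow) := by
    refine factors_of_epi_comp (Abelian.factorThruImage (mapW f i)) ?_
    rw [← Category.assoc, Abelian.image.fac, mapW_arrow]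
    exact (imageSubobject_le_iff _ _).1 le_rfl
  refine Subobject.le_of_comm ((imageSubobject ((A.W i).arrow ≫ f.hom)).factorThru X.arrow ?_)
    (Subobject.factorThru_arrow _ _ _)
  have h5 : kernel.lift _ t h3 ≫ Abelian.image.ι (mapW f i) = t := kernel.lift_ι _ _ _
  rw [← ht, ← h5, Category.assoc]
  exact Subobject.factors_of_factors_right _ h4

lemma ker : IsMixed T (FilteredObj.ker f) where
  eventually_zero := by
    obtain ⟨a, ha⟩ := hA.eventually_zero
    refine ⟨a, ?_⟩
    rw [ker_W_eq]
    exact isZero_mk (kerMap f a) (ha.of_mono (kernel.ι _))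
  eventually_top := by
    obtain ⟨b, hb⟩ := hA.eventually_top
    refine ⟨b, ?_⟩
    change (Subobject.pullback (kernel.ι f.hom)).obj (A.W b) = ⊤
    rw [hb, Subobject.pullback_top]
  gr i := by
    obtain ⟨p, w, hrow⟩ := (exists_rows hT hA hB f i).1
    have m₁ : Mono (Y := (FilteredObj.ker f).obj) (kerMap f i) :=
      inferInstanceAs (Mono (kerMap f i))
    have m₂ : Mono (Y := (FilteredObj.ker f).obj) (kerMap f (i - 1)) :=
      inferInstanceAs (Mono (kerMap f (i - 1)))
    have e := grIso (FilteredObj.ker f) i (kerMap f (i - 1)) (kerMap f i) (ker_W_eq f _)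
      (ker_W_eq f _) _ (kerIncl_kerMap f i)
    have e' : cokernel (kerIncl f i) ≅ kernel (grMap f i) :=
      IsColimit.coconePointUniqueUpToIso (colimit.isColimit _) hrow.gIsCokernel
    exact hT.of_iso (hT.kernel (hA.gr i) (hB.gr i) (grMap f i)) (e ≪≫ e').symm

lemma coker : IsMixed T (FilteredObj.coker f) where
  eventually_zero := by
    obtain ⟨a, ha⟩ := hB.eventually_zero
    have := mono_cokerMap hT hA hB f a
    refine ⟨a, ?_⟩
    rw [coker_W_eq]
    exact isZero_mk (cokerMap f a) (ha.of_epi (cokernel.π _))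
  eventually_top := by
    obtain ⟨b, hb⟩ := hB.eventually_top
    refine ⟨b, ?_⟩
    have h2 : IsIso (B.W b).arrow :=
      (Subobject.isIso_iff_mk_eq_top _).2 (by rw [Subobject.mk_arrow, hb])
    exact imageSubobject_of_epi ((B.W b).arrow ≫ cokernel.π f.hom)
  gr i := by
    obtain ⟨p, w, hrow⟩ := (exists_rows hT hA hB f i).2
    have := mono_cokerMap hT hA hB f i
    have := mono_cokerMap hT hA hB f (i - 1)
    have m₁ : Mono (Y := (FilteredObj.coker f).obj) (cokerMap f i) :=
      inferInstanceAs (Mono (cokerMap f i))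
    have m₂ : Mono (Y := (FilteredObj.coker f).obj) (cokerMap f (i - 1)) :=
      inferInstanceAs (Mono (cokerMap f (i - 1)))
    have e := grIso (FilteredObj.coker f) i (cokerMap f (i - 1)) (cokerMap f i) (coker_W_eq f _)
      (coker_W_eq f _) _ (cokerIncl_cokerMap f i)
    have e' : cokernel (cokerIncl f i) ≅ cokernel (grMap f i) :=
      IsColimit.coconePointUniqueUpToIso (colimit.isColimit _) hrow.gIsCokernel
    exact hT.of_iso (hT.cokernel (hA.gr i) (hB.gr i) (grMap f i)) (e ≪≫ e').symm

/-- A morphism of mixed objects is an isomorphism if the underlying morphism is. -/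
lemma isIso_of_isIso_hom [IsIso f.hom] : IsIso f := by
  have h : ∀ i, (A.W i).Factors ((B.W i).arrow ≫ inv f.hom) := by
    intro i
    have h1 := strict hT hA hB f i
    rw [imageSubobject_mono f.hom, (Subobject.isIso_iff_mk_eq_top f.hom).1 inferInstance,
      top_inf_eq, imageSubobject_mono] at h1
    have h2 : (Subobject.mk ((A.W i).arrow ≫ f.hom)).Factors (B.W i).arrow := by
      rw [h1]
      exact Subobject.factors_self _
    obtain ⟨u, hu⟩ := (Subobject.mk_factors_iff _ _).1 h2
    let u' : (B.W i : C) ⟶ (A.W i : C) := u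
    have hu' : u' ≫ (A.W i).arrow ≫ f.hom = (B.W i).arrow := hu
    rw [← hu', Category.assoc, Category.assoc, IsIso.hom_inv_id, Category.comp_id]
    exact Subobject.factors_comp_arrow _
  exact ⟨⟨inv f.hom, h⟩, FilteredObj.hom_ext (IsIso.hom_inv_id f.hom),
    FilteredObj.hom_ext (IsIso.inv_hom_id f.hom)⟩

end IsMixed

end Strictness

/-! ### The category of mixed objects -/

section Products

open scoped ZeroObject

universe v u

variable {C : Type u} [Category.{v} C] [Abelian C]

namespace FilteredObj

/-- The inclusion of the direct sum of the members of two filtrations. -/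
def prodArrow (A B : FilteredObj C) (i : ℤ) : (A.W i : C) ⊞ (B.W i : C) ⟶ A.obj ⊞ B.obj :=
  biprod.map (A.W i).arrow (B.W i).arrow

instance (A B : FilteredObj C) (i : ℤ) : Mono (prodArrow A B i) :=
  inferInstanceAs (Mono (biprod.map (A.W i).arrow (B.W i).arrow))

lemma map_incl_prodArrow (A B : FilteredObj C) {i j : ℤ} (h : i ≤ j) :
    biprod.map (A.incl h) (B.incl h) ≫ prodArrow A B j = prodArrow A B i := by
  dsimp only [prodArrow]
  ext <;> simp [incl_arrow]

/-- The direct sum of filtered objects. -/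
def prod (A B : FilteredObj C) : FilteredObj C where
  obj := A.obj ⊞ B.obj
  W i := Subobject.mk (prodArrow A B i)
  monotone _ _ h := Subobject.mk_le_mk_of_comm _ (map_incl_prodArrow A B h)

instance (A B : FilteredObj C) (i : ℤ) : Mono (Y := (A.prod B).obj) (prodArrow A B i) :=
  inferInstanceAs (Mono (prodArrow A B i))

variable {A B D : FilteredObj C}

/-- The first projection of a direct sum. -/
def prodFst (A B : FilteredObj C) : A.prod B ⟶ A :=
  Hom.mk biprod.fst fun i => by
    let e := Subobject.underlyingIso (prodArrow A B i)
    have h : (A.W i).Factors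
        (e.inv ≫ (Subobject.mk (prodArrow A B i)).arrow ≫ biprod.fst) := by
      rw [Subobject.underlyingIso_arrow_assoc, prodArrow, biprod.map_fst]
      exact Subobject.factors_comp_arrow _
    exact factors_of_epi_comp e.inv h

/-- The second projection of a direct sum. -/
def prodSnd (A B : FilteredObj C) : A.prod B ⟶ B :=
  Hom.mk biprod.snd fun i => by
    let e := Subobject.underlyingIso (prodArrow A B i)
    have h : (B.W i).Factors
        (e.inv ≫ (Subobject.mk (prodArrow A B i)).arrow ≫ biprod.snd) := by
      rw [Subobject.underlyingIso_arrow_assoc, prodArrow, biprod.map_snd]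
      exact Subobject.factors_comp_arrow _
    exact factors_of_epi_comp e.inv h

/-- The morphism to a direct sum with given components. -/
def prodLift (f : D ⟶ A) (g : D ⟶ B) : D ⟶ A.prod B :=
  Hom.mk (biprod.lift f.hom g.hom) fun i => by
    refine (Subobject.mk_factors_iff _ _).2 ⟨biprod.lift (mapW f i) (mapW g i), ?_⟩
    change biprod.lift (mapW f i) (mapW g i) ≫ biprod.map (A.W i).arrow (B.W i).arrow =
      (D.W i).arrow ≫ biprod.lift f.hom g.hom
    ext
    · simp [mapW_arrow]
    · simp [mapW_arrow]

/-- The split extension of one object by another. -/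
abbrev biprodSeq (X Y : C) : ShortComplex C :=
  ShortComplex.mk (biprod.inl : X ⟶ X ⊞ Y) biprod.snd biprod.inl_snd

lemma shortExact_biprodSeq (X Y : C) : (biprodSeq X Y).ShortExact :=
  (ShortComplex.Splitting.mk (S := biprodSeq X Y) biprod.fst biprod.inr (by simp) (by simp)
    (by simp)).shortExact

end FilteredObj

namespace IsMixed

open FilteredObj

variable {T : ℤ → C → Prop} (hT : IsPureFamily T) {A B : FilteredObj C}

include hT

lemma prod (hA : IsMixed T A) (hB : IsMixed T B) : IsMixed T (A.prod B) where
  eventually_zero := by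
    obtain ⟨a, ha⟩ := hA.eventually_zero
    obtain ⟨b, hb⟩ := hB.eventually_zero
    refine ⟨min a b, ?_⟩
    exact isZero_mk (prodArrow A B _) ((biprod_isZero_iff _ _).2 ⟨isZero_of_le (min_le_left _ _) ha,
      isZero_of_le (min_le_right _ _) hb⟩)
  eventually_top := by
    obtain ⟨a, ha⟩ := hA.eventually_top
    obtain ⟨b, hb⟩ := hB.eventually_top
    refine ⟨max a b, ?_⟩
    have h1 : IsIso (A.W (max a b)).arrow :=
      (Subobject.isIso_iff_mk_eq_top _).2 (by
        rw [Subobject.mk_arrow, eq_top_of_le (le_max_left _ _) ha])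
    have h2 : IsIso (B.W (max a b)).arrow :=
      (Subobject.isIso_iff_mk_eq_top _).2 (by
        rw [Subobject.mk_arrow, eq_top_of_le (le_max_right _ _) hb])
    exact (Subobject.isIso_iff_mk_eq_top (prodArrow A B (max a b))).1
      (biprod.mapIso (asIso (A.W (max a b)).arrow)
        (asIso (B.W (max a b)).arrow)).isIso_hom
  gr i := by
    let φ : biprodSeq (A.W (i - 1) : C) (B.W (i - 1) : C) ⟶ biprodSeq (A.W i : C) (B.W i : C) :=
      { τ₁ := A.incl (sub_one_lt i).le
        τ₂ := biprod.map (A.incl (sub_one_lt i).le) (B.incl (sub_one_lt i).le)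
        τ₃ := B.incl (sub_one_lt i).le
        comm₁₂ := biprod.inl_map _ _ |>.symm
        comm₂₃ := biprod.map_snd _ _ }
    have hφ : IsZero (kernel φ.τ₃) := isZero_kernel_of_mono (B.incl (sub_one_lt i).le)
    have hS := (shortExact_of_hom_eq_zero φ (shortExact_biprodSeq _ _) (shortExact_biprodSeq _ _)
      fun δ => hφ.eq_of_src _ _).2
    have e := grIso (A.prod B) i (prodArrow A B (i - 1)) (prodArrow A B i) rfl rfl φ.τ₂
      (map_incl_prodArrow A B (sub_one_lt i).le)
    exact hT.of_iso (hT.of_shortExact hS (hA.gr i) (hB.gr i)) e.symm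

lemma of_isZero (h : IsZero A.obj) : IsMixed T A where
  eventually_zero := ⟨0, h.of_mono (A.W 0).arrow⟩
  eventually_top := by
    have : IsIso (A.W 0).arrow := ⟨0, (h.of_mono (A.W 0).arrow).eq_of_src _ _, h.eq_of_src _ _⟩
    exact ⟨0, (Subobject.mk_arrow _).symm.trans ((Subobject.isIso_iff_mk_eq_top _).1 this)⟩
  gr i := hT.of_isZero ((h.of_mono (A.W i).arrow).of_epi
    (cokernel.π (Subobject.ofLE (A.W (i - 1)) (A.W i) (A.monotone (by lia))))) i

end IsMixed

end Products

/-! ### The category of mixed objects is abelian -/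

section Abelian

universe v u

variable {C : Type u} [Category.{v} C] [Abelian C] {P : ObjectProperty (FilteredObj C)}

section UniversalProperties

open FilteredObj

variable {X Y : P.FullSubcategory} (f : X ⟶ Y)

/-- The kernel with the induced filtration is the kernel in every full subcategory of filtered
objects that contains it. -/
def isLimitKer (hK : P (ker f.hom)) : IsLimit (KernelFork.ofι (f := f)
    (ObjectProperty.homMk (kerι f.hom) : (⟨ker f.hom, hK⟩ : P.FullSubcategory) ⟶ X)
    (ObjectProperty.hom_ext _ (kerι_comp f.hom))) :=
  have : Mono (ObjectProperty.homMk (kerι f.hom) : (⟨ker f.hom, hK⟩ : P.FullSubcategory) ⟶ X) :=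
    ⟨fun a b h => ObjectProperty.hom_ext _ (FilteredObj.hom_ext
      ((cancel_mono (kernel.ι f.hom.hom)).1
      (congrArg (fun k => k.hom.hom) h)))⟩
  KernelFork.IsLimit.ofι' _ _ fun {D} k hk =>
    have hk' : k.hom.hom ≫ f.hom.hom = 0 := congrArg (fun k => k.hom.hom) hk
    ⟨ObjectProperty.homMk (Hom.mk (kernel.lift f.hom.hom k.hom.hom hk') fun i => by
        have sq := Subobject.isPullback (kernel.ι f.hom.hom) (X.obj.W i)
        have h : mapW k.hom i ≫ (X.obj.W i).arrow =
            ((D.obj.W i).arrow ≫ kernel.lift f.hom.hom k.hom.hom hk') ≫ kernel.ι f.hom.hom := by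
          rw [mapW_arrow, Category.assoc, kernel.lift_ι]
        have h' : sq.lift _ _ h ≫ ((Subobject.pullback (kernel.ι f.hom.hom)).obj
            (X.obj.W i)).arrow = (D.obj.W i).arrow ≫ kernel.lift f.hom.hom k.hom.hom hk' :=
          sq.lift_snd _ _ h
        have h'' : ((Subobject.pullback (kernel.ι f.hom.hom)).obj (X.obj.W i)).Factors
            ((D.obj.W i).arrow ≫ kernel.lift f.hom.hom k.hom.hom hk') := by
          rw [← h']
          exact Subobject.factors_comp_arrow _
        exact h''),
      ObjectProperty.hom_ext _ (FilteredObj.hom_ext (kernel.lift_ι f.hom.hom k.hom.hom hk'))⟩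

/-- The cokernel with the induced filtration is the cokernel in every full subcategory of filtered
objects that contains it. -/
def isColimitCoker (hC : P (coker f.hom)) : IsColimit (CokernelCofork.ofπ (f := f)
    (ObjectProperty.homMk (cokerπ f.hom) : Y ⟶ (⟨coker f.hom, hC⟩ : P.FullSubcategory))
    (ObjectProperty.hom_ext _ (comp_cokerπ f.hom))) :=
  have : Epi (ObjectProperty.homMk (cokerπ f.hom) :
      Y ⟶ (⟨coker f.hom, hC⟩ : P.FullSubcategory)) :=
    ⟨fun a b h => ObjectProperty.hom_ext _ (FilteredObj.hom_ext
      ((cancel_epi (cokernel.π f.hom.hom)).1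
      (congrArg (fun k => k.hom.hom) h)))⟩
  CokernelCofork.IsColimit.ofπ' _ _ fun {D} k hk =>
    have hk' : f.hom.hom ≫ k.hom.hom = 0 := congrArg (fun k => k.hom.hom) hk
    ⟨ObjectProperty.homMk (Hom.mk (cokernel.desc f.hom.hom k.hom.hom hk') fun i => by
        let g : (Y.obj.W i : C) ⟶ cokernel f.hom.hom := (Y.obj.W i).arrow ≫ cokernel.π f.hom.hom
        have h : (D.obj.W i).Factors (factorThruImageSubobject g ≫ (imageSubobject g).arrow ≫
            cokernel.desc f.hom.hom k.hom.hom hk') := by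
          rw [imageSubobject_arrow_comp_assoc, Category.assoc, cokernel.π_desc]
          exact k.hom.factors i
        exact factors_of_epi_comp (factorThruImageSubobject g) h),
      ObjectProperty.hom_ext _ (FilteredObj.hom_ext (cokernel.π_desc f.hom.hom k.hom.hom hk'))⟩

variable (X Y)

/-- The direct sum is the product in every full subcategory of filtered objects that contains
it. -/
def isLimitProd (h : P (X.obj.prod Y.obj)) : IsLimit (BinaryFan.mk
    (ObjectProperty.homMk (prodFst X.obj Y.obj) : (⟨_, h⟩ : P.FullSubcategory) ⟶ X)
    (ObjectProperty.homMk (prodSnd X.obj Y.obj) : (⟨_, h⟩ : P.FullSubcategory) ⟶ Y)) :=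
  BinaryFan.isLimitMk (fun s => ObjectProperty.homMk (prodLift s.fst.hom s.snd.hom))
    (fun _ => ObjectProperty.hom_ext _ (FilteredObj.hom_ext (biprod.lift_fst _ _)))
    (fun _ => ObjectProperty.hom_ext _ (FilteredObj.hom_ext (biprod.lift_snd _ _)))
    fun _ _ h₁ h₂ => ObjectProperty.hom_ext _ (FilteredObj.hom_ext (biprod.hom_ext _ _
      ((congrArg (fun k => k.hom.hom) h₁).trans (biprod.lift_fst _ _).symm)
      ((congrArg (fun k => k.hom.hom) h₂).trans (biprod.lift_snd _ _).symm)))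

end UniversalProperties

/-- The functor that forgets the filtrations. -/
def forgetFiltration (P : ObjectProperty (FilteredObj C)) : P.FullSubcategory ⥤ C where
  obj X := X.obj.obj
  map f := f.hom.hom

instance : (forgetFiltration P).PreservesZeroMorphisms where
  map_zero _ _ := rfl

namespace IsMixed

variable {T : ℤ → C → Prop} (hT : IsPureFamily T) (hP : ∀ A, P A ↔ IsMixed T A)

include hT hP

lemma prop_ker {X Y : P.FullSubcategory} (f : X ⟶ Y) : P (FilteredObj.ker f.hom) :=
  (hP _).2 (ker hT ((hP _).1 X.property) ((hP _).1 Y.property) f.hom)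

lemma prop_coker {X Y : P.FullSubcategory} (f : X ⟶ Y) : P (FilteredObj.coker f.hom) :=
  (hP _).2 (coker hT ((hP _).1 X.property) ((hP _).1 Y.property) f.hom)

lemma hasKernels : HasKernels P.FullSubcategory where
  has_limit f := ⟨⟨_, isLimitKer f (prop_ker hT hP f)⟩⟩

lemma hasCokernels : HasCokernels P.FullSubcategory where
  has_colimit f := ⟨⟨_, isColimitCoker f (prop_coker hT hP f)⟩⟩

lemma hasFiniteProducts : HasFiniteProducts P.FullSubcategory := by
  have h₁ : ∀ {X Y : P.FullSubcategory}, HasLimit (pair X Y) := fun {X Y} =>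
    ⟨⟨_, isLimitProd X Y ((hP _).2 (prod hT ((hP _).1 X.property) ((hP _).1 Y.property)))⟩⟩
  have := hasBinaryProducts_of_hasLimit_pair P.FullSubcategory
  open scoped ZeroObject in
  let Z : FilteredObj C := ⟨0, fun _ => ⊤, fun _ _ _ => le_rfl⟩
  have hZ : IsZero Z.obj := isZero_zero C
  let Z' : P.FullSubcategory := ⟨Z, (hP _).2 (of_isZero hT hZ)⟩
  have : HasZeroObject P.FullSubcategory := ⟨Z', (IsZero.iff_id_eq_zero Z').2
    (ObjectProperty.hom_ext _ (FilteredObj.hom_ext (hZ.eq_of_src _ _)))⟩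
  have : HasTerminal P.FullSubcategory := HasZeroObject.hasTerminal
  exact hasFiniteProducts_of_has_binary_and_terminal

lemma preservesKernel {X Y : P.FullSubcategory} (f : X ⟶ Y) :
    PreservesLimit (parallelPair f 0) (forgetFiltration P) :=
  preservesLimit_of_preserves_limit_cone (isLimitKer f (prop_ker hT hP f))
    ((isLimitMapConeForkEquiv' (forgetFiltration P) _).symm
      (kernelIsKernel ((forgetFiltration P).map f)))

lemma preservesCokernel {X Y : P.FullSubcategory} (f : X ⟶ Y) :
    PreservesColimit (parallelPair f 0) (forgetFiltration P) :=
  preservesColimit_of_preserves_colimit_cocone (isColimitCoker f (prop_coker hT hP f))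
    ((isColimitMapCoconeCoforkEquiv' (forgetFiltration P) _).symm
      (cokernelIsCokernel ((forgetFiltration P).map f)))

/-- The underlying morphism of the comparison of the coimage with the image is the comparison in
the ambient abelian category. -/
lemma isIso_coimageImageComparison [HasKernels P.FullSubcategory] [HasCokernels P.FullSubcategory]
    {X Y : P.FullSubcategory} (f : X ⟶ Y) : IsIso (Abelian.coimageImageComparison f) := by
  have h₁ := fun {X Y : P.FullSubcategory} (f : X ⟶ Y) => preservesKernel hT hP f
  have h₂ := fun {X Y : P.FullSubcategory} (f : X ⟶ Y) => preservesCokernel hT hP f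
  have e := Abelian.PreservesCoimageImageComparison.iso (forgetFiltration P) f
  have : IsIso ((forgetFiltration P).map (Abelian.coimageImageComparison f)) :=
    ((MorphismProperty.isomorphisms C).arrow_mk_iso_iff e).2
      (inferInstanceAs (IsIso (Abelian.coimageImageComparison ((forgetFiltration P).map f))))
  have h₃ : IsIso (Abelian.coimageImageComparison f).hom.hom := this
  exact (ObjectProperty.isIso_hom_iff _).1 (isIso_of_isIso_hom hT
    ((hP _).1 (Abelian.coimage f).property) ((hP _).1 (Abelian.image f).property) _)

end IsMixed

end Abelian

/-! ### Mixed twistor structures -/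

section MixedTwistor

open scoped ZeroObject

/-- Semistable bundles of slope `i` form an abelian category. -/
lemma isPureFamily_isSemistableOfSlope : IsPureFamily fun i E => IsSemistableOfSlope E i where
  of_isZero := IsSemistableOfSlope.of_isZero
  of_iso := IsSemistableOfSlope.of_iso
  hom_eq_zero := IsSemistableOfSlope.hom_eq_zero
  kernel := IsSemistableOfSlope.isSemistable_kernel
  cokernel := IsSemistableOfSlope.isSemistable_cokernel
  of_shortExact := IsSemistableOfSlope.of_shortExact

variable {A : FilteredObj Mod}

lemma IsMixed.isBundle_W (hA : IsMixed (fun i E => IsSemistableOfSlope E i) A) (i : ℤ) :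
    IsBundle (A.W i : Mod) := by
  obtain ⟨a, ha⟩ := hA.eventually_zero
  rcases le_total i a with hi | hi
  · exact isBundle_zero (FilteredObj.isZero_of_le hi ha)
  induction i, hi using Int.leInduction with
  | base => exact isBundle_zero ha
  | succ i _ ih =>
    have hS := A.shortExact_grSeq (i + 1)
    refine IsBundle.of_shortExact hS ?_ (hA.gr (i + 1)).isBundle
    have h : i + 1 - 1 = i := by ring
    change IsBundle (A.W (i + 1 - 1) : Mod)
    rwa [h]

lemma IsMixed.isBundle_quotient (hA : IsMixed (fun i E => IsSemistableOfSlope E i) A) (i : ℤ) :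
    IsBundle (cokernel (A.W i).arrow) := by
  obtain ⟨b, hb⟩ := hA.eventually_top
  have h₀ : ∀ i, b ≤ i → IsBundle (cokernel (A.W i).arrow) := fun i hi => by
    have : IsIso (A.W i).arrow := (Subobject.isIso_iff_mk_eq_top _).2 (by
      rw [Subobject.mk_arrow, FilteredObj.eq_top_of_le hi hb])
    exact isBundle_zero (isZero_cokernel_of_epi _)
  rcases le_total b i with hi | hi
  · exact h₀ i hi
  induction i, hi using Int.leInductionDown with
  | base => exact h₀ b le_rfl
  | pred i _ ih =>
    -- The quotient by `W (i - 1)` is an extension of the quotient by `W i` by a graded piece.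
    let S : ShortComplex Mod := ShortComplex.mk (𝟙 (A.W (i - 1) : Mod))
      (0 : (A.W (i - 1) : Mod) ⟶ (0 : Mod)) comp_zero
    have hS : S.ShortExact :=
      { exact := (ShortComplex.exact_iff_epi S rfl).2 (inferInstanceAs (Epi (𝟙 _)))
        mono_f := inferInstanceAs (Mono (𝟙 _))
        epi_g := (isZero_zero Mod).epi _ }
    let Q : ShortComplex Mod := ShortComplex.mk (A.W i).arrow (cokernel.π (A.W i).arrow)
      (cokernel.condition _)
    have hQ : Q.ShortExact :=
      { exact := ShortComplex.exact_cokernel _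
        mono_f := inferInstanceAs (Mono (A.W i).arrow)
        epi_g := coequalizer.π_epi }
    let φ : S ⟶ Q :=
      { τ₁ := A.incl (sub_one_lt i).le
        τ₂ := (A.W (i - 1)).arrow
        τ₃ := 0
        comm₁₂ := (A.incl_arrow _).trans (Category.id_comp _).symm
        comm₂₃ := by
          rw [← A.incl_arrow (sub_one_lt i).le, Category.assoc]
          exact (congrArg _ (cokernel.condition _)).trans (comp_zero.trans comp_zero.symm) }
    have hφ : IsZero (kernel φ.τ₃) := (isZero_zero Mod).of_mono (kernel.ι φ.τ₃)
    exact IsBundle.of_shortExact (shortExact_of_hom_eq_zero φ hS hQ fun δ => hφ.eq_of_src _ _).2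
      (hA.gr i).isBundle (ih.of_iso cokernelZeroIsoTarget.symm)

/-- The members of the filtration and the quotients by them are iterated extensions of graded
pieces, so that they are bundles as soon as the graded pieces are. -/
lemma isMixedTwistorStructure_iff : IsMixedTwistorStructure A ↔
    IsMixed (fun i E => IsSemistableOfSlope E i) A := by
  refine ⟨fun h => ⟨h.eventually_zero, h.eventually_top, h.isSemistableOfSlope_gr⟩, fun h => ?_⟩
  refine ⟨?_, h.eventually_zero, h.eventually_top, h.isBundle_W, h.isBundle_quotient, h.gr⟩
  obtain ⟨b, hb⟩ := h.eventually_top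
  have : IsIso (A.W b).arrow := (Subobject.isIso_iff_mk_eq_top _).2 (by
    rw [Subobject.mk_arrow, hb])
  exact (h.isBundle_W b).of_iso (asIso (A.W b).arrow)

end MixedTwistor

end Twistor

end

theorem mainTheorem4 :
    -- the category of mixed twistor structures is abelian, for the usual addition of morphisms
    (∃ A : Abelian Twistor.MixedTwistorStructure,
        A.toPreadditive = Twistor.MixedTwistorStructure.preadditive) ∧
    -- the sheaf kernel with the induced filtration is a mixed twistor structure, and the kernel
    (∀ (X Y : Twistor.MixedTwistorStructure) (f : X ⟶ Y),
      ∃ hK : Twistor.IsMixedTwistorStructure (Twistor.FilteredObj.ker f.hom),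
        Nonempty (IsLimit (KernelFork.ofι (f := f)
          (ObjectProperty.homMk (Twistor.FilteredObj.kerι f.hom) :
            (⟨Twistor.FilteredObj.ker f.hom, hK⟩ : Twistor.MixedTwistorStructure) ⟶ X)
          (ObjectProperty.hom_ext _ (Twistor.FilteredObj.kerι_comp f.hom))))) ∧
    -- the sheaf cokernel with the induced filtration is a mixed twistor structure, and the cokernel
    (∀ (X Y : Twistor.MixedTwistorStructure) (f : X ⟶ Y),
      ∃ hC : Twistor.IsMixedTwistorStructure (Twistor.FilteredObj.coker f.hom),
        Nonempty (IsColimit (CokernelCofork.ofπ (f := f)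
          (ObjectProperty.homMk (Twistor.FilteredObj.cokerπ f.hom) :
            Y ⟶ (⟨Twistor.FilteredObj.coker f.hom, hC⟩ : Twistor.MixedTwistorStructure))
          (ObjectProperty.hom_ext _ (Twistor.FilteredObj.comp_cokerπ f.hom))))) ∧
    -- the canonical morphism from the coimage to the image is an isomorphism
    (∃ (_ : HasKernels Twistor.MixedTwistorStructure)
        (_ : HasCokernels Twistor.MixedTwistorStructure),
      ∀ (X Y : Twistor.MixedTwistorStructure) (f : X ⟶ Y),
        IsIso (Abelian.coimageImageComparison f)) ∧
    -- morphisms are strict: `f(W i) = f(E) ∩ W' i`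
    (∀ (X Y : Twistor.MixedTwistorStructure) (f : X ⟶ Y) (i : ℤ),
      imageSubobject ((X.obj.W i).arrow ≫ f.hom.hom) =
        imageSubobject f.hom.hom ⊓ Y.obj.W i) := by
  have hT := Twistor.isPureFamily_isSemistableOfSlope
  have hP := fun A => Twistor.isMixedTwistorStructure_iff (A := A)
  have hK := Twistor.IsMixed.hasKernels hT hP
  have hC := Twistor.IsMixed.hasCokernels hT hP
  have hF := Twistor.IsMixed.hasFiniteProducts hT hP
  have hI : ∀ {X Y : Twistor.MixedTwistorStructure} (f : X ⟶ Y),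
      IsIso (Abelian.coimageImageComparison f) :=
    Twistor.IsMixed.isIso_coimageImageComparison hT hP
  refine ⟨⟨Abelian.ofCoimageImageComparisonIsIso, rfl⟩, fun X Y f => ?_, fun X Y f => ?_,
    ⟨hK, hC, fun X Y f => hI f⟩, fun X Y f i => ?_⟩
  · exact ⟨Twistor.IsMixed.prop_ker hT hP f, ⟨Twistor.isLimitKer f _⟩⟩
  · exact ⟨Twistor.IsMixed.prop_coker hT hP f, ⟨Twistor.isColimitCoker f _⟩⟩
  · exact Twistor.IsMixed.strict hT ((hP _).1 X.property) ((hP _).1 Y.property) f.hom i
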